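/- Let $d\ge 1$, let $S$ be a Polish space and $E=S\times\mathbb R^d$. Let $\mu_N$ ($N\in\mathbb N$) and $\mu=\mu_\infty$ be Borel probability measures on $E$ such that $\mu_N\to\mu$ weakly and $\operatorname{supp}\mu_N\subseteq\operatorname{supp}\mu$ for all $N$. For $N\in\mathbb N\cup\{\infty\}$ let $\nu_N$ be the image of $\mu_N$ under the projection onto $S$ and $m^N_s$, $s\in S$, the conditional distributions on $\mathbb R^d$, so that $\mu_N(A)=\int_S\int_{\mathbb R^d}\mathbb 1_A(s,x)\,dm^N_s(x)\,d\nu_N(s)$; write $\nu=\nu_\infty$, $m_s=m_s^\infty$. **Quantities.** A measurable $\varphi:\mathbb R^d\to[0,1]$ is called primal if $\varphi=0$ off $[-2,2]^d$, $\int\varphi\,dx=1$ and $\sum_{\alpha\in\mathbb Z^d}\varphi(x-\alpha)=1$ for all $x$; let $\mathscr C$ be the set of primal functions and, for $r>0$ and $\alpha\in r\mathbb Z^d$, $\varphi^\alpha_r(x)=\varphi((x-\alpha)/r)$. For integrable $g\ge 0$ on $\mathbb R^d$ put $$R^{\varphi,\eta}_r(g)(y)=\sum_{\alpha\in r\mathbb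 Z^d}r^{-d}\int|g(y)-g(x)|\,\eta_r^\alpha(x)\,dx\;\varphi^\alpha_r(y),\qquad I^{\varphi,\eta}_r(g)(y)=\sum_{\alpha\in r\mathbb Z^d}r^{-d}\int\eta_r^\alpha(x)\,g(x)\,dx\;\varphi_r^\alpha(y).$$ For a probability measure $m=\varrho\,dx$ and measurable $\kappa:\mathbb R^d\to[0,1]$ put $$\delta_r^\kappa(m)=\sup_{\varphi,\eta\in\mathscr C}\sup_f\frac{|\int f\,R_r^{\varphi,\eta}(\kappa\varrho)\,dx|}{\|f\|_{L^2(m)}},\qquad C_r^\kappa(m)=\sup_{\varphi,\eta\in\mathscr C}\sup_f\frac{|\int f\,I_r^{\varphi,\eta}(\kappa\varrho)\,dx|}{\|f\|_{L^1(m)}},$$ where $f$ runs over the bounded measurable functions, with $1/0=\infty$ and $0\cdot\infty=0$. **Hamza's condition.** For every $N\in\mathbb N\cup\{\infty\}$: for $\nu_N$-a.e. $s$ the measure $m^N_s$ has a Lebesgue density $\varrho_N(s,\cdot)$, and $$\int_S m^N_s\Big(\Big\{x\;\Big|\;\int_{x+[-\varepsilon,\varepsilon]^d}\varrho_N(s,y)^{-1}\,dy<\infty\text{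 for some }\varepsilon>0\Big\}\Big)\,d\nu_N(s)=1.$$ **Forms.** Let $\mathscr D$ be the set of bounded continuous functions on $\mathbb R^d$ whose first weak partial derivatives exist and are in $L^\infty(dx)$. For measurable $\kappa:E\to[0,1]$ let $(\mathcal E^{N,\kappa},\mathcal D(\mathcal E^{N,\kappa}))$ be the smallest closed extension in $L^2(E,\kappa\mu_N)$ of $$\mathcal E^{N,\kappa}(u,v)=\int_S\int_{\mathbb R^d}\sum_{i=1}^d\partial_{x_i}u(s,x)\,\partial_{x_i}v(s,x)\,\kappa(s,x)\varrho_N(s,x)\,dx\,d\nu_N(s),$$ defined on the classes of bounded measurable $u$ on $E$ with $u(s,\cdot)\in\mathscr D$ for all $s$ for which the inner integral with $v=u$ is a $\nu_N$-integrable function of $s$. Let $\mathcal D_{\min}(\mathcal E^{\infty,\kappa})$ be the closure in $\mathcal D(\mathcal E^{\infty,\kappa})$, for the norm $(\mathcal E^{\infty,\kappa}(u,u)+\|u\|^2_{L^2(\kappa\mu)})^{1/2}$, of the linear span of the functions $f(s)g(x)$, $f\in C_b(S)$, $g\in C^1_c(\mathbb R^d)$. Write $\mathcal E^N=\mathcal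 E^{N,1}$ and $\mathcal E=\mathcal E^{\infty,1}$. **Condition on the sequence.** (i) $\lim_{N\to\infty}\int_S\big|\int g(s,\cdot)\,dm^N_s\big|^2d\nu_N(s)=\int_S\big|\int g(s,\cdot)\,dm_s\big|^2d\nu(s)$ for all $g\in C_b(E)$. (ii) There is an at most countable set $\mathscr U$ of continuous functions $E\to[0,1]$ such that for each $\kappa\in\mathscr U$ $$\lim_{n\to\infty}\sup_{N\in\mathbb N}\big\|\delta_{1/n}^{\kappa(s,\cdot)}(m^N_s)\big\|_{L^2(\nu_N)}=0,\qquad\limsup_{n\to\infty}\sup_{N\in\mathbb N}\big\|C_{1/n}^{\kappa(s,\cdot)}(m^N_s)\big\|_{L^\infty(\nu_N)}<\infty,$$ and moreover $\sup_{\kappa\in\mathscr U}\kappa=1$ $\mu$-a.e. and $$\mathcal D_{\min}(\mathcal E)=\Big\{u\in L^2(E,\mu)\;\Big|\;u\in\bigcap_{\kappa\in\mathscr U}\mathcal D_{\min}(\mathcal E^{\infty,\kappa}),\ \sup_{\kappa\in\mathscr U}\mathcal E^{\infty,\kappa}(u,u)<\infty\Big\}.$$ **Theorem.** Under Hamza's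 condition and (i), (ii), the forms $(\mathcal E^N,\mathcal D(\mathcal E^N))$ converge to $(\mathcal E,\mathcal D_{\min}(\mathcal E))$ in the sense of Mosco (Kuwae–Shioya). That is, call $u_N\in L^2(\mu_N)$ strongly convergent to $u\in L^2(\mu)$ if $\int u_N\varphi\,d\mu_N\to\int u\varphi\,d\mu$ for all $\varphi\in C_b(E)$ and $\|u_N\|_{L^2(\mu_N)}\to\|u\|_{L^2(\mu)}$, and weakly convergent to $u$ if $\int u_Nv_N\,d\mu_N\to\int uv\,d\mu$ whenever $v_N$ converges strongly to $v$; set each form equal to $+\infty$ off its domain. Then (a) if $u_N$ converges weakly to $u$, then $\mathcal E(u,u)\le\liminf_{N\to\infty}\mathcal E^N(u_N,u_N)$; in particular $u\in\mathcal D_{\min}(\mathcal E)$ if the right-hand side is finite; (b) for every $u\in\mathcal D_{\min}(\mathcal E)$ there are $u_N\in\mathcal D(\mathcal E^N)$ converging strongly to $u$ with $\lim_{N\to\infty}\mathcal E^N(u_N,u_N)=\mathcal E(u,u)$. -/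

import Mathlib

open MeasureTheory Filter Topology Set ProbabilityTheory
open scoped ENNReal BoundedContinuousFunction ContDiff

noncomputable section

namespace MoscoSuperposition

/-! ### Converging Hilbert spaces and Mosco convergence in the sense of Kuwae and Shioya -/

section KuwaeShioya

variable {V : Type*} [AddCommGroup V] [Module ℝ V]
  {H : ℕ → Type*} [∀ N, NormedAddCommGroup (H N)] [∀ N, InnerProductSpace ℝ (H N)]
  {H₀ : Type*} [NormedAddCommGroup H₀] [InnerProductSpace ℝ H₀]

/-- Strong convergence of a section `(u_N)`, `u₀`. The dense subspace `𝒞` of the asymptotic space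
is the range of `Ψ₀ : V → H₀`, and `Ψ N` maps (a label `φ : V` of) an element of `𝒞` to `H N`. -/
def StrongConv (Ψ : ∀ N, V →ₗ[ℝ] H N) (Ψ₀ : V →ₗ[ℝ] H₀) (u : ∀ N, H N) (u₀ : H₀) : Prop :=
  (∀ φ : V, Tendsto (fun N => inner ℝ (u N) (Ψ N φ)) atTop (𝓝 (inner ℝ u₀ (Ψ₀ φ)))) ∧
    Tendsto (fun N => ‖u N‖) atTop (𝓝 ‖u₀‖)

/-- Weak convergence of a section: pairings with strongly convergent sections converge. -/
def WeakConv (Ψ : ∀ N, V →ₗ[ℝ] H N) (Ψ₀ : V →ₗ[ℝ] H₀) (u : ∀ N, H N) (u₀ : H₀) : Prop :=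
  ∀ (v : ∀ N, H N) (v₀ : H₀), StrongConv Ψ Ψ₀ v v₀ →
    Tendsto (fun N => inner ℝ (u N) (v N)) atTop (𝓝 (inner ℝ u₀ v₀))

/-- Mosco convergence of non-negative quadratic forms. A form `(Q, D(Q))` is encoded by the
function `u ↦ Q(u,u)` with the value `⊤` off the domain. -/
def MoscoConv (Ψ : ∀ N, V →ₗ[ℝ] H N) (Ψ₀ : V →ₗ[ℝ] H₀)
    (Q : ∀ N, H N → ℝ≥0∞) (Q₀ : H₀ → ℝ≥0∞) : Prop :=
  (∀ (u : ∀ N, H N) (u₀ : H₀), WeakConv Ψ Ψ₀ u u₀ →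
      Q₀ u₀ ≤ liminf (fun N => Q N (u N)) atTop) ∧
  (∀ u₀ : H₀, Q₀ u₀ < ⊤ → ∃ u : ∀ N, H N, (∀ N, Q N (u N) < ⊤) ∧ StrongConv Ψ Ψ₀ u u₀ ∧
      Tendsto (fun N => Q N (u N)) atTop (𝓝 (Q₀ u₀)))

end KuwaeShioya

variable {d : ℕ}

/-! ### Primal functions, residual and perturbation -/

/-- Bounded measurable real functions. -/
def BddMeas {X : Type*} [MeasurableSpace X] (f : X → ℝ) : Prop :=
  Measurable f ∧ ∃ M : ℝ, ∀ x, |f x| ≤ M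

/-- Primal functions on `ℝ^d`. -/
structure IsPrimal (φ : (Fin d → ℝ) → ℝ) : Prop where
  measurable : Measurable φ
  mem_Icc : ∀ x, φ x ∈ Icc (0 : ℝ) 1
  eq_zero : ∀ x, x ∉ Icc (fun _ => (-2 : ℝ)) (fun _ => (2 : ℝ)) → φ x = 0
  integral_eq : ∫ x, φ x = 1
  sum_eq : ∀ x : Fin d → ℝ, ∑' a : Fin d → ℤ, φ (fun i => x i - (a i : ℝ)) = 1

/-- `φ_r^α(x) = φ((x - α) / r)` with `α = r a`, `a ∈ ℤ^d`. -/
def rescale (φ : (Fin d → ℝ) → ℝ) (r : ℝ) (a : Fin d → ℤ) (x : Fin d → ℝ) : ℝ :=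
  φ (fun i => (x i - r * (a i : ℝ)) / r)

/-- The `φ,η`-residual `R_r^{φ,η}(g)`. -/
def residual (r : ℝ) (φ η g : (Fin d → ℝ) → ℝ) (y : Fin d → ℝ) : ℝ :=
  ∑' a : Fin d → ℤ, (r ^ d)⁻¹ * (∫ x, |g y - g x| * rescale η r a x) * rescale φ r a y

/-- The `φ,η`-perturbation `I_r^{φ,η}(g)`. -/
def perturbation (r : ℝ) (φ η g : (Fin d → ℝ) → ℝ) (y : Fin d → ℝ) : ℝ :=
  ∑' a : Fin d → ℤ, (r ^ d)⁻¹ * (∫ x, rescale η r a x * g x) * rescale φ r a y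

/-- Lebesgue density of a measure on `ℝ^d`. -/
def density (m : Measure (Fin d → ℝ)) (x : Fin d → ℝ) : ℝ := (m.rnDeriv volume x).toReal

/-- `δ_r^κ(m)`. The division in `[0,∞]` obeys `1/0 = ∞` and `0 · ∞ = 0`. -/
def deltaRes (r : ℝ) (κ : (Fin d → ℝ) → ℝ) (m : Measure (Fin d → ℝ)) : ℝ≥0∞ :=
  ⨆ (φ : (Fin d → ℝ) → ℝ) (_ : IsPrimal φ) (η : (Fin d → ℝ) → ℝ) (_ : IsPrimal η)
    (f : (Fin d → ℝ) → ℝ) (_ : BddMeas f),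
    ENNReal.ofReal |∫ x, f x * residual r φ η (fun z => κ z * density m z) x| / eLpNorm f 2 m

/-- `C_r^κ(m)`. -/
def cPert (r : ℝ) (κ : (Fin d → ℝ) → ℝ) (m : Measure (Fin d → ℝ)) : ℝ≥0∞ :=
  ⨆ (φ : (Fin d → ℝ) → ℝ) (_ : IsPrimal φ) (η : (Fin d → ℝ) → ℝ) (_ : IsPrimal η)
    (f : (Fin d → ℝ) → ℝ) (_ : BddMeas f),
    ENNReal.ofReal |∫ x, f x * perturbation r φ η (fun z => κ z * density m z) x| / eLpNorm f 1 m

/-! ### The gradient energy on `ℝ^d` -/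

/-- `v` is the `i`-th weak partial derivative of `f`. -/
def IsWeakPartial (i : Fin d) (f v : (Fin d → ℝ) → ℝ) : Prop :=
  ∀ ψ : (Fin d → ℝ) → ℝ, ContDiff ℝ ∞ ψ → HasCompactSupport ψ →
    ∫ x, f x * fderiv ℝ ψ x (Pi.single i 1) = - ∫ x, v x * ψ x

/-- `f` has an essentially bounded `i`-th weak partial derivative. -/
def HasBddWeakPartial (i : Fin d) (f : (Fin d → ℝ) → ℝ) : Prop :=
  ∃ v : (Fin d → ℝ) → ℝ, MemLp v ⊤ volume ∧ IsWeakPartial i f v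

open Classical in
/-- A version of the essentially bounded `i`-th weak partial derivative (unique a.e.). -/
def weakPartial (i : Fin d) (f : (Fin d → ℝ) → ℝ) : (Fin d → ℝ) → ℝ :=
  if h : HasBddWeakPartial i f then h.choose else 0

/-- The class `𝒟` of bounded continuous functions with essentially bounded weak gradient. -/
def IsClassD (f : (Fin d → ℝ) → ℝ) : Prop :=
  Continuous f ∧ (∃ M : ℝ, ∀ x, |f x| ≤ M) ∧ ∀ i, HasBddWeakPartial i f

/-- `E^ϱ(f,g) = ∫ ∑ᵢ ∂ᵢf ∂ᵢg ϱ dx`. -/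
def energy (ϱ : (Fin d → ℝ) → ℝ) (f g : (Fin d → ℝ) → ℝ) : ℝ :=
  ∫ x, (∑ i, weakPartial i f x * weakPartial i g x) * ϱ x

/-! ### Superposition of gradient forms on `S × ℝ^d` -/

section Superposition

variable {S : Type*} [MeasurableSpace S]

/-- The domain of the direct integral `∫^⊕ E^{ϱ(s,·)} dν`. -/
def directDomain (ν : Measure S) (ϱ : S → (Fin d → ℝ) → ℝ) : Set (S × (Fin d → ℝ) → ℝ) :=
  {u | BddMeas u ∧ (∀ s, IsClassD fun x => u (s, x)) ∧
    Measurable (fun s => energy (ϱ s) (fun x => u (s, x)) (fun x => u (s, x))) ∧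
    Integrable (fun s => energy (ϱ s) (fun x => u (s, x)) (fun x => u (s, x))) ν}

/-- The direct integral `∫^⊕ E^{ϱ(s,·)} dν`. -/
def directEnergy (ν : Measure S) (ϱ : S → (Fin d → ℝ) → ℝ) (u v : S × (Fin d → ℝ) → ℝ) : ℝ :=
  ∫ s, energy (ϱ s) (fun x => u (s, x)) (fun x => v (s, x)) ∂ν

/-- `e` is the limit of the energies along a sequence of the pre-domain which is Cauchy with
respect to the energy and converges to `u` in `L²(m)`. -/
def IsClosureValue (m : Measure (S × (Fin d → ℝ))) (ν : Measure S) (ϱ : S → (Fin d → ℝ) → ℝ)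
    (u : S × (Fin d → ℝ) → ℝ) (e : ℝ≥0∞) : Prop :=
  ∃ w : ℕ → S × (Fin d → ℝ) → ℝ, (∀ k, w k ∈ directDomain ν ϱ) ∧
    Tendsto (fun k => eLpNorm (w k - u) 2 m) atTop (𝓝 0) ∧
    (∀ ε : ℝ, 0 < ε → ∃ K : ℕ, ∀ k l, K ≤ k → K ≤ l →
      directEnergy ν ϱ (w k - w l) (w k - w l) < ε) ∧
    Tendsto (fun k => ENNReal.ofReal (directEnergy ν ϱ (w k) (w k))) atTop (𝓝 e)

/-- The smallest closed extension in `L²(m)` of the superposed form, as the quadratic function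
`u ↦ E(u,u)` with the value `⊤` off the domain. The form being closable, there is at most one
closure value, so that the infimum merely selects it, or `⊤` if there is none. -/
def closedForm (m : Measure (S × (Fin d → ℝ))) (ν : Measure S) (ϱ : S → (Fin d → ℝ) → ℝ)
    (u : S × (Fin d → ℝ) → ℝ) : ℝ≥0∞ :=
  sInf {e | IsClosureValue m ν ϱ u e}

/-- The linear span of `C_b(S) × C¹_c(ℝ^d)`. -/
def core (S : Type*) [TopologicalSpace S] (d : ℕ) : Submodule ℝ (S × (Fin d → ℝ) → ℝ) :=
  Submodule.span ℝ {h | ∃ (f : S →ᵇ ℝ) (g : (Fin d → ℝ) → ℝ), ContDiff ℝ 1 g ∧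
    HasCompactSupport g ∧ h = fun p => f p.1 * g p.2}

/-- Membership in the minimal domain: the closure of the core in the Hilbert space given by the
domain of the closed form with the norm `(E(u,u) + ‖u‖²)^{1/2}`. -/
def MemMinDomain [TopologicalSpace S] (m : Measure (S × (Fin d → ℝ))) (ν : Measure S)
    (ϱ : S → (Fin d → ℝ) → ℝ) (u : S × (Fin d → ℝ) → ℝ) : Prop :=
  closedForm m ν ϱ u < ⊤ ∧
    ∃ w : ℕ → S × (Fin d → ℝ) → ℝ, (∀ k, w k ∈ core S d) ∧
      Tendsto (fun k => eLpNorm (w k - u) 2 m) atTop (𝓝 0) ∧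
      Tendsto (fun k => closedForm m ν ϱ (w k - u)) atTop (𝓝 0)

/-- The conditional densities `ϱ(s,·)` of `μ` given the first coordinate. -/
def condDensity (μ : Measure (S × (Fin d → ℝ))) [IsFiniteMeasure μ] (s : S) :
    (Fin d → ℝ) → ℝ :=
  density (μ.condKernel s)

/-- The form `(E, D(E))` on `L²(μ)`. -/
def gradForm (μ : Measure (S × (Fin d → ℝ))) [IsFiniteMeasure μ]
    (u : S × (Fin d → ℝ) → ℝ) : ℝ≥0∞ :=
  closedForm μ μ.fst (condDensity μ) u

/-- Membership in `D_min(E)`. -/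
def MemGradMin [TopologicalSpace S] (μ : Measure (S × (Fin d → ℝ))) [IsFiniteMeasure μ]
    (u : S × (Fin d → ℝ) → ℝ) : Prop :=
  MemMinDomain μ μ.fst (condDensity μ) u

open Classical in
/-- The form `(E, D_min(E))` on `L²(μ)`. -/
def gradFormMin [TopologicalSpace S] (μ : Measure (S × (Fin d → ℝ))) [IsFiniteMeasure μ]
    (u : S × (Fin d → ℝ) → ℝ) : ℝ≥0∞ :=
  if MemGradMin μ u then gradForm μ u else ⊤

/-- The measure `κ μ`. -/
def cutMeasure (μ : Measure (S × (Fin d → ℝ))) (κ : S × (Fin d → ℝ) → ℝ) :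
    Measure (S × (Fin d → ℝ)) :=
  μ.withDensity fun p => ENNReal.ofReal (κ p)

/-- The densities `κ(s,·) ϱ(s,·)`. -/
def cutDensity (μ : Measure (S × (Fin d → ℝ))) [IsFiniteMeasure μ] (κ : S × (Fin d → ℝ) → ℝ)
    (s : S) (x : Fin d → ℝ) : ℝ :=
  κ (s, x) * condDensity μ s x

/-- The form `(E^κ, D(E^κ))` on `L²(κμ)`. -/
def cutForm (μ : Measure (S × (Fin d → ℝ))) [IsFiniteMeasure μ] (κ : S × (Fin d → ℝ) → ℝ)
    (u : S × (Fin d → ℝ) → ℝ) : ℝ≥0∞ :=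
  closedForm (cutMeasure μ κ) μ.fst (cutDensity μ κ) u

/-- Membership in `D_min(E^κ)`. -/
def MemCutMin [TopologicalSpace S] (μ : Measure (S × (Fin d → ℝ))) [IsFiniteMeasure μ]
    (κ : S × (Fin d → ℝ) → ℝ) (u : S × (Fin d → ℝ) → ℝ) : Prop :=
  MemMinDomain (cutMeasure μ κ) μ.fst (cutDensity μ κ) u

/-- Hamza's condition for the conditional distributions of `μ`. -/
def Hamza (μ : Measure (S × (Fin d → ℝ))) [IsFiniteMeasure μ] : Prop :=
  (∀ᵐ s ∂μ.fst, μ.condKernel s ≪ volume) ∧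
    ∫⁻ s, μ.condKernel s {x | ∃ ε : ℝ, 0 < ε ∧
      ∫⁻ y in Icc (fun i => x i - ε) (fun i => x i + ε),
        ((μ.condKernel s).rnDeriv volume y)⁻¹ < ⊤} ∂μ.fst = 1

/-- Convergence of the conditional integrals of bounded continuous functions. -/
def CondIntegralsConv [TopologicalSpace S] (μ : ℕ → Measure (S × (Fin d → ℝ)))
    [∀ N, IsFiniteMeasure (μ N)] (μ₀ : Measure (S × (Fin d → ℝ))) [IsFiniteMeasure μ₀] : Prop :=
  ∀ g : (S × (Fin d → ℝ)) →ᵇ ℝ,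
    Tendsto (fun N => ∫ s, |∫ x, g (s, x) ∂((μ N).condKernel s)| ^ 2 ∂(μ N).fst) atTop
      (𝓝 (∫ s, |∫ x, g (s, x) ∂(μ₀.condKernel s)| ^ 2 ∂μ₀.fst))

/-- The cut-off condition: a countable family of continuous cut-off functions with uniform control
of `δ` and `C` along the sequence, supremum one, and the domain identity for the limit. -/
def CutoffCondition [TopologicalSpace S] (μ : ℕ → Measure (S × (Fin d → ℝ)))
    [∀ N, IsFiniteMeasure (μ N)] (μ₀ : Measure (S × (Fin d → ℝ))) [IsFiniteMeasure μ₀] : Prop :=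
  ∃ U : Set (S × (Fin d → ℝ) → ℝ), U.Countable ∧
    (∀ κ ∈ U, Continuous κ ∧ ∀ p, κ p ∈ Icc (0 : ℝ) 1) ∧
    (∀ κ ∈ U,
      Tendsto (fun n : ℕ => ⨆ N, eLpNorm
        (fun s => deltaRes (1 / (n : ℝ)) (fun x => κ (s, x)) ((μ N).condKernel s)) 2 (μ N).fst)
        atTop (𝓝 0) ∧
      limsup (fun n : ℕ => ⨆ N, eLpNorm
        (fun s => cPert (1 / (n : ℝ)) (fun x => κ (s, x)) ((μ N).condKernel s)) ⊤ (μ N).fst)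
        atTop < ⊤) ∧
    (∀ᵐ p ∂μ₀, IsLUB ((fun κ : S × (Fin d → ℝ) → ℝ => κ p) '' U) 1) ∧
    (∀ u : Lp ℝ 2 μ₀, MemGradMin μ₀ u ↔
      (∀ κ ∈ U, MemCutMin μ₀ κ u) ∧ (⨆ κ ∈ U, cutForm μ₀ κ u) < ⊤)

/-- The map sending a bounded continuous function to its class in `L²(μ)`. -/
def classMap {X : Type*} [TopologicalSpace X] [MeasurableSpace X] [BorelSpace X]
    [SecondCountableTopology X] (μ : Measure X) [IsFiniteMeasure μ] :
    (X →ᵇ ℝ) →ₗ[ℝ] Lp ℝ 2 μ :=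
  (BoundedContinuousFunction.toLp 2 μ ℝ : (X →ᵇ ℝ) →L[ℝ] Lp ℝ 2 μ).toLinearMap

end Superposition

end MoscoSuperposition

end

open MoscoSuperposition

open MeasureTheory Filter Topology Set ProbabilityTheory
open scoped ENNReal BoundedContinuousFunction ContDiff

noncomputable section

namespace MoscoSuperposition

/-! ### Hilbert space preliminaries -/

section Hilbert

/-! The difficulty is the lower bound. Suppose that the energies of `u N` lie frequently below a
finite `c`. Along an ultrafilter concentrated on those indices, replace `u N` by a nearby bounded `w
N` with jointly measurable weak gradient `V N`. Riesz representation on the limit space gives weak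
limits, tested against bounded continuous functions: the functions converge to `u₀`, the gradients
to some field `v` whose squared norm is at most `c`. It remains to show that `v` is the gradient of
`u₀` for the minimal form. The densities vary with `N`, so the equation defining a weak derivative
cannot be passed to the limit directly.

Fix a cut-off `κ` and a scale `r`, and expand `w N(s,·)` on the lattice `rℤ^d`. The perturbation
replaces a function by the sum of its local averages (`coef`) times a partition of unity. Its kernel
is a probability density of range `4r`, hence Jensen's inequality holds, and `cPert` bounds the
operator from `L²(μ N)` to `L²(κ μ N)` uniformly in `N` (`memLp_pertSec`). The quantity `deltaRes`
shows that the expansion differs little from the function when tested against `F(s) g(x)`, again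
uniformly in `N` (`abs_integral_pertSec_sub_le`). The primal functions are built from averaged
bumps, whose derivatives are differences of translated bumps. Integration by parts and summation by
parts then show that the partial derivatives of the expansion are expansions of the partial
derivatives, for another pair of primal functions (`sum_coef_mul_fderiv`).

At fixed scale the expansion is a sum of terms `b(s) h(x)` in which only the coefficient depends on
`N`. Truncated coefficients have weak limits in `L²` of the first marginal. Condition (i) makes the
conditional integrals of a fixed function converge strongly, and weak times strong convergence
identifies the weak limit of each product as the product with the limit coefficient
(`tendsto_integral_coef_mul`). Such products are limits of core functions together with their
gradients (`isLimGrad_tensor`). The closure of the graph of the gradient on the core is a closed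
subspace of a Hilbert space, hence weakly closed (`isLimGrad_of_weak`). The truncation level may
therefore tend to infinity and then the scale to zero, and `(u₀, v)` lies in the closed graph for `κ
μ₀` (`isLimGrad_of_weak_limits`).

By the domain identity in (ii), `u₀` is in the minimal domain. Hamza's condition makes gradients
unique: on compact sets where the inverse density is integrable, weighted `L²` convergence implies
`L¹` convergence (`ae_eq_zero_of_tendsto_weighted`). Thus the gradient of `u₀` agrees with `v`
wherever some `κ` is positive, which is almost everywhere, and the form at `u₀` is the squared norm
of `v`.

The recovery sequence is soft. Core functions have bounded continuous gradients, so weak convergence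
of the measures gives convergence of their energies and norms, and a diagonal sequence through the
core recovers every element of the minimal domain (`exists_recovery`). -/

theorem WeakConv.bddAbove_norm {V : Type*} [AddCommGroup V] [Module ℝ V]
    {H : ℕ → Type*} [∀ N, NormedAddCommGroup (H N)] [∀ N, InnerProductSpace ℝ (H N)]
    {H₀ : Type*} [NormedAddCommGroup H₀] [InnerProductSpace ℝ H₀]
    {Ψ : ∀ N, V →ₗ[ℝ] H N} {Ψ₀ : V →ₗ[ℝ] H₀} {u : ∀ N, H N} {u₀ : H₀}
    (hΨ : ∀ φ, ∃ C, ∀ N, ‖Ψ N φ‖ ≤ C) (h : WeakConv Ψ Ψ₀ u u₀) :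
    ∃ C, ∀ N, ‖u N‖ ≤ C := by
  by_contra! hC
  have hfreq : ∀ k : ℕ, ∃ᶠ N in atTop, (k : ℝ) < ‖u N‖ := by
    intro k
    rw [frequently_atTop]
    intro a
    -- Adding the first `a` norms to the threshold forces `a ≤ N`.
    obtain ⟨N, hN⟩ := hC ((k : ℝ) + ∑ j ∈ Finset.range a, ‖u j‖)
    refine ⟨N, ?_, ?_⟩
    · by_contra! hlt
      have := Finset.single_le_sum (f := fun j => ‖u j‖) (fun j _ => norm_nonneg _)
        (Finset.mem_range.2 hlt)
      have hk : (0 : ℝ) ≤ k := Nat.cast_nonneg k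
      linarith
    · have : 0 ≤ ∑ j ∈ Finset.range a, ‖u j‖ := Finset.sum_nonneg fun j _ => norm_nonneg _
      linarith
  obtain ⟨σ, hσ, hσu⟩ := extraction_forall_of_frequently hfreq
  classical
  -- The test section has norm `1 / ‖u N‖` along the subsequence. It thus converges strongly to
  -- zero, yet pairs with `u N` to one.
  let v : ∀ N, H N := fun N => if N ∈ range σ then (‖u N‖ ^ 2)⁻¹ • u N else 0
  have hvσ : ∀ k, v (σ k) = (‖u (σ k)‖ ^ 2)⁻¹ • u (σ k) := fun k => if_pos ⟨k, rfl⟩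
  have hpos : ∀ k, 0 < ‖u (σ k)‖ := fun k => lt_of_le_of_lt (Nat.cast_nonneg k) (hσu k)
  have hnorm : Tendsto (fun N => ‖v N‖) atTop (𝓝 0) := by
    rw [Metric.tendsto_atTop]
    intro ε hε
    obtain ⟨K, hK⟩ := exists_nat_gt (ε⁻¹)
    refine ⟨σ K, fun N hN => ?_⟩
    rw [Real.dist_eq, sub_zero, abs_of_nonneg (norm_nonneg _)]
    by_cases hr : N ∈ range σ
    · obtain ⟨k, rfl⟩ := hr
      have hk : K ≤ k := hσ.le_iff_le.1 hN
      have h1 : ε⁻¹ < ‖u (σ k)‖ :=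
        hK.trans_le ((Nat.cast_le.2 hk).trans (hσu k).le)
      rw [hvσ, norm_smul, norm_inv, norm_pow, norm_norm, pow_two, mul_inv,
        mul_assoc, inv_mul_cancel₀ (hpos k).ne', mul_one]
      exact inv_lt_of_inv_lt₀ hε h1
    · have hv : v N = 0 := if_neg hr
      rw [hv, norm_zero]
      exact hε
  have hs : StrongConv Ψ Ψ₀ v 0 := by
    refine ⟨fun φ => ?_, by simpa using hnorm⟩
    obtain ⟨C, hC⟩ := hΨ φ
    rw [inner_zero_left]
    refine squeeze_zero_norm (fun N => (norm_inner_le_norm _ _).trans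
      (mul_le_mul_of_nonneg_left (hC N) (norm_nonneg _))) ?_
    simpa using hnorm.mul_const C
  have h1 := (h v 0 hs).comp hσ.tendsto_atTop
  have h2 : ((fun N => inner ℝ (u N) (v N)) ∘ σ) = fun _ => (1 : ℝ) := by
    funext k
    simp only [Function.comp, hvσ, inner_smul_right, real_inner_self_eq_norm_sq]
    exact inv_mul_cancel₀ (pow_ne_zero _ (hpos k).ne')
  rw [h2, inner_zero_right] at h1
  exact one_ne_zero (tendsto_nhds_unique tendsto_const_nhds h1)

/-- Take the largest `k ≤ N` whose threshold has already been passed. No monotonicity of `p` in `k`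
is needed. -/
theorem exists_diagonal {p : ℕ → ℕ → Prop} (hp : ∀ k, ∀ᶠ N in atTop, p k N) :
    ∃ σ : ℕ → ℕ, Tendsto σ atTop atTop ∧ ∀ᶠ N in atTop, p (σ N) N := by
  choose a ha using fun k => eventually_atTop.1 (hp k)
  classical
  let σ : ℕ → ℕ := fun N => Nat.findGreatest (fun k => a k ≤ N) N
  refine ⟨σ, ?_, ?_⟩
  · refine tendsto_atTop.2 fun k => ?_
    filter_upwards [eventually_ge_atTop (max k (a k))] with N hN
    exact Nat.le_findGreatest ((le_max_left _ _).trans hN) ((le_max_right _ _).trans hN)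
  · filter_upwards [eventually_ge_atTop (a 0)] with N hN
    exact ha _ _ (Nat.findGreatest_spec (P := fun k => a k ≤ N) (Nat.zero_le N) hN)

theorem tendsto_inner_of_dense {H : Type*} [NormedAddCommGroup H] [InnerProductSpace ℝ H]
    {D : Set H} (hD : Dense D) {x : ℕ → H} {x₀ : H} {B : ℝ}
    (hB : ∀ᶠ n in atTop, ‖x n‖ ≤ B)
    (h : ∀ y ∈ D, Tendsto (fun n => inner ℝ (x n) y) atTop (𝓝 (inner ℝ x₀ y))) (z : H) :
    Tendsto (fun n => inner ℝ (x n) z) atTop (𝓝 (inner ℝ x₀ z)) := by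
  rw [Metric.tendsto_atTop']
  intro ε hε
  have hM : 0 < max B 0 + ‖x₀‖ + 1 := by positivity
  obtain ⟨y, hyD, hy⟩ := Metric.dense_iff.1 hD z (ε / (2 * (max B 0 + ‖x₀‖ + 1))) (by positivity)
  rw [Metric.mem_ball, dist_eq_norm] at hyD
  have h1 := Metric.tendsto_nhds.1 (h y hy) (ε / 2) (by positivity)
  obtain ⟨n₀, hn₀⟩ := eventually_atTop.1 (h1.and hB)
  refine ⟨n₀, fun n hn => ?_⟩
  obtain ⟨h2, h3⟩ := hn₀ n hn.le
  rw [Real.dist_eq] at h2 ⊢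
  have e1 : inner ℝ (x n) z - inner ℝ x₀ z
      = (inner ℝ (x n) y - inner ℝ x₀ y) - inner ℝ (x n) (y - z) + inner ℝ x₀ (y - z) := by
    simp only [inner_sub_right]; ring
  have e2 := abs_real_inner_le_norm (x n) (y - z)
  have e3 := abs_real_inner_le_norm x₀ (y - z)
  have e4 : (max B 0 + ‖x₀‖ + 1) * ‖y - z‖ < ε / 2 := by
    rw [lt_div_iff₀ (by positivity)] at hyD
    nlinarith
  have e5 : ‖x n‖ * ‖y - z‖ ≤ max B 0 * ‖y - z‖ :=
    mul_le_mul_of_nonneg_right (h3.trans (le_max_left _ _)) (norm_nonneg _)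
  have e6 := norm_nonneg (y - z)
  rw [e1]
  have := abs_add_le ((inner ℝ (x n) y - inner ℝ x₀ y) - inner ℝ (x n) (y - z))
    (inner ℝ x₀ (y - z))
  have := abs_sub (inner ℝ (x n) y - inner ℝ x₀ y) (inner ℝ (x n) (y - z))
  nlinarith

/-- Weak closedness of closed subspaces: such a subspace is its own double orthogonal complement,
and orthogonality to a fixed vector survives weak limits. -/
theorem mem_of_tendsto_inner {H : Type*} [NormedAddCommGroup H] [InnerProductSpace ℝ H]
    [CompleteSpace H] {K : Submodule ℝ H} (hK : IsClosed (K : Set H)) {x : ℕ → H} {x₀ : H}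
    (hx : ∀ᶠ n in atTop, x n ∈ K)
    (h : ∀ y, Tendsto (fun n => inner ℝ (x n) y) atTop (𝓝 (inner ℝ x₀ y))) : x₀ ∈ K := by
  have hK' : Kᗮᗮ = K := by
    have : CompleteSpace K := hK.completeSpace_coe
    exact Submodule.orthogonal_orthogonal K
  rw [← hK', Submodule.mem_orthogonal']
  intro z hz
  have hzero : (fun n => inner ℝ (x n) z) =ᶠ[atTop] fun _ => (0 : ℝ) := by
    filter_upwards [hx] with n hn
    exact Submodule.inner_right_of_mem_orthogonal hn hz
  exact tendsto_nhds_unique (h z) ((tendsto_congr' hzero).2 tendsto_const_nhds)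

end Hilbert

/-! ### Square integrable functions -/

section SquareIntegrable

variable {X : Type*} [MeasurableSpace X] {m : Measure X} {f g : X → ℝ}

theorem integral_mul_eq_inner (hf : MemLp f 2 m) (hg : MemLp g 2 m) :
    ∫ x, f x * g x ∂m = inner ℝ (hf.toLp f) (hg.toLp g) := by
  rw [L2.inner_def]
  refine integral_congr_ae ?_
  filter_upwards [hf.coeFn_toLp, hg.coeFn_toLp] with x h1 h2
  rw [h1, h2]
  simp [mul_comm]

theorem integral_sq_eq_norm_sq (hf : MemLp f 2 m) :
    ∫ x, f x ^ 2 ∂m = ‖hf.toLp f‖ ^ 2 := by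
  rw [← real_inner_self_eq_norm_sq, ← integral_mul_eq_inner hf hf]
  simp only [pow_two]

theorem integrable_mul_of_memLp (hf : MemLp f 2 m) (hg : MemLp g 2 m) :
    Integrable (fun x => f x * g x) m := hf.integrable_mul hg

theorem abs_integral_mul_le (hf : MemLp f 2 m) (hg : MemLp g 2 m) :
    |∫ x, f x * g x ∂m| ≤ √(∫ x, f x ^ 2 ∂m) * √(∫ x, g x ^ 2 ∂m) := by
  rw [integral_mul_eq_inner hf hg, integral_sq_eq_norm_sq hf, integral_sq_eq_norm_sq hg,
    Real.sqrt_sq (norm_nonneg _), Real.sqrt_sq (norm_nonneg _)]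
  exact abs_real_inner_le_norm _ _

theorem eLpNorm_two_eq_ofReal (hf : MemLp f 2 m) :
    eLpNorm f 2 m = ENNReal.ofReal √(∫ x, f x ^ 2 ∂m) := by
  rw [integral_sq_eq_norm_sq hf, Real.sqrt_sq (norm_nonneg _), Lp.norm_toLp,
    ENNReal.ofReal_toReal hf.2.ne]

theorem eLpNorm_two_sq_eq (f : X → ℝ) :
    eLpNorm f 2 m ^ 2 = ∫⁻ x, ENNReal.ofReal (f x ^ 2) ∂m := by
  rw [eLpNorm_eq_lintegral_rpow_enorm_toReal (by norm_num) (by norm_num)]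
  simp only [ENNReal.toReal_ofNat]
  rw [← ENNReal.rpow_natCast, ← ENNReal.rpow_mul]
  norm_num
  refine lintegral_congr fun x => ?_
  rw [← enorm_pow, Real.enorm_of_nonneg (sq_nonneg _)]

end SquareIntegrable

/-! ### Weak limits along an ultrafilter of functions on converging measure spaces -/

section WeakLimit

variable {X : Type*} [TopologicalSpace X] [MeasurableSpace X] [BorelSpace X]

theorem memLp_two_bcf (m : Measure X) [IsFiniteMeasure m] (ψ : X →ᵇ ℝ) :
    MemLp (fun x => ψ x) 2 m :=
  MemLp.of_bound ψ.continuous.aestronglyMeasurable ‖ψ‖ (ae_of_all _ fun x => ψ.norm_coe_le_norm x)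

theorem toLp_bcf_eq (m : Measure X) [IsFiniteMeasure m] (ψ : X →ᵇ ℝ) :
    (BoundedContinuousFunction.toLp 2 m ℝ ψ : Lp ℝ 2 m) = (memLp_two_bcf m ψ).toLp _ := by
  apply Lp.ext
  filter_upwards [BoundedContinuousFunction.coeFn_toLp (p := 2) (𝕜 := ℝ) m ψ,
    (memLp_two_bcf m ψ).coeFn_toLp] with x h1 h2
  rw [h1, h2]

variable [PolishSpace X]

theorem weaklyRegular_of_finite (m : Measure X) [IsFiniteMeasure m] : m.WeaklyRegular := by
  let _ := TopologicalSpace.upgradeIsCompletelyMetrizable X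
  infer_instance

/-- The limits of the pairings define a linear functional of `ψ`. Cauchy–Schwarz in each `L²(m N)`,
together with convergence of the integrals of `ψ ^ 2`, bounds it by `√B` times the norm of `ψ` in
`L²(m₀)`. Density of bounded continuous functions and Riesz representation give `F`. An ultrafilter
lets all pairings converge at once. -/
theorem exists_weak_limit {m : ℕ → Measure X} [∀ N, IsFiniteMeasure (m N)] {m₀ : Measure X}
    [IsFiniteMeasure m₀] (𝒰 : Ultrafilter ℕ)
    (hm : ∀ ψ : X →ᵇ ℝ, Tendsto (fun N => ∫ x, ψ x ∂m N) 𝒰 (𝓝 (∫ x, ψ x ∂m₀)))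
    {f : ℕ → X → ℝ} (hf : ∀ N, MemLp (f N) 2 (m N)) {B : ℝ}
    (hB : Tendsto (fun N => ∫ x, f N x ^ 2 ∂m N) 𝒰 (𝓝 B)) :
    ∃ F : X → ℝ, MemLp F 2 m₀ ∧ ∫ x, F x ^ 2 ∂m₀ ≤ B ∧
      ∀ ψ : X →ᵇ ℝ, Tendsto (fun N => ∫ x, f N x * ψ x ∂m N) 𝒰 (𝓝 (∫ x, F x * ψ x ∂m₀)) := by
  have hsq : ∀ ψ : X →ᵇ ℝ,
      Tendsto (fun N => ∫ x, ψ x ^ 2 ∂m N) 𝒰 (𝓝 (∫ x, ψ x ^ 2 ∂m₀)) := fun ψ => by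
    simpa [pow_two] using hm (ψ * ψ)
  have hbound : ∀ ψ : X →ᵇ ℝ, Tendsto (fun N => √(∫ x, f N x ^ 2 ∂m N) * √(∫ x, ψ x ^ 2 ∂m N)) 𝒰
      (𝓝 (√B * √(∫ x, ψ x ^ 2 ∂m₀))) := fun ψ =>
    (hB.sqrt).mul (hsq ψ).sqrt
  have hex : ∀ ψ : X →ᵇ ℝ, ∃ l : ℝ, Tendsto (fun N => ∫ x, f N x * ψ x ∂m N) 𝒰 (𝓝 l) := by
    intro ψ
    -- The pairings eventually stay in a compact interval, so they converge along the ultrafilter.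
    set C := √B * √(∫ x, ψ x ^ 2 ∂m₀) + 1
    have hev : ∀ᶠ N in (𝒰 : Filter ℕ), ∫ x, f N x * ψ x ∂m N ∈ Icc (-C) C := by
      filter_upwards [(hbound ψ).eventually_lt_const (lt_add_one _)] with N hN
      rw [mem_Icc, ← abs_le]
      exact (abs_integral_mul_le (hf N) (memLp_two_bcf _ ψ)).trans hN.le
    obtain ⟨l, -, hl⟩ := isCompact_Icc.ultrafilter_le_nhds
      (𝒰.map fun N => ∫ x, f N x * ψ x ∂m N) (le_principal_iff.2 hev)
    exact ⟨l, hl⟩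
  choose l hl using hex
  have hint : ∀ N (ψ : X →ᵇ ℝ), Integrable (fun x => f N x * ψ x) (m N) := fun N ψ =>
    integrable_mul_of_memLp (hf N) (memLp_two_bcf _ ψ)
  let ℓ : (X →ᵇ ℝ) →ₗ[ℝ] ℝ :=
    { toFun := l
      map_add' := fun ψ χ => by
        refine tendsto_nhds_unique (hl (ψ + χ)) (((hl ψ).add (hl χ)).congr fun N => ?_)
        rw [← integral_add (hint N ψ) (hint N χ)]
        simp [mul_add]
      map_smul' := fun c ψ => by
        refine tendsto_nhds_unique (hl (c • ψ)) (((hl ψ).const_mul c).congr fun N => ?_)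
        rw [← integral_const_mul]
        refine integral_congr_ae (ae_of_all _ fun x => ?_)
        simp only [BoundedContinuousFunction.coe_smul, smul_eq_mul]
        ring }
  let e : (X →ᵇ ℝ) →ₗ[ℝ] Lp ℝ 2 m₀ :=
    (BoundedContinuousFunction.toLp 2 m₀ ℝ : (X →ᵇ ℝ) →L[ℝ] Lp ℝ 2 m₀).toLinearMap
  have he : ∀ ψ, e ψ = (memLp_two_bcf m₀ ψ).toLp _ := toLp_bcf_eq m₀
  have hde : DenseRange e := by
    have := weaklyRegular_of_finite m₀
    let _ := TopologicalSpace.upgradeIsCompletelyMetrizable X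
    exact BoundedContinuousFunction.toLp_denseRange ℝ m₀ ℝ (by norm_num)
  have hnorm : ∀ ψ, ‖ℓ ψ‖ ≤ √B * ‖e ψ‖ := by
    intro ψ
    have h1 : ‖e ψ‖ = √(∫ x, ψ x ^ 2 ∂m₀) := by
      rw [he, integral_sq_eq_norm_sq (memLp_two_bcf m₀ ψ), Real.sqrt_sq (norm_nonneg _)]
    rw [h1]
    exact le_of_tendsto_of_tendsto (hl ψ).norm (hbound ψ)
      (Eventually.of_forall fun N => abs_integral_mul_le (hf N) (memLp_two_bcf _ ψ))
  let T := ℓ.extendOfNorm e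
  let F : Lp ℝ 2 m₀ := (InnerProductSpace.toDual ℝ (Lp ℝ 2 m₀)).symm T
  have hB0 : 0 ≤ B := ge_of_tendsto' hB fun N => integral_nonneg fun x => sq_nonneg _
  have hF : ‖F‖ ≤ √B := by
    rw [LinearIsometryEquiv.norm_map]
    exact ContinuousLinearMap.opNorm_le_bound _ (Real.sqrt_nonneg _)
      (LinearMap.norm_extendOfNorm_apply_le hde _ hnorm)
  refine ⟨F, Lp.memLp F, ?_, fun ψ => ?_⟩
  · rw [integral_sq_eq_norm_sq (Lp.memLp F), Lp.toLp_coeFn]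
    calc ‖F‖ ^ 2 ≤ √B ^ 2 := pow_le_pow_left₀ (norm_nonneg _) hF 2
      _ = B := Real.sq_sqrt hB0
  · have h1 : ∫ x, F x * ψ x ∂m₀ = l ψ := by
      rw [integral_mul_eq_inner (Lp.memLp F) (memLp_two_bcf m₀ ψ), Lp.toLp_coeFn, ← he]
      calc inner ℝ F (e ψ) = T (e ψ) := InnerProductSpace.toDual_symm_apply
        _ = ℓ ψ := LinearMap.extendOfNorm_eq hde ⟨_, hnorm⟩ ψ
    rw [h1]
    exact hl ψ

theorem exists_weak_limit_of_le {m : ℕ → Measure X} [∀ N, IsFiniteMeasure (m N)] {m₀ : Measure X}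
    [IsFiniteMeasure m₀] (𝒰 : Ultrafilter ℕ)
    (hm : ∀ ψ : X →ᵇ ℝ, Tendsto (fun N => ∫ x, ψ x ∂m N) 𝒰 (𝓝 (∫ x, ψ x ∂m₀)))
    {f : ℕ → X → ℝ} (hf : ∀ N, MemLp (f N) 2 (m N)) {B : ℝ}
    (hB : ∀ᶠ N in (𝒰 : Filter ℕ), ∫ x, f N x ^ 2 ∂m N ≤ B) :
    ∃ F : X → ℝ, MemLp F 2 m₀ ∧ ∫ x, F x ^ 2 ∂m₀ ≤ B ∧
      ∀ ψ : X →ᵇ ℝ, Tendsto (fun N => ∫ x, f N x * ψ x ∂m N) 𝒰 (𝓝 (∫ x, F x * ψ x ∂m₀)) := by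
  have hev : ∀ᶠ N in (𝒰 : Filter ℕ), ∫ x, f N x ^ 2 ∂m N ∈ Icc 0 B := by
    filter_upwards [hB] with N hN
    exact ⟨integral_nonneg fun x => sq_nonneg _, hN⟩
  obtain ⟨B', hB'mem, hB'⟩ := isCompact_Icc.ultrafilter_le_nhds
    (𝒰.map fun N => ∫ x, f N x ^ 2 ∂m N) (le_principal_iff.2 hev)
  obtain ⟨F, h1, h2, h3⟩ := exists_weak_limit 𝒰 hm hf hB'
  exact ⟨F, h1, h2.trans hB'mem.2, h3⟩

end WeakLimit

/-! ### Smooth primal functions -/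

section Primal

/-- Continuous primal functions on the line. -/
structure IsPrimalLine (h : ℝ → ℝ) : Prop where
  continuous : Continuous h
  mem_Icc : ∀ t, h t ∈ Icc (0 : ℝ) 1
  eq_zero : ∀ t, t ∉ Icc (-2 : ℝ) 2 → h t = 0
  integral_eq : ∫ t, h t = 1
  sum_eq : ∀ t : ℝ, ∑ j ∈ Finset.range 7, h (t - ((⌊t⌋ - 3 + (j : ℤ) : ℤ) : ℝ)) = 1

/-- Unit differences of a step function telescope, which yields both the partition of unity and the
unit integral. Seven integer translates reach from where `P` is zero to where it is one. -/
theorem isPrimalLine_of_step {P : ℝ → ℝ} (hP : Continuous P) (hmono : Monotone P)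
    (h0 : ∀ t ≤ -1, P t = 0) (h1 : ∀ t, 2 ≤ t → P t = 1) :
    IsPrimalLine fun t => P (t + 1) - P t where
  continuous := by fun_prop
  mem_Icc t := by
    have a1 := hmono (show t ≤ t + 1 by linarith)
    have a2 : 0 ≤ P t := by
      rw [← h0 (min t (-1)) (min_le_right _ _)]; exact hmono (min_le_left _ _)
    have a3 : P (t + 1) ≤ 1 :=
      (hmono (le_max_left _ 2)).trans_eq (h1 _ (le_max_right _ _))
    constructor <;> linarith
  eq_zero t ht := by
    rw [mem_Icc, not_and_or, not_le, not_le] at ht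
    rcases ht with ht | ht
    · rw [h0 _ (by linarith), h0 _ (by linarith), sub_zero]
    · rw [h1 _ (by linarith), h1 _ (by linarith), sub_self]
  integral_eq := by
    have hsupp : ∀ t, t ∉ Ioc (-3 : ℝ) 3 → P (t + 1) - P t = 0 := by
      intro t ht
      rw [mem_Ioc, not_and_or, not_lt, not_le] at ht
      rcases ht with ht | ht
      · rw [h0 _ (by linarith), h0 _ (by linarith), sub_zero]
      · rw [h1 _ (by linarith), h1 _ (by linarith), sub_self]
    rw [← setIntegral_eq_integral_of_forall_compl_eq_zero hsupp,
      ← intervalIntegral.integral_of_le (by norm_num)]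
    have hi : ∀ a b : ℝ, IntervalIntegrable P volume a b := fun a b => hP.intervalIntegrable a b
    have hP' : Continuous fun t => P (t + 1) := by fun_prop
    rw [intervalIntegral.integral_sub (hP'.intervalIntegrable _ _) (hi _ _),
      intervalIntegral.integral_comp_add_right (fun t => P t)]
    -- After cancellation only the integral of `P` over `[3,4]`, equal to one, and that over
    -- `[-3,-2]`, equal to zero, are left.
    have e1 := intervalIntegral.integral_add_adjacent_intervals (hi (-2) 3) (hi 3 4)
    have e2 := intervalIntegral.integral_add_adjacent_intervals (hi (-3) (-2)) (hi (-2) 3)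
    have e3 : ∫ t in (3 : ℝ)..4, P t = 1 := by
      rw [intervalIntegral.integral_congr (g := fun _ => (1 : ℝ))]
      · simp; norm_num
      · intro t ht
        rw [uIcc_of_le (by norm_num)] at ht
        exact h1 t (by linarith [ht.1])
    have e4 : ∫ t in (-3 : ℝ)..(-2), P t = 0 := by
      rw [intervalIntegral.integral_congr (g := fun _ => (0 : ℝ))]
      · simp
      · intro t ht
        rw [uIcc_of_le (by norm_num)] at ht
        exact h0 t (by linarith [ht.2])
    norm_num at e1 e2 ⊢
    linarith
  sum_eq t := by
    have h := Finset.sum_range_sub' (fun j : ℕ => P (t - (⌊t⌋ - 3 + (j : ℝ)) + 1)) 7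
    have h2 : ∀ j : ℕ, P (t - ((⌊t⌋ - 3 + (j : ℤ) : ℤ) : ℝ) + 1)
        - P (t - ((⌊t⌋ - 3 + (j : ℤ) : ℤ) : ℝ)) = P (t - (⌊t⌋ - 3 + (j : ℝ)) + 1)
        - P (t - (⌊t⌋ - 3 + ((j + 1 : ℕ) : ℝ)) + 1) := by
      intro j; push_cast; congr 2; ring
    simp only [h2]
    rw [h, h1, h0, sub_zero]
    · push_cast; linarith [Int.lt_floor_add_one t]
    · push_cast; linarith [Int.floor_le t]

/-- The basic smooth primal function on the line. -/
def bumpOne (t : ℝ) : ℝ := Real.smoothTransition (t + 1) - Real.smoothTransition t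

/-- The primitive of `bumpOne`. -/
def bumpStep (t : ℝ) : ℝ := ∫ s in (-1 : ℝ)..t, bumpOne s

/-- The average of `bumpOne` over unit intervals. -/
def bumpTwo (t : ℝ) : ℝ := bumpStep (t + 1) - bumpStep t

theorem contDiff_bumpOne : ContDiff ℝ ∞ bumpOne := by
  unfold bumpOne
  have h : ContDiff ℝ ∞ Real.smoothTransition := Real.smoothTransition.contDiff
  fun_prop

theorem isPrimalLine_bumpOne : IsPrimalLine bumpOne :=
  isPrimalLine_of_step Real.smoothTransition.continuous Real.smoothTransition.monotone
    (fun _ ht => Real.smoothTransition.zero_of_nonpos (by linarith))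
    (fun _ ht => Real.smoothTransition.one_of_one_le (by linarith))

theorem isPrimalLine_bumpOne_add : IsPrimalLine fun t => bumpOne (t + 1) :=
  isPrimalLine_of_step (P := fun t => Real.smoothTransition (t + 1))
    (Real.smoothTransition.continuous.comp (by fun_prop))
    (fun _ _ h => Real.smoothTransition.monotone (by linarith))
    (fun _ ht => Real.smoothTransition.zero_of_nonpos (by linarith))
    (fun _ ht => Real.smoothTransition.one_of_one_le (by linarith))

theorem hasDerivAt_bumpStep (t : ℝ) : HasDerivAt bumpStep (bumpOne t) t :=
  intervalIntegral.integral_hasDerivAt_right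
    (isPrimalLine_bumpOne.continuous.intervalIntegrable _ _)
    (isPrimalLine_bumpOne.continuous.stronglyMeasurableAtFilter _ _)
    isPrimalLine_bumpOne.continuous.continuousAt

theorem contDiff_bumpStep : ContDiff ℝ ∞ bumpStep := by
  rw [contDiff_infty_iff_deriv]
  refine ⟨fun t => (hasDerivAt_bumpStep t).differentiableAt, ?_⟩
  rw [show deriv bumpStep = bumpOne from funext fun t => (hasDerivAt_bumpStep t).deriv]
  exact contDiff_bumpOne

theorem bumpStep_mono : Monotone bumpStep :=
  monotone_of_deriv_nonneg (fun t => (hasDerivAt_bumpStep t).differentiableAt) fun t => by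
    rw [(hasDerivAt_bumpStep t).deriv]; exact (isPrimalLine_bumpOne.mem_Icc t).1

theorem bumpOne_eq_zero {t : ℝ} (ht : t ≤ -1 ∨ 1 ≤ t) : bumpOne t = 0 := by
  unfold bumpOne
  rcases ht with ht | ht
  · rw [Real.smoothTransition.zero_of_nonpos (by linarith),
      Real.smoothTransition.zero_of_nonpos (by linarith), sub_zero]
  · rw [Real.smoothTransition.one_of_one_le (by linarith),
      Real.smoothTransition.one_of_one_le (by linarith), sub_self]

theorem bumpStep_eq_zero {t : ℝ} (ht : t ≤ -1) : bumpStep t = 0 := by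
  unfold bumpStep
  rw [intervalIntegral.integral_congr (g := fun _ => (0 : ℝ))]
  · simp
  · intro s hs
    rw [uIcc_of_ge ht] at hs
    exact bumpOne_eq_zero (Or.inl hs.2)

theorem bumpStep_eq_one {t : ℝ} (ht : 1 ≤ t) : bumpStep t = 1 := by
  unfold bumpStep
  rw [intervalIntegral.integral_of_le (by linarith),
    setIntegral_eq_integral_of_forall_compl_eq_zero, isPrimalLine_bumpOne.integral_eq]
  intro s hs
  rw [mem_Ioc, not_and_or, not_lt, not_le] at hs
  exact bumpOne_eq_zero (hs.imp id fun h => by linarith)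

theorem contDiff_bumpTwo : ContDiff ℝ ∞ bumpTwo := by
  unfold bumpTwo
  have h := contDiff_bumpStep
  fun_prop

theorem isPrimalLine_bumpTwo : IsPrimalLine bumpTwo :=
  isPrimalLine_of_step contDiff_bumpStep.continuous bumpStep_mono
    (fun _ ht => bumpStep_eq_zero ht) (fun _ ht => bumpStep_eq_one (by linarith))

/-- `bumpTwo` lives on `[-2,1]`, so the translate by one still fits into `[-2,2]`. Its derivative is
`bumpOne t - bumpOne (t - 1)`, the form needed for differences of coefficients. -/
theorem isPrimalLine_bumpTwo_sub : IsPrimalLine fun t => bumpTwo (t - 1) := by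
  have h := isPrimalLine_of_step (P := fun t => bumpStep (t - 1))
    (contDiff_bumpStep.continuous.comp (by fun_prop))
    (fun _ _ h => bumpStep_mono (by linarith))
    (fun _ ht => bumpStep_eq_zero (by linarith)) (fun _ ht => bumpStep_eq_one (by linarith))
  convert h using 1
  funext t
  simp only [bumpTwo]
  congr 2; ring

/-- The purpose of the averaging: differentiation leads back to differences of primal functions, so
gradients stay within the scope of `deltaRes` and `cPert`. -/
theorem hasDerivAt_bumpTwo (t : ℝ) : HasDerivAt bumpTwo (bumpOne (t + 1) - bumpOne t) t :=
  ((hasDerivAt_bumpStep (t + 1)).comp_add_const t 1).sub (hasDerivAt_bumpStep t)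

/-! ### Tensor products of primal functions and their lattice translates -/

variable {d : ℕ}

/-- The tensor product of functions of one variable. -/
def tens (h : Fin d → ℝ → ℝ) (x : Fin d → ℝ) : ℝ := ∏ j, h j (x j)

/-- The lattice points whose translated cubes may contain `x`. -/
def latticeNear (x : Fin d → ℝ) : Finset (Fin d → ℤ) :=
  Fintype.piFinset fun i => (Finset.range 7).map
    ⟨fun j : ℕ => ⌊x i⌋ - 3 + (j : ℤ), fun a b h => by simpa using h⟩

theorem mem_latticeNear {x : Fin d → ℝ} {a : Fin d → ℤ}
    (h : (fun i => x i - (a i : ℝ)) ∈ Icc (fun _ => (-2 : ℝ)) (fun _ => (2 : ℝ))) :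
    a ∈ latticeNear x := by
  rw [latticeNear, Fintype.mem_piFinset]
  intro i
  have h1 := h.1 i
  have h2 := h.2 i
  have h3 : ⌊x i⌋ - 3 ≤ a i := by
    have : ((⌊x i⌋ - 3 : ℤ) : ℝ) ≤ a i := by push_cast; linarith [Int.floor_le (x i)]
    exact_mod_cast this
  have h4 : a i < ⌊x i⌋ + 4 := by
    have : (a i : ℝ) < ((⌊x i⌋ + 4 : ℤ) : ℝ) := by push_cast; linarith [Int.lt_floor_add_one (x i)]
    exact_mod_cast this
  rw [Finset.mem_map]
  refine ⟨(a i - (⌊x i⌋ - 3)).toNat, ?_, ?_⟩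
  · rw [Finset.mem_range]; omega
  · change ⌊x i⌋ - 3 + (((a i - (⌊x i⌋ - 3)).toNat : ℕ) : ℤ) = a i
    omega

theorem IsPrimal.eq_zero_of_notMem {φ : (Fin d → ℝ) → ℝ} (hφ : IsPrimal φ) {x : Fin d → ℝ}
    {a : Fin d → ℤ} (h : a ∉ latticeNear x) : φ (fun i => x i - (a i : ℝ)) = 0 :=
  hφ.eq_zero _ fun h' => h (mem_latticeNear h')

/-- Everything factorises: the integral by Fubini, and the sum over the lattice because the product
of the one-dimensional finite sums expands into it. -/
theorem isPrimal_tens {h : Fin d → ℝ → ℝ} (hh : ∀ j, IsPrimalLine (h j)) : IsPrimal (tens h) where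
  measurable := by
    unfold tens
    exact Finset.measurable_prod _ fun j _ =>
      (hh j).continuous.measurable.comp (measurable_pi_apply j)
  mem_Icc x := ⟨Finset.prod_nonneg fun j _ => ((hh j).mem_Icc _).1,
    Finset.prod_le_one (fun j _ => ((hh j).mem_Icc _).1) fun j _ => ((hh j).mem_Icc _).2⟩
  eq_zero x hx := by
    have : ∃ j, x j ∉ Icc (-2 : ℝ) 2 := by
      by_contra! hc
      exact hx ⟨fun j => (hc j).1, fun j => (hc j).2⟩
    obtain ⟨j, hj⟩ := this
    exact Finset.prod_eq_zero (Finset.mem_univ j) ((hh j).eq_zero _ hj)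
  integral_eq := by
    unfold tens
    rw [integral_fintype_prod_volume_eq_prod]
    exact Finset.prod_eq_one fun j _ => (hh j).integral_eq
  sum_eq x := by
    rw [tsum_eq_sum (s := latticeNear x)]
    · simp only [tens, latticeNear]
      rw [← Finset.prod_univ_sum (fun i => (Finset.range 7).map
        ⟨fun j : ℕ => ⌊x i⌋ - 3 + (j : ℤ), fun a b h => by simpa using h⟩)
        (fun j a => h j (x j - (a : ℝ)))]
      refine Finset.prod_eq_one fun j _ => ?_
      rw [Finset.sum_map]
      exact (hh j).sum_eq (x j)
    · intro a ha
      have : (fun i => x i - (a i : ℝ)) ∉ Icc (fun _ => (-2 : ℝ)) (fun _ => (2 : ℝ)) :=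
        fun h' => ha (mem_latticeNear h')
      have : ∃ j, x j - (a j : ℝ) ∉ Icc (-2 : ℝ) 2 := by
        by_contra! hc
        exact this ⟨fun j => (hc j).1, fun j => (hc j).2⟩
      obtain ⟨j, hj⟩ := this
      exact Finset.prod_eq_zero (Finset.mem_univ j) ((hh j).eq_zero _ hj)

theorem IsPrimal.summable {φ : (Fin d → ℝ) → ℝ} (hφ : IsPrimal φ) (x : Fin d → ℝ) :
    Summable fun a : Fin d → ℤ => φ (fun i => x i - (a i : ℝ)) :=
  summable_of_ne_finset_zero (s := latticeNear x) fun _ ha => hφ.eq_zero_of_notMem ha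

/-- A nonintegrable function has integral zero by convention, whereas this integral is one. -/
theorem IsPrimal.integrable {φ : (Fin d → ℝ) → ℝ} (hφ : IsPrimal φ) : Integrable φ := by
  by_contra h
  exact zero_ne_one ((integral_undef h).symm.trans hφ.integral_eq)

/-- Convexity of the class makes the sum of two primal functions, which dominates the partial
derivatives of `primalSmooth`, twice a single primal function. -/
theorem IsPrimal.half_add {φ η : (Fin d → ℝ) → ℝ} (hφ : IsPrimal φ) (hη : IsPrimal η) :
    IsPrimal fun x => (φ x + η x) / 2 where
  measurable := (hφ.measurable.add hη.measurable).div_const 2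
  mem_Icc x := by
    have h1 := hφ.mem_Icc x
    have h2 := hη.mem_Icc x
    constructor <;> linarith [h1.1, h1.2, h2.1, h2.2]
  eq_zero x hx := by rw [hφ.eq_zero x hx, hη.eq_zero x hx]; norm_num
  integral_eq := by
    rw [integral_div, integral_add hφ.integrable hη.integrable, hφ.integral_eq, hη.integral_eq]
    norm_num
  sum_eq x := by
    rw [tsum_div_const, (hφ.summable x).tsum_add (hη.summable x), hφ.sum_eq, hη.sum_eq]
    norm_num

theorem contDiff_tens {h : Fin d → ℝ → ℝ} (hh : ∀ j, ContDiff ℝ ∞ (h j)) :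
    ContDiff ℝ ∞ (tens h) := by
  unfold tens
  exact contDiff_prod fun j _ => (hh j).comp (contDiff_apply ℝ ℝ j)

theorem tens_update (h : Fin d → ℝ → ℝ) (i : Fin d) (g : ℝ → ℝ) (x : Fin d → ℝ) :
    tens (Function.update h i g) x = g (x i) * ∏ j ∈ Finset.univ.erase i, h j (x j) := by
  unfold tens
  rw [← Finset.mul_prod_erase _ _ (Finset.mem_univ i), Function.update_self]
  congr 1
  refine Finset.prod_congr rfl fun j hj => ?_
  rw [Function.update_of_ne (Finset.ne_of_mem_erase hj)]

theorem fderiv_rescale_tens {h : Fin d → ℝ → ℝ} (hh : ∀ j, ContDiff ℝ ∞ (h j)) {i : Fin d}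
    {g : ℝ → ℝ} (hg : ∀ t, HasDerivAt (h i) (g t) t) {r : ℝ} (a : Fin d → ℤ)
    (x : Fin d → ℝ) :
    fderiv ℝ (rescale (tens h) r a) x (Pi.single i 1)
      = r⁻¹ * rescale (tens (Function.update h i g)) r a x := by
  have hdiff : DifferentiableAt ℝ (rescale (tens h) r a) x := by
    have h1 : ContDiff ℝ ∞ (rescale (tens h) r a) := by
      unfold rescale
      exact (contDiff_tens hh).comp (by fun_prop)
    exact h1.differentiable (by simp) x
  rw [← hdiff.lineDeriv_eq_fderiv]
  refine HasLineDerivAt.lineDeriv ?_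
  have h2 : (fun t : ℝ => rescale (tens h) r a (x + t • Pi.single i 1))
      = fun t => h i ((x i + t - r * a i) / r) *
        ∏ j ∈ Finset.univ.erase i, h j ((x j - r * a j) / r) := by
    funext t
    unfold rescale
    have := tens_update h i (h i) 
      (fun j => ((x + t • (Pi.single i 1 : Fin d → ℝ)) j - r * a j) / r)
    rw [Function.update_eq_self] at this
    rw [this]
    congr 1
    · simp
    · refine Finset.prod_congr rfl fun j hj => ?_
      simp [Pi.single_eq_of_ne (Finset.ne_of_mem_erase hj)]
  unfold HasLineDerivAt
  rw [h2]
  unfold rescale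
  rw [tens_update]
  have h3 : HasDerivAt (fun t : ℝ => (x i + t - r * a i) / r) (1 / r) 0 :=
    (((hasDerivAt_id (0 : ℝ)).const_add (x i)).sub_const _).div_const r
  have h4 := (hg ((x i - r * a i) / r)).comp_of_eq (0 : ℝ) h3 (by simp)
  have h5 := h4.mul_const (∏ j ∈ Finset.univ.erase i, h j ((x j - r * a j) / r))
  refine h5.congr_deriv ?_
  rw [one_div]; ring

variable (d) in
/-- A smooth primal function. -/
def primalBase : (Fin d → ℝ) → ℝ := tens fun _ => bumpOne

/-- The average of `primalBase` in direction `i`. -/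
def primalBaseAvg (i : Fin d) : (Fin d → ℝ) → ℝ :=
  tens (Function.update (fun _ => bumpOne) i fun t => bumpTwo (t - 1))

variable (d) in
/-- A smooth primal function whose partial derivatives are differences of primal functions. -/
def primalSmooth : (Fin d → ℝ) → ℝ := tens fun _ => bumpTwo

/-- The primal function whose differences are the partial derivative of `primalSmooth`. -/
def primalSmoothDiff (i : Fin d) : (Fin d → ℝ) → ℝ :=
  tens (Function.update (fun _ => bumpTwo) i bumpOne)

/-- A translate of `primalSmoothDiff`. -/
def primalSmoothDiffShift (i : Fin d) : (Fin d → ℝ) → ℝ :=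
  tens (Function.update (fun _ => bumpTwo) i fun t => bumpOne (t + 1))

theorem isPrimal_primalBase : IsPrimal (primalBase d) := isPrimal_tens fun _ => isPrimalLine_bumpOne

theorem isPrimal_primalSmooth : IsPrimal (primalSmooth d) :=
  isPrimal_tens fun _ => isPrimalLine_bumpTwo

theorem forall_update {p : (ℝ → ℝ) → Prop} {i : Fin d} {f g : ℝ → ℝ} (hf : p f) (hg : p g)
    (j : Fin d) : p (Function.update (fun _ => f) i g j) := by
  by_cases h : j = i
  · subst h; rwa [Function.update_self]
  · rwa [Function.update_of_ne h]

theorem isPrimal_primalBaseAvg (i : Fin d) : IsPrimal (primalBaseAvg i) :=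
  isPrimal_tens (forall_update isPrimalLine_bumpOne isPrimalLine_bumpTwo_sub)

theorem isPrimal_primalSmoothDiff (i : Fin d) : IsPrimal (primalSmoothDiff i) :=
  isPrimal_tens (forall_update isPrimalLine_bumpTwo isPrimalLine_bumpOne)

theorem isPrimal_primalSmoothDiffShift (i : Fin d) : IsPrimal (primalSmoothDiffShift i) :=
  isPrimal_tens (forall_update isPrimalLine_bumpTwo isPrimalLine_bumpOne_add)

theorem contDiff_primalSmooth : ContDiff ℝ ∞ (primalSmooth d) :=
  contDiff_tens fun _ => contDiff_bumpTwo

theorem contDiff_primalBaseAvg (i : Fin d) : ContDiff ℝ ∞ (primalBaseAvg i) :=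
  contDiff_tens (forall_update contDiff_bumpOne (contDiff_bumpTwo.comp (by fun_prop)))

/-- Used with integration by parts: averages of a weak partial derivative become difference
quotients of averages of the function over neighbouring lattice points. -/
theorem fderiv_primalBaseAvg (i : Fin d) {r : ℝ} (hr : r ≠ 0) (a : Fin d → ℤ) (x : Fin d → ℝ) :
    fderiv ℝ (rescale (primalBaseAvg i) r a) x (Pi.single i 1)
      = r⁻¹ * (rescale (primalBase d) r a x - rescale (primalBase d) r (a + Pi.single i 1) x) := by
  unfold primalBaseAvg
  rw [fderiv_rescale_tens (g := fun t => bumpOne t - bumpOne (t - 1))]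
  · congr 1
    rw [Function.update_idem]
    unfold rescale
    rw [tens_update, sub_mul]
    congr 1
    · conv_rhs => rw [primalBase, ← Function.update_eq_self i fun _ => bumpOne, tens_update]
    · conv_rhs => rw [primalBase, ← Function.update_eq_self i fun _ => bumpOne, tens_update]
      congr 1
      · congr 1; simp; field_simp; ring
      · refine Finset.prod_congr rfl fun j hj => ?_
        simp [Pi.single_eq_of_ne (Finset.ne_of_mem_erase hj)]
  · exact forall_update contDiff_bumpOne (contDiff_bumpTwo.comp (by fun_prop))
  · intro t
    rw [Function.update_self]
    have := (hasDerivAt_bumpTwo (t - 1)).comp_sub_const t 1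
    simpa using this

theorem fderiv_primalSmooth (i : Fin d) {r : ℝ} (a : Fin d → ℤ) (x : Fin d → ℝ) :
    fderiv ℝ (rescale (primalSmooth d) r a) x (Pi.single i 1)
      = r⁻¹ * (rescale (primalSmoothDiffShift i) r a x - rescale (primalSmoothDiff i) r a x) := by
  unfold primalSmooth
  rw [fderiv_rescale_tens (g := fun t => bumpOne (t + 1) - bumpOne t)]
  · congr 1
    unfold rescale primalSmoothDiffShift primalSmoothDiff
    rw [tens_update, tens_update, tens_update, sub_mul]
  · exact fun _ => contDiff_bumpTwo
  · exact fun t => hasDerivAt_bumpTwo t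

/-- Moving the lattice point by one step undoes the translation by one. This is the index shift in
the summation by parts of `sum_coef_mul_fderiv`. -/
theorem rescale_primalSmoothDiffShift (i : Fin d) {r : ℝ} (hr : r ≠ 0) (a : Fin d → ℤ)
    (x : Fin d → ℝ) : rescale (primalSmoothDiffShift i) r (a + Pi.single i 1) x
      = rescale (primalSmoothDiff i) r a x := by
  unfold rescale primalSmoothDiffShift primalSmoothDiff
  rw [tens_update, tens_update]
  congr 1
  · congr 1; simp; field_simp; ring
  · refine Finset.prod_congr rfl fun j hj => ?_
    simp [Pi.single_eq_of_ne (Finset.ne_of_mem_erase hj)]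

end Primal

/-! ### The perturbation as an integral operator -/

theorem measurable_tsum_of_summable {X ι : Type*} [MeasurableSpace X] [Countable ι]
    {f : ι → X → ℝ} (hf : ∀ i, Measurable (f i)) (hs : ∀ x, Summable fun i => f i x) :
    Measurable fun x => ∑' i, f i x :=
  measurable_of_tendsto_metrizable' (atTop : Filter (Finset ι))
    (fun s => Finset.measurable_sum s fun i _ => hf i)
    (tendsto_pi_nhds.2 fun x => by
      simpa [HasSum] using (hs x).hasSum)

section Kernel

variable {d : ℕ} {r : ℝ} {φ η f g : (Fin d → ℝ) → ℝ}

theorem BddMeas.integrable {X : Type*} [MeasurableSpace X] {f : X → ℝ} (hf : BddMeas f)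
    (m : Measure X) [IsFiniteMeasure m] : Integrable f m := by
  obtain ⟨h1, M, hM⟩ := hf
  exact Integrable.of_bound h1.aestronglyMeasurable M (ae_of_all _ hM)

theorem BddMeas.memLp {X : Type*} [MeasurableSpace X] {f : X → ℝ} (hf : BddMeas f)
    (m : Measure X) [IsFiniteMeasure m] (p : ℝ≥0∞) : MemLp f p m := by
  obtain ⟨h1, M, hM⟩ := hf
  exact MemLp.of_bound h1.aestronglyMeasurable M (ae_of_all _ hM)

theorem BddMeas.abs {X : Type*} [MeasurableSpace X] {f : X → ℝ} (hf : BddMeas f) :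
    BddMeas fun x => |f x| :=
  ⟨hf.1.abs, hf.2.imp fun M hM x => by rw [abs_abs]; exact hM x⟩

theorem BddMeas.mul {X : Type*} [MeasurableSpace X] {f g : X → ℝ} (hf : BddMeas f)
    (hg : BddMeas g) : BddMeas fun x => f x * g x := by
  obtain ⟨h1, M, hM⟩ := hf
  obtain ⟨h2, L, hL⟩ := hg
  refine ⟨h1.mul h2, M * L, fun x => ?_⟩
  rw [abs_mul]
  exact mul_le_mul (hM x) (hL x) (abs_nonneg _) ((abs_nonneg _).trans (hM x))

theorem BddMeas.sq {X : Type*} [MeasurableSpace X] {f : X → ℝ} (hf : BddMeas f) :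
    BddMeas fun x => f x ^ 2 := by
  simpa only [pow_two] using hf.mul hf

theorem rescale_eq (hr : r ≠ 0) (φ : (Fin d → ℝ) → ℝ) (a : Fin d → ℤ) (x : Fin d → ℝ) :
    rescale φ r a x = φ fun i => x i / r - (a i : ℝ) := by
  unfold rescale
  congr 1
  funext i
  field_simp

/-- The lattice points whose rescaled cubes may contain `x`. -/
def near (r : ℝ) (x : Fin d → ℝ) : Finset (Fin d → ℤ) := latticeNear fun i => x i / r

theorem rescale_eq_zero (hr : r ≠ 0) (hφ : IsPrimal φ) {a : Fin d → ℤ} {x : Fin d → ℝ}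
    (h : a ∉ near r x) : rescale φ r a x = 0 := by
  rw [rescale_eq hr]
  exact hφ.eq_zero_of_notMem h

theorem measurable_rescale (hφ : IsPrimal φ) (a : Fin d → ℤ) : Measurable (rescale φ r a) :=
  hφ.measurable.comp (by fun_prop)

theorem rescale_nonneg (hφ : IsPrimal φ) (a : Fin d → ℤ) (x : Fin d → ℝ) :
    0 ≤ rescale φ r a x := (hφ.mem_Icc _).1

theorem rescale_le_one (hφ : IsPrimal φ) (a : Fin d → ℤ) (x : Fin d → ℝ) :
    rescale φ r a x ≤ 1 := (hφ.mem_Icc _).2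

theorem tsum_rescale_mul (hr : r ≠ 0) (hφ : IsPrimal φ) (c : (Fin d → ℤ) → ℝ) (x : Fin d → ℝ) :
    ∑' a, c a * rescale φ r a x = ∑ a ∈ near r x, c a * rescale φ r a x :=
  tsum_eq_sum fun a ha => by rw [rescale_eq_zero hr hφ ha, mul_zero]

theorem summable_mul_rescale (hr : r ≠ 0) (hφ : IsPrimal φ) (c : (Fin d → ℤ) → ℝ)
    (x : Fin d → ℝ) : Summable fun a => c a * rescale φ r a x :=
  summable_of_ne_finset_zero (s := near r x) fun a ha => by
    rw [rescale_eq_zero hr hφ ha, mul_zero]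

theorem sum_rescale (hr : r ≠ 0) (hφ : IsPrimal φ) (x : Fin d → ℝ) :
    ∑ a ∈ near r x, rescale φ r a x = 1 := by
  have h := tsum_rescale_mul hr hφ (fun _ => 1) x
  simp only [one_mul] at h
  rw [← h]
  simp only [rescale_eq hr]
  exact hφ.sum_eq _

theorem integral_rescale (hr : 0 < r) (hφ : IsPrimal φ) (a : Fin d → ℤ) :
    ∫ x, rescale φ r a x = r ^ d := by
  have h := Measure.integral_comp_inv_smul (volume : Measure (Fin d → ℝ))
    (fun x => φ (x - fun i => (a i : ℝ))) r
  rw [integral_sub_right_eq_self (fun x => φ x), hφ.integral_eq, Module.finrank_fin_fun,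
    abs_of_pos (pow_pos hr d), smul_eq_mul, mul_one] at h
  rw [← h]
  refine integral_congr_ae (ae_of_all _ fun x => ?_)
  simp only
  rw [rescale_eq hr.ne']
  congr 1
  funext i
  simp [div_eq_inv_mul]

theorem integrable_rescale (hr : 0 < r) (hφ : IsPrimal φ) (a : Fin d → ℤ) :
    Integrable (rescale φ r a) := by
  by_contra h
  exact (pow_pos hr d).ne ((integral_undef h).symm.trans (integral_rescale hr hφ a))

theorem integrable_rescale_mul (hr : 0 < r) (hφ : IsPrimal φ) (a : Fin d → ℤ) (hf : BddMeas f) :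
    Integrable fun x => rescale φ r a x * f x := by
  obtain ⟨h1, M, hM⟩ := hf
  exact (integrable_rescale hr hφ a).mul_bdd (c := M) h1.aestronglyMeasurable (ae_of_all _ hM)

theorem integrable_rescale_mul' (hφ : IsPrimal φ) (a : Fin d → ℤ) (hg : Integrable g) :
    Integrable fun x => rescale φ r a x * g x :=
  hg.bdd_mul (c := 1) (measurable_rescale hφ a).aestronglyMeasurable
    (ae_of_all _ fun x => by
      rw [Real.norm_eq_abs, abs_of_nonneg (rescale_nonneg hφ a x)]; exact rescale_le_one hφ a x)

/-- The integral kernel of the perturbation. -/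
def kern (r : ℝ) (φ η : (Fin d → ℝ) → ℝ) (y x : Fin d → ℝ) : ℝ :=
  ∑' a : Fin d → ℤ, (r ^ d)⁻¹ * rescale φ r a y * rescale η r a x

theorem kern_comm (y x : Fin d → ℝ) : kern r φ η y x = kern r η φ x y := by
  unfold kern
  refine tsum_congr fun a => by ring

theorem kern_eq_sum (hr : r ≠ 0) (hφ : IsPrimal φ) (y x : Fin d → ℝ) :
    kern r φ η y x = ∑ a ∈ near r y, (r ^ d)⁻¹ * rescale φ r a y * rescale η r a x :=
  tsum_eq_sum fun a ha => by rw [rescale_eq_zero hr hφ ha, mul_zero, zero_mul]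

theorem kern_nonneg (hr : 0 < r) (hφ : IsPrimal φ) (hη : IsPrimal η) (y x : Fin d → ℝ) :
    0 ≤ kern r φ η y x :=
  tsum_nonneg fun a => mul_nonneg (mul_nonneg (by positivity) (rescale_nonneg hφ a y))
    (rescale_nonneg hη a x)

theorem measurable_kern (hr : r ≠ 0) (hφ : IsPrimal φ) (hη : IsPrimal η) :
    Measurable fun p : (Fin d → ℝ) × (Fin d → ℝ) => kern r φ η p.1 p.2 := by
  refine measurable_tsum_of_summable (fun a => ?_) fun p => ?_
  · exact (((measurable_rescale hφ a).comp measurable_fst).const_mul _).mul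
      ((measurable_rescale hη a).comp measurable_snd)
  · exact summable_mul_rescale hr hη _ p.2

/-- Both points lie within `2 * r` of a common lattice point in every coordinate. -/
theorem dist_le_of_kern_ne_zero (hr : 0 < r) (hφ : IsPrimal φ) (hη : IsPrimal η)
    {y x : Fin d → ℝ} (h : kern r φ η y x ≠ 0) : dist y x ≤ 4 * r := by
  have : ∃ a : Fin d → ℤ, (r ^ d)⁻¹ * rescale φ r a y * rescale η r a x ≠ 0 := by
    by_contra! hc
    exact h (by unfold kern; simp [hc])
  obtain ⟨a, ha⟩ := this
  have h1 : rescale φ r a y ≠ 0 := fun h => ha (by rw [h]; ring)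
  have h2 : rescale η r a x ≠ 0 := fun h => ha (by rw [h]; ring)
  rw [rescale_eq hr.ne'] at h1 h2
  have h3 := not_imp_comm.1 (hφ.eq_zero _) h1
  have h4 := not_imp_comm.1 (hη.eq_zero _) h2
  refine (dist_pi_le_iff (by positivity)).2 fun i => ?_
  have a1 := h3.1 i
  have a2 := h3.2 i
  have a3 := h4.1 i
  have a4 := h4.2 i
  dsimp only at a1 a2 a3 a4
  rw [Real.dist_eq, abs_le]
  have e : y i - x i = r * ((y i / r - a i) - (x i / r - a i)) := by field_simp; ring
  rw [e]
  constructor <;> nlinarith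

theorem perturbation_eq (hr : r ≠ 0) (hφ : IsPrimal φ)
    (hg : ∀ a, Integrable fun x => rescale η r a x * g x) (y : Fin d → ℝ) :
    perturbation r φ η g y = ∫ x, kern r φ η y x * g x := by
  unfold perturbation
  rw [tsum_rescale_mul hr hφ]
  simp only [kern_eq_sum hr hφ, Finset.sum_mul]
  rw [integral_finsetSum]
  · refine Finset.sum_congr rfl fun a _ => ?_
    rw [← integral_const_mul, ← integral_mul_const]
    refine integral_congr_ae (ae_of_all _ fun x => ?_)
    simp only; ring
  · intro a _
    have := (hg a).const_mul ((r ^ d)⁻¹ * rescale φ r a y)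
    simpa only [mul_assoc] using this

theorem integrable_kern_mul (hr : r ≠ 0) (hφ : IsPrimal φ)
    (hg : ∀ a, Integrable fun x => rescale η r a x * g x) (y : Fin d → ℝ) :
    Integrable fun x => kern r φ η y x * g x := by
  simp only [kern_eq_sum hr hφ, Finset.sum_mul]
  refine integrable_finsetSum _ fun a _ => ?_
  have := (hg a).const_mul ((r ^ d)⁻¹ * rescale φ r a y)
  simpa only [mul_assoc] using this

theorem integrable_kern (hr : 0 < r) (hφ : IsPrimal φ) (hη : IsPrimal η) (y : Fin d → ℝ) :
    Integrable fun x => kern r φ η y x := by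
  simpa using integrable_kern_mul (g := fun _ => 1) hr.ne' hφ
    (fun a => by simpa using integrable_rescale hr hη a) y

/-- The average of each `η` is normalised and the `φ` form a partition of unity, so the kernel is
Markovian. The Jensen-type bounds and the comparison with the residual rest on this. -/
theorem integral_kern (hr : 0 < r) (hφ : IsPrimal φ) (hη : IsPrimal η) (y : Fin d → ℝ) :
    ∫ x, kern r φ η y x = 1 := by
  have h := perturbation_eq (g := fun _ => 1) hr.ne' hφ
    (fun a => by simpa using integrable_rescale hr hη a) y
  simp only [mul_one] at h
  rw [← h]
  unfold perturbation
  simp only [mul_one, integral_rescale hr hη, inv_mul_cancel₀ (pow_pos hr d).ne']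
  rw [tsum_rescale_mul hr.ne' hφ]
  simpa using sum_rescale hr.ne' hφ y

theorem residual_eq (hr : 0 < r) (hφ : IsPrimal φ) (hη : IsPrimal η)
    (hg : Integrable g) (y : Fin d → ℝ) :
    residual r φ η g y = ∫ x, kern r φ η y x * |g y - g x| := by
  rw [← perturbation_eq hr.ne' hφ]
  · unfold residual perturbation
    simp only [mul_comm |g y - g _|]
  · intro a
    have h1 : Integrable fun x => rescale η r a x * (g y - g x) := by
      simp only [mul_sub]
      exact ((integrable_rescale hr hη a).mul_const _).sub (integrable_rescale_mul' hη a hg)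
    refine h1.abs.congr (ae_of_all _ fun x => ?_)
    simp only
    rw [abs_mul, abs_of_nonneg (rescale_nonneg hη a x)]

theorem perturbation_eq_of_bddMeas (hr : 0 < r) (hφ : IsPrimal φ) (hη : IsPrimal η)
    (hf : BddMeas f) (y : Fin d → ℝ) :
    perturbation r φ η f y = ∫ x, kern r φ η y x * f x :=
  perturbation_eq hr.ne' hφ (fun a => integrable_rescale_mul hr hη a hf) y

theorem abs_perturbation_le (hr : 0 < r) (hφ : IsPrimal φ) (hη : IsPrimal η) {M : ℝ}
    (hf : Measurable f) (hM : ∀ x, |f x| ≤ M) (y : Fin d → ℝ) : |perturbation r φ η f y| ≤ M := by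
  rw [perturbation_eq_of_bddMeas hr hφ hη ⟨hf, M, hM⟩]
  have h1 : ‖∫ x, kern r φ η y x * f x‖ ≤ ∫ x, kern r φ η y x * M := by
    refine norm_integral_le_of_norm_le ((integrable_kern hr hφ hη y).mul_const M)
      (ae_of_all _ fun x => ?_)
    rw [norm_mul, Real.norm_of_nonneg (kern_nonneg hr hφ hη y x)]
    exact mul_le_mul_of_nonneg_left (hM x) (kern_nonneg hr hφ hη y x)
  rwa [integral_mul_const, integral_kern hr hφ hη, one_mul] at h1

theorem measurable_perturbation_section {S : Type*} [MeasurableSpace S]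
    {u : S × (Fin d → ℝ) → ℝ} (hu : Measurable u) (hr : r ≠ 0) (hφ : IsPrimal φ)
    (hη : IsPrimal η) :
    Measurable fun p : S × (Fin d → ℝ) => perturbation r φ η (fun x => u (p.1, x)) p.2 := by
  unfold perturbation
  refine measurable_tsum_of_summable (fun a => ?_) fun p => summable_mul_rescale hr hφ _ p.2
  refine Measurable.mul (Measurable.const_mul ?_ _) ((measurable_rescale hφ a).comp measurable_snd)
  have h1 : StronglyMeasurable fun q : S × (Fin d → ℝ) => rescale η r a q.2 * u q :=
    (((measurable_rescale hη a).comp measurable_snd).mul hu).stronglyMeasurable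
  exact (h1.integral_prod_right' (ν := volume)).measurable.comp measurable_fst

theorem BddMeas.perturbation (hf : BddMeas f) (hr : 0 < r) (hφ : IsPrimal φ)
    (hη : IsPrimal η) : BddMeas (perturbation r φ η f) := by
  refine ⟨?_, hf.2.imp fun M hM => abs_perturbation_le hr hφ hη hf.1 hM⟩
  exact (measurable_perturbation_section (S := Unit) (u := fun p => f p.2)
    (hf.1.comp measurable_snd) hr.ne' hφ hη).comp (measurable_const (a := ()) |>.prodMk measurable_id)

theorem perturbation_nonneg (hr : 0 < r) (hφ : IsPrimal φ) (hη : IsPrimal η)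
    (hf0 : ∀ x, 0 ≤ f x) (y : Fin d → ℝ) : 0 ≤ perturbation r φ η f y :=
  tsum_nonneg fun a => mul_nonneg (mul_nonneg (by positivity)
    (integral_nonneg fun x => mul_nonneg (rescale_nonneg hη a x) (hf0 x))) (rescale_nonneg hφ a y)

/-- Jensen's inequality for the probability density `kern r φ η y`, as nonnegativity of a variance.
-/
theorem sq_perturbation_le (hr : 0 < r) (hφ : IsPrimal φ) (hη : IsPrimal η) (hf : BddMeas f)
    (y : Fin d → ℝ) :
    perturbation r φ η f y ^ 2 ≤ perturbation r φ η (fun x => f x ^ 2) y := by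
  have i1 := integrable_kern_mul hr.ne' hφ (fun a => integrable_rescale_mul hr hη a hf) y
  have i2 := integrable_kern_mul hr.ne' hφ (fun a => integrable_rescale_mul hr hη a hf.sq) y
  have i3 := integrable_kern hr hφ hη y
  rw [perturbation_eq_of_bddMeas hr hφ hη hf, perturbation_eq_of_bddMeas hr hφ hη hf.sq]
  set c := ∫ x, kern r φ η y x * f x
  have h0 : 0 ≤ ∫ x, kern r φ η y x * (f x - c) ^ 2 :=
    integral_nonneg fun x => mul_nonneg (kern_nonneg hr hφ hη y x) (sq_nonneg _)
  have h1 : ∫ x, kern r φ η y x * (f x - c) ^ 2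
      = (∫ x, kern r φ η y x * f x ^ 2) - 2 * c * c + c ^ 2 * 1 := by
    rw [← integral_kern hr hφ hη y, ← integral_const_mul (c ^ 2), ← integral_const_mul (2 * c),
      ← integral_sub i2 (i1.const_mul _),
      ← integral_add (i2.sub' (i1.const_mul _)) (i3.const_mul _)]
    refine integral_congr_ae (ae_of_all _ fun x => ?_)
    simp only; ring
  nlinarith

/-- The commutator with multiplication by `g` has kernel `kern * (g y - g x)`, and the kernel
vanishes beyond distance `4 * r`. -/
theorem abs_mul_perturbation_sub_le (hr : 0 < r) (hφ : IsPrimal φ) (hη : IsPrimal η)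
    (hf : BddMeas f) (hg : BddMeas g) {w : ℝ} (hw : ∀ x y, dist y x ≤ 4 * r → |g y - g x| ≤ w)
    (y : Fin d → ℝ) :
    |perturbation r φ η f y * g y - perturbation r φ η (fun x => f x * g x) y|
      ≤ w * perturbation r φ η (fun x => |f x|) y := by
  have i1 := integrable_kern_mul hr.ne' hφ (fun a => integrable_rescale_mul hr hη a hf) y
  have i2 := integrable_kern_mul hr.ne' hφ (fun a => integrable_rescale_mul hr hη a (hf.mul hg)) y
  have i3 := integrable_kern_mul hr.ne' hφ (fun a => integrable_rescale_mul hr hη a hf.abs) y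
  rw [perturbation_eq_of_bddMeas hr hφ hη hf, perturbation_eq_of_bddMeas hr hφ hη (hf.mul hg),
    perturbation_eq_of_bddMeas hr hφ hη hf.abs, ← integral_mul_const, ← integral_sub
    (i1.mul_const _) i2, ← integral_const_mul, ← Real.norm_eq_abs]
  refine norm_integral_le_of_norm_le (i3.const_mul w) (ae_of_all _ fun x => ?_)
  have e : kern r φ η y x * f x * g y - kern r φ η y x * (f x * g x)
      = kern r φ η y x * (f x * (g y - g x)) := by ring
  rw [e, Real.norm_eq_abs, abs_mul, abs_mul, abs_of_nonneg (kern_nonneg hr hφ hη y x)]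
  by_cases hk : kern r φ η y x = 0
  · simp [hk]
  · have h1 := hw x y (dist_le_of_kern_ne_zero hr hφ hη hk)
    have h2 := mul_nonneg (kern_nonneg hr hφ hη y x) (abs_nonneg (f x))
    nlinarith

theorem integrable_kern_mul_mul (hr : 0 < r) (hφ : IsPrimal φ) (hη : IsPrimal η)
    (hf : BddMeas f) (hg : Measurable g) (hgi : Integrable g) :
    Integrable (fun p : (Fin d → ℝ) × (Fin d → ℝ) => kern r φ η p.1 p.2 * (f p.1 * g p.2))
      (volume.prod volume) := by
  obtain ⟨hfm, M, hM⟩ := hf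
  have hmeas : AEStronglyMeasurable
      (fun p : (Fin d → ℝ) × (Fin d → ℝ) => kern r φ η p.1 p.2 * (f p.1 * g p.2))
      (volume.prod volume) :=
    ((measurable_kern hr.ne' hφ hη).mul
      ((hfm.comp measurable_fst).mul (hg.comp measurable_snd))).aestronglyMeasurable
  have hsec : ∀ x, Integrable fun y => kern r φ η y x * (f y * g x) := by
    intro x
    simp only [kern_comm (φ := φ)]
    have := (integrable_kern_mul hr.ne' hη
      (fun a => integrable_rescale_mul hr hφ a ⟨hfm, M, hM⟩) x).mul_const (g x)
    simpa only [mul_assoc] using this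
  rw [integrable_prod_iff' hmeas]
  refine ⟨ae_of_all _ hsec, ?_⟩
  refine (hgi.norm.const_mul M).mono' hmeas.norm.prod_swap.integral_prod_right' (ae_of_all _ fun x => ?_)
  rw [Real.norm_of_nonneg (integral_nonneg fun y => norm_nonneg _)]
  have h1 : ∫ y, ‖kern r φ η y x * (f y * g x)‖ ≤ ∫ y, kern r η φ x y * (M * ‖g x‖) := by
    refine integral_mono (hsec x).norm ((integrable_kern hr hη hφ x).mul_const _) fun y => ?_
    simp only
    rw [kern_comm, norm_mul, Real.norm_of_nonneg (kern_nonneg hr hη hφ x y), norm_mul]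
    exact mul_le_mul_of_nonneg_left (mul_le_mul_of_nonneg_right (hM y) (norm_nonneg _))
      (kern_nonneg hr hη hφ x y)
  rwa [integral_mul_const, integral_kern hr hη hφ, one_mul] at h1

theorem integrable_kern_mul_diag (hr : 0 < r) (hφ : IsPrimal φ) (hη : IsPrimal η)
    (hg : Measurable g) (hgi : Integrable g) :
    Integrable (fun p : (Fin d → ℝ) × (Fin d → ℝ) => kern r φ η p.1 p.2 * g p.1)
      (volume.prod volume) := by
  have h := integrable_kern_mul_mul hr hη hφ (f := fun _ => 1)
    ⟨measurable_const, 1, fun _ => by simp⟩ hg hgi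
  have := h.swap
  refine this.congr (ae_of_all _ fun p => ?_)
  simp only [Function.comp, Prod.fst_swap, Prod.snd_swap, one_mul]
  rw [kern_comm]

theorem integrable_perturbation (hr : 0 < r) (hφ : IsPrimal φ) (hη : IsPrimal η)
    (hg : Measurable g) (hgi : Integrable g) : Integrable (perturbation r φ η g) := by
  have h := (integrable_kern_mul_mul hr hφ hη (f := fun _ => 1)
    ⟨measurable_const, 1, fun _ => by simp⟩ hg hgi).integral_prod_left
  refine h.congr (ae_of_all _ fun y => ?_)
  simp only [one_mul]
  rw [perturbation_eq hr.ne' hφ (fun a => integrable_rescale_mul' hη a hgi)]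

/-- The kernel is symmetric up to exchanging `φ` and `η`. By Fubini an operator acting on the
density becomes one acting on the test function. -/
theorem integral_mul_perturbation (hr : 0 < r) (hφ : IsPrimal φ) (hη : IsPrimal η)
    (hf : BddMeas f) (hg : Measurable g) (hgi : Integrable g) :
    ∫ y, f y * perturbation r φ η g y = ∫ x, perturbation r η φ f x * g x := by
  have hI := integrable_kern_mul_mul hr hφ hη hf hg hgi
  have h1 : ∀ y, f y * perturbation r φ η g y = ∫ x, kern r φ η y x * (f y * g x) := by
    intro y
    rw [perturbation_eq hr.ne' hφ (fun a => integrable_rescale_mul' hη a hgi),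
      ← integral_const_mul]
    refine integral_congr_ae (ae_of_all _ fun x => ?_)
    simp only; ring
  have h2 : ∀ x, perturbation r η φ f x * g x = ∫ y, kern r φ η y x * (f y * g x) := by
    intro x
    rw [perturbation_eq_of_bddMeas hr hη hφ hf, ← integral_mul_const]
    refine integral_congr_ae (ae_of_all _ fun y => ?_)
    simp only
    rw [kern_comm]; ring
  simp only [h1, h2]
  exact integral_integral_swap hI

theorem integrable_residual (hr : 0 < r) (hφ : IsPrimal φ) (hη : IsPrimal η)
    (hg : Measurable g) (hgi : Integrable g) : Integrable (residual r φ η g) := by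
  have i1 := integrable_kern_mul_mul hr hφ hη (f := fun _ => 1)
    ⟨measurable_const, 1, fun _ => by simp⟩ hg hgi
  have i2 := integrable_kern_mul_diag hr hφ hη hg hgi
  have h := (i2.sub i1).abs.integral_prod_left
  refine h.congr (ae_of_all _ fun y => ?_)
  simp only
  rw [residual_eq hr hφ hη hgi]
  refine integral_congr_ae (ae_of_all _ fun x => ?_)
  simp only [Pi.sub_apply, one_mul]
  rw [← mul_sub, abs_mul, abs_of_nonneg (kern_nonneg hr hφ hη y x)]

/-- The kernel has total mass one, so the left side is the modulus of an average of `g x - g y`, and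
the residual is the average of the moduli. -/
theorem abs_perturbation_sub_le_residual (hr : 0 < r) (hφ : IsPrimal φ) (hη : IsPrimal η)
    (hgi : Integrable g) (y : Fin d → ℝ) :
    |perturbation r φ η g y - g y| ≤ residual r φ η g y := by
  have i1 := integrable_kern_mul hr.ne' hφ (fun a => integrable_rescale_mul' hη a hgi) y
  have i2 := (integrable_kern hr hφ hη y).mul_const (g y)
  have e : g y = ∫ x, kern r φ η y x * g y := by
    rw [integral_mul_const, integral_kern hr hφ hη, one_mul]
  have i3 := (i2.sub i1).abs
  rw [residual_eq hr hφ hη hgi, perturbation_eq hr.ne' hφ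
    (fun a => integrable_rescale_mul' hη a hgi)]
  conv_lhs => rw [e]
  rw [← integral_sub i1 i2, ← Real.norm_eq_abs]
  refine norm_integral_le_of_norm_le (i3.congr (ae_of_all _ fun x => ?_)) (ae_of_all _ fun x => ?_)
  · simp only [Pi.sub_apply]
    rw [← mul_sub, abs_mul, abs_of_nonneg (kern_nonneg hr hφ hη y x)]
  · rw [← mul_sub, Real.norm_eq_abs, abs_mul, abs_of_nonneg (kern_nonneg hr hφ hη y x),
      abs_sub_comm]

/-- By duality the error is `f` integrated against the error of the perturbation of `g`, which the
residual dominates pointwise. -/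
theorem abs_integral_perturbation_sub_le (hr : 0 < r) (hφ : IsPrimal φ) (hη : IsPrimal η)
    (hf : BddMeas f) (hg : Measurable g) (hgi : Integrable g) :
    |(∫ x, perturbation r η φ f x * g x) - ∫ x, f x * g x| ≤ ∫ x, |f x| * residual r φ η g x := by
  obtain ⟨hfm, M, hM⟩ := hf
  have hb : ∀ {h : (Fin d → ℝ) → ℝ}, Integrable h → Integrable fun x => f x * h x := fun hh =>
    hh.bdd_mul (c := M) hfm.aestronglyMeasurable (ae_of_all _ hM)
  rw [← integral_mul_perturbation hr hφ hη ⟨hfm, M, hM⟩ hg hgi,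
    ← integral_sub (hb (integrable_perturbation hr hφ hη hg hgi)) (hb hgi),
    ← Real.norm_eq_abs]
  refine norm_integral_le_of_norm_le ?_ (ae_of_all _ fun x => ?_)
  · exact (integrable_residual hr hφ hη hg hgi).bdd_mul (c := M) hfm.abs.aestronglyMeasurable
      (ae_of_all _ fun x => by simpa using hM x)
  · rw [← mul_sub, Real.norm_eq_abs, abs_mul]
    exact mul_le_mul_of_nonneg_left (abs_perturbation_sub_le_residual hr hφ hη hgi x)
      (abs_nonneg _)

/-- The coefficients of the perturbation. -/
def coef (r : ℝ) (η f : (Fin d → ℝ) → ℝ) (a : Fin d → ℤ) : ℝ :=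
  (r ^ d)⁻¹ * ∫ x, rescale η r a x * f x

theorem perturbation_eq_sum (hr : r ≠ 0) (hφ : IsPrimal φ) (f : (Fin d → ℝ) → ℝ)
    (y : Fin d → ℝ) : perturbation r φ η f y = ∑ a ∈ near r y, coef r η f a * rescale φ r a y :=
  tsum_rescale_mul hr hφ _ y

/-- Jensen's inequality for the probability density `(r ^ d)⁻¹ * rescale η r a`. -/
theorem sq_coef_le (hr : 0 < r) (hη : IsPrimal η) (hf : BddMeas f) (a : Fin d → ℤ) :
    coef r η f a ^ 2 ≤ coef r η (fun x => f x ^ 2) a := by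
  have i1 := integrable_rescale_mul hr hη a hf
  have i2 := integrable_rescale_mul hr hη a hf.sq
  have i3 := integrable_rescale hr hη a
  have hrd := pow_pos hr d
  set c := coef r η f a with hc
  have hc' : ∫ x, rescale η r a x * f x = r ^ d * c := by
    rw [hc, coef, ← mul_assoc, mul_inv_cancel₀ hrd.ne', one_mul]
  have h0 : 0 ≤ ∫ x, rescale η r a x * (f x - c) ^ 2 :=
    integral_nonneg fun x => mul_nonneg (rescale_nonneg hη a x) (sq_nonneg _)
  have h1 : ∫ x, rescale η r a x * (f x - c) ^ 2
      = (∫ x, rescale η r a x * f x ^ 2) - 2 * c * (r ^ d * c) + c ^ 2 * r ^ d := by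
    rw [← integral_rescale hr hη a, ← integral_const_mul (c ^ 2), integral_rescale hr hη a,
      ← hc', ← integral_const_mul (2 * c), ← integral_sub i2 (i1.const_mul _),
      ← integral_add (i2.sub' (i1.const_mul _)) (i3.const_mul _)]
    refine integral_congr_ae (ae_of_all _ fun x => ?_)
    simp only; ring
  have h2 : c ^ 2 * r ^ d ≤ ∫ x, rescale η r a x * f x ^ 2 := by nlinarith
  rw [coef, inv_mul_eq_div, le_div_iff₀ hrd]
  exact h2

theorem sum_sq_coef_mul_le (hr : 0 < r) (hφ : IsPrimal φ) (hη : IsPrimal η) (hf : BddMeas f)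
    (A : Finset (Fin d → ℤ)) (y : Fin d → ℝ) :
    ∑ a ∈ A, coef r η f a ^ 2 * rescale φ r a y ≤ perturbation r φ η (fun x => f x ^ 2) y := by
  have hs := summable_mul_rescale hr.ne' hφ (fun a => coef r η (fun x => f x ^ 2) a) y
  calc ∑ a ∈ A, coef r η f a ^ 2 * rescale φ r a y
      ≤ ∑ a ∈ A, coef r η (fun x => f x ^ 2) a * rescale φ r a y :=
        Finset.sum_le_sum fun a _ => mul_le_mul_of_nonneg_right (sq_coef_le hr hη hf a)
          (rescale_nonneg hφ a y)
    _ ≤ ∑' a, coef r η (fun x => f x ^ 2) a * rescale φ r a y :=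
        hs.sum_le_tsum A fun a _ => mul_nonneg ((sq_nonneg _).trans (sq_coef_le hr hη hf a))
          (rescale_nonneg hφ a y)

/-! ### The estimates through `deltaRes` and `cPert` -/

variable {m : Measure (Fin d → ℝ)} {κ : (Fin d → ℝ) → ℝ}

theorem measurable_density (m : Measure (Fin d → ℝ)) : Measurable (density m) :=
  (Measure.measurable_rnDeriv m volume).ennreal_toReal

theorem density_nonneg (m : Measure (Fin d → ℝ)) (x : Fin d → ℝ) : 0 ≤ density m x :=
  ENNReal.toReal_nonneg

theorem integrable_density (m : Measure (Fin d → ℝ)) [IsFiniteMeasure m] :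
    Integrable (density m) := Measure.integrable_toReal_rnDeriv

theorem integral_mul_density [IsFiniteMeasure m] (hm : m ≪ volume) (f : (Fin d → ℝ) → ℝ) :
    ∫ x, f x * density m x = ∫ x, f x ∂m := by
  rw [← integral_rnDeriv_smul hm]
  simp only [density, smul_eq_mul, mul_comm]

theorem integrable_cut_density [IsFiniteMeasure m] (hκ : Measurable κ)
    (hκ1 : ∀ x, κ x ∈ Icc (0 : ℝ) 1) : Integrable fun z => κ z * density m z :=
  (integrable_density m).bdd_mul (c := 1) hκ.aestronglyMeasurable (ae_of_all _ fun x => by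
    rw [Real.norm_of_nonneg (hκ1 x).1]; exact (hκ1 x).2)

/-- `cPert` controls the perturbation of the density against `L¹` test functions. The adjoint
relation reads this as `L¹` boundedness of the perturbation acting on functions. -/
theorem integral_perturbation_le_of_cPert [IsFiniteMeasure m] (hm : m ≪ volume)
    (hκ : Measurable κ) (hκ1 : ∀ x, κ x ∈ Icc (0 : ℝ) 1) (hr : 0 < r) (hφ : IsPrimal φ)
    (hη : IsPrimal η) (hf : BddMeas f) (hf0 : ∀ x, 0 ≤ f x) {C : ℝ} (hC0 : 0 ≤ C)
    (hC : cPert r κ m ≤ ENNReal.ofReal C) :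
    ∫ x, perturbation r φ η f x * κ x ∂m ≤ C * ∫ x, f x ∂m := by
  have hgm : Measurable fun z => κ z * density m z := hκ.mul (measurable_density m)
  have h1 : ENNReal.ofReal |∫ x, f x * perturbation r η φ (fun z => κ z * density m z) x|
      / eLpNorm f 1 m ≤ ENNReal.ofReal C := by
    refine le_trans ?_ hC
    -- The operator on the density is the adjoint one, hence `η` and `φ` trade places in the
    -- supremum.
    unfold cPert
    exact le_iSup_of_le η (le_iSup_of_le hη (le_iSup_of_le φ (le_iSup_of_le hφ
      (le_iSup_of_le f (le_iSup_of_le hf le_rfl)))))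
  have hfin : eLpNorm f 1 m ≠ ⊤ := (hf.memLp m 1).2.ne
  -- A vanishing `L¹` norm is harmless: `1/0 = ∞`, so a finite bound on the quotient forces the
  -- numerator to vanish.
  rw [ENNReal.div_le_iff_le_mul (Or.inr ENNReal.ofReal_ne_top) (Or.inl hfin),
    integral_mul_perturbation hr hη hφ hf hgm (integrable_cut_density hκ hκ1)] at h1
  have h2 : ∫ x, perturbation r φ η f x * (κ x * density m x)
      = ∫ x, perturbation r φ η f x * κ x ∂m := by
    rw [← integral_mul_density hm]
    simp only [mul_assoc]
  have h3 : eLpNorm f 1 m = ENNReal.ofReal (∫ x, f x ∂m) := by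
    rw [eLpNorm_one_eq_lintegral_enorm, ofReal_integral_eq_lintegral_ofReal (hf.integrable m)
      (ae_of_all _ hf0)]
    exact lintegral_congr fun x => by rw [Real.enorm_of_nonneg (hf0 x)]
  rw [h2, h3, ← ENNReal.ofReal_mul hC0, ENNReal.ofReal_le_ofReal_iff
    (mul_nonneg hC0 (integral_nonneg hf0))] at h1
  exact (le_abs_self _).trans h1

/-- The weak error is dominated by the residual tested against `|f|`, which is again an admissible
test function with the same `L²` norm. -/
theorem div_le_deltaRes [IsFiniteMeasure m] (hm : m ≪ volume)
    (hκ : Measurable κ) (hκ1 : ∀ x, κ x ∈ Icc (0 : ℝ) 1) (hr : 0 < r) (hφ : IsPrimal φ)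
    (hη : IsPrimal η) (hf : BddMeas f) :
    ENNReal.ofReal |(∫ x, perturbation r φ η f x * κ x ∂m) - ∫ x, f x * κ x ∂m| / eLpNorm f 2 m
      ≤ deltaRes r κ m := by
  have hgm : Measurable fun z => κ z * density m z := hκ.mul (measurable_density m)
  have h1 := abs_integral_perturbation_sub_le hr hη hφ hf hgm (integrable_cut_density hκ hκ1)
  have h2 : ENNReal.ofReal |∫ x, |f x| * residual r η φ (fun z => κ z * density m z) x|
      / eLpNorm (fun x => |f x|) 2 m ≤ deltaRes r κ m := by
    unfold deltaRes
    exact le_iSup_of_le η (le_iSup_of_le hη (le_iSup_of_le φ (le_iSup_of_le hφ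
      (le_iSup_of_le (fun x => |f x|) (le_iSup_of_le hf.abs le_rfl)))))
  have h3 : eLpNorm (fun x => |f x|) 2 m = eLpNorm f 2 m := eLpNorm_norm f
  rw [h3] at h2
  refine le_trans (ENNReal.div_le_div_right (ENNReal.ofReal_le_ofReal ?_) _) h2
  have e1 : ∫ x, perturbation r φ η f x * κ x ∂m
      = ∫ x, perturbation r φ η f x * (κ x * density m x) := by
    rw [← integral_mul_density hm]
    simp only [mul_assoc]
  have e2 : ∫ x, f x * κ x ∂m = ∫ x, f x * (κ x * density m x) := by
    rw [← integral_mul_density hm]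
    simp only [mul_assoc]
  rw [e1, e2]
  exact h1.trans (le_abs_self _)

end Kernel

/-! ### Weak gradients -/

section WeakGradient

variable {d : ℕ} {i : Fin d} {f v v' : (Fin d → ℝ) → ℝ}

theorem locallyIntegrable_of_memLp_top (hv : MemLp v ⊤ (volume : Measure (Fin d → ℝ))) :
    LocallyIntegrable v := hv.locallyIntegrable le_top

theorem BddMeas.memLp_top (hv : BddMeas v) : MemLp v ⊤ (volume : Measure (Fin d → ℝ)) := by
  obtain ⟨h1, M, hM⟩ := hv
  exact memLp_top_of_bound h1.aestronglyMeasurable M (ae_of_all _ hM)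

theorem IsWeakPartial.ae_unique (hv : MemLp v ⊤ volume) (hv' : MemLp v' ⊤ volume)
    (h : IsWeakPartial i f v) (h' : IsWeakPartial i f v') : v =ᵐ[volume] v' := by
  refine ae_eq_of_integral_contDiff_smul_eq (locallyIntegrable_of_memLp_top hv)
    (locallyIntegrable_of_memLp_top hv') fun ψ hψ hc => ?_
  have := (h ψ hψ hc).symm.trans (h' ψ hψ hc)
  simp only [smul_eq_mul, mul_comm (ψ _)]
  linarith

theorem weakPartial_spec (h : HasBddWeakPartial i f) :
    MemLp (weakPartial i f) ⊤ volume ∧ IsWeakPartial i f (weakPartial i f) := by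
  unfold weakPartial
  rw [dif_pos h]
  exact h.choose_spec

theorem IsWeakPartial.weakPartial_ae_eq (hv : MemLp v ⊤ volume) (h : IsWeakPartial i f v) :
    weakPartial i f =ᵐ[volume] v :=
  have hs := weakPartial_spec ⟨v, hv, h⟩
  IsWeakPartial.ae_unique hs.1 hv hs.2 h

theorem integrable_mul_test {g ψ : (Fin d → ℝ) → ℝ} (hg : MemLp g ⊤ volume) (hψ : Continuous ψ)
    (hc : HasCompactSupport ψ) : Integrable fun x => g x * ψ x := by
  exact (hψ.integrable_of_hasCompactSupport hc).mul_of_top_right hg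

theorem integrable_mul_fderiv_test {g ψ : (Fin d → ℝ) → ℝ} (hg : MemLp g ⊤ volume)
    (hψ : ContDiff ℝ ∞ ψ) (hc : HasCompactSupport ψ) :
    Integrable fun x => g x * fderiv ℝ ψ x (Pi.single i 1) :=
  integrable_mul_test hg ((hψ.continuous_fderiv (by simp)).clm_apply continuous_const)
    (hc.fderiv_apply (𝕜 := ℝ) (v := Pi.single i 1))

theorem IsWeakPartial.sub {f' : (Fin d → ℝ) → ℝ} (hf : MemLp f ⊤ volume) (hf' : MemLp f' ⊤ volume)
    (hv : MemLp v ⊤ volume) (hv' : MemLp v' ⊤ volume) (h : IsWeakPartial i f v)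
    (h' : IsWeakPartial i f' v') : IsWeakPartial i (fun x => f x - f' x) fun x => v x - v' x := by
  intro ψ hψ hc
  simp only [sub_mul]
  rw [integral_sub (integrable_mul_fderiv_test hf hψ hc) (integrable_mul_fderiv_test hf' hψ hc),
    integral_sub (integrable_mul_test hv hψ.continuous hc)
      (integrable_mul_test hv' hψ.continuous hc), h ψ hψ hc, h' ψ hψ hc]
  ring

theorem isWeakPartial_fderiv (hf : ContDiff ℝ 1 f) :
    IsWeakPartial i f fun x => fderiv ℝ f x (Pi.single i 1) := by
  intro ψ hψ hc
  have c1 : Continuous fun x => fderiv ℝ f x (Pi.single i 1) :=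
    (hf.continuous_fderiv (by simp)).clm_apply continuous_const
  have c2 : Continuous fun x => fderiv ℝ ψ x (Pi.single i 1) :=
    (hψ.continuous_fderiv (by simp)).clm_apply continuous_const
  refine integral_mul_fderiv_eq_neg_fderiv_mul_of_integrable ?_ ?_ ?_
    (fun x _ => hf.differentiable (by simp) x) (fun x _ => hψ.differentiable (by simp) x)
  · exact (c1.mul hψ.continuous).integrable_of_hasCompactSupport hc.mul_left
  · exact (hf.continuous.mul c2).integrable_of_hasCompactSupport
      (hc.fderiv_apply (𝕜 := ℝ) (v := Pi.single i 1)).mul_left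
  · exact (hf.continuous.mul hψ.continuous).integrable_of_hasCompactSupport hc.mul_left

variable {S : Type*} [MeasurableSpace S]

/-- `V` is a jointly measurable version of the weak gradients of the sections of the bounded
measurable function `u`. -/
structure IsGrad (u : S × (Fin d → ℝ) → ℝ) (V : Fin d → S × (Fin d → ℝ) → ℝ) : Prop where
  bddMeas : BddMeas u
  measurable : ∀ i, Measurable (V i)
  bdd : ∀ i s, ∃ M : ℝ, ∀ x, |V i (s, x)| ≤ M
  weak : ∀ i s, IsWeakPartial i (fun x => u (s, x)) fun x => V i (s, x)

variable {u u' : S × (Fin d → ℝ) → ℝ} {V V' : Fin d → S × (Fin d → ℝ) → ℝ}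

theorem bddMeas_section (hu : BddMeas u) (s : S) : BddMeas fun x => u (s, x) :=
  ⟨hu.1.comp measurable_prodMk_left, hu.2.imp fun _ hM x => hM (s, x)⟩

theorem IsGrad.bddMeas_grad (h : IsGrad u V) (i : Fin d) (s : S) : BddMeas fun x => V i (s, x) :=
  ⟨(h.measurable i).comp measurable_prodMk_left, h.bdd i s⟩

theorem IsGrad.weakPartial_ae_eq (h : IsGrad u V) (i : Fin d) (s : S) :
    weakPartial i (fun x => u (s, x)) =ᵐ[volume] fun x => V i (s, x) :=
  (h.weak i s).weakPartial_ae_eq (h.bddMeas_grad i s).memLp_top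

theorem IsGrad.sub (h : IsGrad u V) (h' : IsGrad u' V') :
    IsGrad (u - u') fun i => V i - V' i where
  bddMeas := by
    obtain ⟨h1, M, hM⟩ := h.bddMeas
    obtain ⟨h2, L, hL⟩ := h'.bddMeas
    exact ⟨h1.sub h2, M + L, fun p => (abs_sub _ _).trans (add_le_add (hM p) (hL p))⟩
  measurable i := (h.measurable i).sub (h'.measurable i)
  bdd i s := by
    obtain ⟨M, hM⟩ := h.bdd i s
    obtain ⟨L, hL⟩ := h'.bdd i s
    exact ⟨M + L, fun p => (abs_sub _ _).trans (add_le_add (hM p) (hL p))⟩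
  weak i s := (h.weak i s).sub (bddMeas_section h.bddMeas s).memLp_top
    (bddMeas_section h'.bddMeas s).memLp_top (h.bddMeas_grad i s).memLp_top
    (h'.bddMeas_grad i s).memLp_top (h'.weak i s)

/-- A sequence of mollifiers. -/
def mollifier (d : ℕ) (n : ℕ) : ContDiffBump (0 : Fin d → ℝ) where
  rIn := 1 / ((n : ℝ) + 1)
  rOut := 2 * (1 / ((n : ℝ) + 1))
  rIn_pos := by positivity
  rIn_lt_rOut := by
    have : 0 < 1 / ((n : ℝ) + 1) := by positivity
    linarith

theorem tendsto_rOut_mollifier (d : ℕ) :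
    Tendsto (fun n => (mollifier d n).rOut) atTop (𝓝 0) := by
  simpa [mollifier] using (tendsto_one_div_add_atTop_nhds_zero_nat (𝕜 := ℝ)).const_mul 2

/-- The `i`-th partial derivative of the mollification. -/
def mollGrad (i : Fin d) (n : ℕ) (f : (Fin d → ℝ) → ℝ) (x : Fin d → ℝ) : ℝ :=
  ∫ y, f y * fderiv ℝ ((mollifier d n).normed volume) (x - y) (Pi.single i 1)

/-- The weak derivative is tested with the reflected translate `y ↦ ρ (x - y)`. The sign from the
reflection cancels the sign of the integration by parts. -/
theorem mollGrad_eq (h : IsWeakPartial i f v) (n : ℕ) (x : Fin d → ℝ) :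
    mollGrad i n f x = ∫ y, v y * (mollifier d n).normed volume (x - y) := by
  set ρ := (mollifier d n).normed (volume : Measure (Fin d → ℝ))
  have hρ : ContDiff ℝ ∞ ρ := (mollifier d n).contDiff_normed
  have hρc : HasCompactSupport ρ := (mollifier d n).hasCompactSupport_normed
  have h1 := h (fun y => ρ (x - y)) (hρ.comp (by fun_prop))
    (hρc.comp_homeomorph (Homeomorph.subLeft x))
  have h2 : ∀ y, fderiv ℝ (fun y => ρ (x - y)) y (Pi.single i 1)
      = - fderiv ℝ ρ (x - y) (Pi.single i 1) := by
    intro y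
    have h3 : HasFDerivAt (fun y => x - y) (-ContinuousLinearMap.id ℝ (Fin d → ℝ)) y :=
      (hasFDerivAt_id y).const_sub x
    have h4 := ((hρ.differentiable (by simp) (x - y)).hasFDerivAt.comp y h3).fderiv
    rw [show (fun y => ρ (x - y)) = ρ ∘ fun y => x - y from rfl, h4]
    simp
  simp only [h2, mul_neg, integral_neg, neg_inj] at h1
  exact h1

theorem ae_tendsto_mollGrad (hv : MemLp v ⊤ volume) (h : IsWeakPartial i f v) :
    ∀ᵐ x, Tendsto (fun n => mollGrad i n f x) atTop (𝓝 (v x)) := by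
  have h1 := ContDiffBump.ae_convolution_tendsto_right_of_locallyIntegrable
    (φ := mollifier d) (K := 2) (tendsto_rOut_mollifier d)
    (Eventually.of_forall fun n => le_rfl) (locallyIntegrable_of_memLp_top hv)
  filter_upwards [h1] with x hx
  refine hx.congr fun n => ?_
  rw [mollGrad_eq h, convolution_eq_swap]
  refine integral_congr_ae (ae_of_all _ fun y => ?_)
  simp [mul_comm]

theorem exists_abs_mollGrad_le (hv : MemLp v ⊤ volume) (h : IsWeakPartial i f v) :
    ∃ M : ℝ, ∀ n x, |mollGrad i n f x| ≤ M := by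
  refine ⟨(eLpNorm v ⊤ volume).toReal, fun n x => ?_⟩
  set ρ := (mollifier d n).normed (volume : Measure (Fin d → ℝ))
  have hi : Integrable fun y => ρ (x - y) :=
    ((mollifier d n).integrable_normed (μ := volume)).comp_sub_left x
  rw [mollGrad_eq h]
  have h2 : ‖∫ y, v y * ρ (x - y)‖ ≤ ∫ y, (eLpNorm v ⊤ volume).toReal * ρ (x - y) := by
    refine norm_integral_le_of_norm_le (hi.const_mul _) ?_
    filter_upwards [ae_le_eLpNormEssSup (f := v) (μ := volume)] with y hy
    rw [norm_mul, Real.norm_of_nonneg ((mollifier d n).nonneg_normed _)]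
    refine mul_le_mul_of_nonneg_right ?_ ((mollifier d n).nonneg_normed _)
    rw [← toReal_enorm, eLpNorm_exponent_top]
    refine ENNReal.toReal_mono ?_ hy
    rw [← eLpNorm_exponent_top]
    exact hv.2.ne
  rw [integral_const_mul, integral_sub_left_eq_self (fun y => ρ y),
    (mollifier d n).integral_normed, mul_one] at h2
  exact h2

theorem measurable_mollGrad (hu : Measurable u) (i : Fin d) (n : ℕ) :
    Measurable fun p : S × (Fin d → ℝ) => mollGrad i n (fun x => u (p.1, x)) p.2 := by
  have hρ : ContDiff ℝ ∞ ((mollifier d n).normed (volume : Measure (Fin d → ℝ))) :=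
    (mollifier d n).contDiff_normed
  have hc : Continuous fun x => fderiv ℝ ((mollifier d n).normed (volume : Measure (Fin d → ℝ))) x
      (Pi.single i 1) := (hρ.continuous_fderiv (by simp)).clm_apply continuous_const
  have h1 : StronglyMeasurable fun q : (S × (Fin d → ℝ)) × (Fin d → ℝ) => u (q.1.1, q.2) *
      fderiv ℝ ((mollifier d n).normed (volume : Measure (Fin d → ℝ))) (q.1.2 - q.2)
        (Pi.single i 1) := by
    refine Measurable.stronglyMeasurable (Measurable.mul ?_ ?_)
    · exact hu.comp ((measurable_fst.comp measurable_fst).prodMk measurable_snd)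
    · exact hc.measurable.comp ((measurable_snd.comp measurable_fst).sub measurable_snd)
  exact (h1.integral_prod_right' (ν := volume)).measurable

/-- Weak gradients chosen separately for each `s` need not be measurable in `s`. The mollified
gradients are integrals of `u` itself, hence jointly measurable, and converge almost everywhere to
any version on each section. -/
theorem exists_isGrad (hu : BddMeas u) (h : ∀ s i, HasBddWeakPartial i fun x => u (s, x)) :
    ∃ V : Fin d → S × (Fin d → ℝ) → ℝ, IsGrad u V := by
  choose v hv hw using h
  -- The upper limit is defined everywhere, is measurable, and inherits the uniform bound of the
  -- mollified gradients.
  let V : Fin d → S × (Fin d → ℝ) → ℝ := fun i p =>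
    limsup (fun n => mollGrad i n (fun x => u (p.1, x)) p.2) atTop
  have hV : ∀ i s, (fun x => V i (s, x)) =ᵐ[volume] v s i := by
    intro i s
    filter_upwards [ae_tendsto_mollGrad (hv s i) (hw s i)] with x hx
    exact hx.limsup_eq
  refine ⟨V, hu, fun i => ?_, fun i s => ?_, fun i s ψ hψ hc => ?_⟩
  · exact Measurable.limsup fun n => measurable_mollGrad hu.1 i n
  · obtain ⟨M, hM⟩ := exists_abs_mollGrad_le (hv s i) (hw s i)
    refine ⟨M, fun x => abs_le.2 ⟨?_, ?_⟩⟩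
    · exact le_limsup_of_le
        (isBoundedUnder_of ⟨M, fun n => (abs_le.1 (hM n x)).2⟩)
        fun b hb => by
          obtain ⟨n, hn⟩ := hb.exists
          exact (abs_le.1 (hM n x)).1.trans hn
    · exact limsup_le_of_le
        (isBoundedUnder_of ⟨-M, fun n => (abs_le.1 (hM n x)).1⟩ : IsBoundedUnder _ _ _).isCoboundedUnder_le
        (Eventually.of_forall fun n => (abs_le.1 (hM n x)).2)
  · rw [hw s i ψ hψ hc]
    congr 1
    refine integral_congr_ae ?_
    filter_upwards [hV i s] with x hx
    rw [hx]

end WeakGradient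

/-! ### Bounded functions with continuous bounded gradient along the sections -/

section SmoothSections

variable {d : ℕ} {S : Type*}

/-- The classical partial derivative along the sections. -/
def pgrad (i : Fin d) (w : S × (Fin d → ℝ) → ℝ) (p : S × (Fin d → ℝ)) : ℝ :=
  fderiv ℝ (fun x => w (p.1, x)) p.2 (Pi.single i 1)

theorem pgrad_tensor (f : S → ℝ) {g : (Fin d → ℝ) → ℝ} (hg : Differentiable ℝ g) (i : Fin d) :
    pgrad i (fun p => f p.1 * g p.2) = fun p => f p.1 * fderiv ℝ g p.2 (Pi.single i 1) := by
  funext p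
  unfold pgrad
  simp only
  rw [fderiv_const_mul (hg p.2)]
  rfl

variable [TopologicalSpace S]

/-- Bounded continuous functions with `C¹` sections and bounded continuous gradient. -/
structure IsSmoothBdd (w : S × (Fin d → ℝ) → ℝ) : Prop where
  continuous : Continuous w
  bdd : ∃ M : ℝ, ∀ p, |w p| ≤ M
  contDiff : ∀ s, ContDiff ℝ 1 fun x => w (s, x)
  continuous_grad : ∀ i, Continuous (pgrad i w)
  bdd_grad : ∀ i, ∃ M : ℝ, ∀ p, |pgrad i w p| ≤ M

theorem pgrad_add {w w' : S × (Fin d → ℝ) → ℝ} (h : IsSmoothBdd w) (h' : IsSmoothBdd w')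
    (i : Fin d) : pgrad i (w + w') = pgrad i w + pgrad i w' := by
  funext p
  unfold pgrad
  have := fderiv_fun_add ((h.contDiff p.1).differentiable (by simp) p.2)
    ((h'.contDiff p.1).differentiable (by simp) p.2)
  simp only [Pi.add_apply]
  rw [this]
  rfl

theorem pgrad_smul {w : S × (Fin d → ℝ) → ℝ} (h : IsSmoothBdd w) (c : ℝ)
    (i : Fin d) : pgrad i (c • w) = c • pgrad i w := by
  funext p
  unfold pgrad
  have := fderiv_const_mul ((h.contDiff p.1).differentiable (by simp) p.2) c
  simp only [Pi.smul_apply, smul_eq_mul]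
  rw [this]
  rfl

theorem IsSmoothBdd.add {w w' : S × (Fin d → ℝ) → ℝ} (h : IsSmoothBdd w) (h' : IsSmoothBdd w') :
    IsSmoothBdd (w + w') where
  continuous := h.continuous.add h'.continuous
  bdd := by
    obtain ⟨M, hM⟩ := h.bdd
    obtain ⟨L, hL⟩ := h'.bdd
    exact ⟨M + L, fun p => (abs_add_le _ _).trans (add_le_add (hM p) (hL p))⟩
  contDiff s := (h.contDiff s).add (h'.contDiff s)
  continuous_grad i := by
    rw [pgrad_add h h']; exact (h.continuous_grad i).add (h'.continuous_grad i)
  bdd_grad i := by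
    rw [pgrad_add h h']
    obtain ⟨M, hM⟩ := h.bdd_grad i
    obtain ⟨L, hL⟩ := h'.bdd_grad i
    exact ⟨M + L, fun p => (abs_add_le _ _).trans (add_le_add (hM p) (hL p))⟩

theorem IsSmoothBdd.smul {w : S × (Fin d → ℝ) → ℝ} (h : IsSmoothBdd w) (c : ℝ) :
    IsSmoothBdd (c • w) where
  continuous := h.continuous.const_smul c
  bdd := by
    obtain ⟨M, hM⟩ := h.bdd
    refine ⟨|c| * M, fun p => ?_⟩
    rw [Pi.smul_apply, smul_eq_mul, abs_mul]
    exact mul_le_mul_of_nonneg_left (hM p) (abs_nonneg c)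
  contDiff s := (h.contDiff s).const_smul c
  continuous_grad i := by rw [pgrad_smul h]; exact (h.continuous_grad i).const_smul c
  bdd_grad i := by
    rw [pgrad_smul h]
    obtain ⟨M, hM⟩ := h.bdd_grad i
    refine ⟨|c| * M, fun p => ?_⟩
    rw [Pi.smul_apply, smul_eq_mul, abs_mul]
    exact mul_le_mul_of_nonneg_left (hM p) (abs_nonneg c)

theorem pgrad_sub {w w' : S × (Fin d → ℝ) → ℝ} (h : IsSmoothBdd w) (h' : IsSmoothBdd w')
    (i : Fin d) : pgrad i (w - w') = pgrad i w - pgrad i w' := by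
  have := pgrad_add h (h'.smul (-1)) i
  rw [pgrad_smul h'] at this
  simpa [sub_eq_add_neg] using this

theorem isSmoothBdd_tensor (f : S →ᵇ ℝ) {g : (Fin d → ℝ) → ℝ} (hg : ContDiff ℝ 1 g)
    (hc : HasCompactSupport g) : IsSmoothBdd fun p : S × (Fin d → ℝ) => f p.1 * g p.2 := by
  have hcd : ∀ i, Continuous fun x => fderiv ℝ g x (Pi.single i 1) := fun i =>
    (hg.continuous_fderiv (by simp)).clm_apply continuous_const
  refine ⟨(f.continuous.comp continuous_fst).mul (hg.continuous.comp continuous_snd), ?_,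
    fun s => (contDiff_const (c := f s)).mul hg, fun i => ?_, fun i => ?_⟩
  · obtain ⟨M, hM⟩ := hc.exists_bound_of_continuous hg.continuous
    refine ⟨‖f‖ * M, fun p => ?_⟩
    rw [abs_mul]
    exact mul_le_mul (f.norm_coe_le_norm _) (hM _) (abs_nonneg _) (norm_nonneg _)
  · rw [pgrad_tensor _ (hg.differentiable (by simp))]
    exact (f.continuous.comp continuous_fst).mul ((hcd i).comp continuous_snd)
  · rw [pgrad_tensor _ (hg.differentiable (by simp))]
    obtain ⟨M, hM⟩ := (hc.fderiv_apply (𝕜 := ℝ) (v := Pi.single i 1)).exists_bound_of_continuous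
      (hcd i)
    refine ⟨‖f‖ * M, fun p => ?_⟩
    rw [abs_mul]
    exact mul_le_mul (f.norm_coe_le_norm _) (hM _) (abs_nonneg _) (norm_nonneg _)

theorem isSmoothBdd_of_mem_core {w : S × (Fin d → ℝ) → ℝ} (hw : w ∈ core S d) : IsSmoothBdd w := by
  unfold core at hw
  induction hw using Submodule.span_induction with
  | mem h hh =>
    obtain ⟨f, g, hg, hc, rfl⟩ := hh
    exact isSmoothBdd_tensor f hg hc
  | zero =>
    have h0 : ∀ i, pgrad i (0 : S × (Fin d → ℝ) → ℝ) = 0 := by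
      intro i; funext p; simp [pgrad]
    exact ⟨continuous_const, ⟨0, fun _ => by simp⟩, fun _ => contDiff_const,
      fun i => by rw [h0]; exact continuous_const, fun i => ⟨0, fun _ => by rw [h0]; simp⟩⟩
  | add x y _ _ hx hy => exact hx.add hy
  | smul c x _ hx => exact hx.smul c

variable [MeasurableSpace S]

theorem IsSmoothBdd.isGrad [OpensMeasurableSpace (S × (Fin d → ℝ))] {w : S × (Fin d → ℝ) → ℝ}
    (h : IsSmoothBdd w) : IsGrad w fun i => pgrad i w where
  bddMeas := ⟨h.continuous.measurable, h.bdd⟩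
  measurable i := (h.continuous_grad i).measurable
  bdd i s := (h.bdd_grad i).imp fun _ hM x => hM (s, x)
  weak _ s := isWeakPartial_fderiv (h.contDiff s)

theorem IsSmoothBdd.isClassD [OpensMeasurableSpace (S × (Fin d → ℝ))] {w : S × (Fin d → ℝ) → ℝ}
    (h : IsSmoothBdd w) (s : S) : IsClassD fun x => w (s, x) :=
  ⟨(h.contDiff s).continuous, h.bdd.imp fun _ hM x => hM (s, x), fun i =>
    ⟨_, (h.isGrad.bddMeas_grad i s).memLp_top, h.isGrad.weak i s⟩⟩

end SmoothSections

/-! ### The energy as an integral over the product space -/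

section Energy

variable {d : ℕ} {S : Type*} [MeasurableSpace S]

/-- The square of the `L²`-norm of a vector field. -/
def gradSq {X : Type*} [MeasurableSpace X] (m : Measure X) (V : Fin d → X → ℝ) : ℝ≥0∞ :=
  ∫⁻ p, ENNReal.ofReal (∑ i, V i p ^ 2) ∂m

theorem gradSq_eq_sum {X : Type*} [MeasurableSpace X] {m : Measure X} {V : Fin d → X → ℝ}
    (hV : ∀ i, AEStronglyMeasurable (V i) m) : gradSq m V = ∑ i, eLpNorm (V i) 2 m ^ 2 := by
  unfold gradSq
  simp only [eLpNorm_two_sq_eq]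
  rw [← lintegral_finsetSum' _ fun i _ => ((hV i).aemeasurable.pow_const 2).ennreal_ofReal]
  exact lintegral_congr fun p => ENNReal.ofReal_sum_of_nonneg fun i _ => sq_nonneg _

theorem gradSq_congr {X : Type*} [MeasurableSpace X] {m : Measure X} {V W : Fin d → X → ℝ}
    (h : ∀ i, V i =ᵐ[m] W i) : gradSq m V = gradSq m W := by
  unfold gradSq
  refine lintegral_congr_ae ?_
  filter_upwards [ae_all_iff.2 h] with p hp
  simp only [hp]

theorem eLpNorm_sq_le_gradSq {X : Type*} [MeasurableSpace X] {m : Measure X} {V : Fin d → X → ℝ}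
    (i : Fin d) : eLpNorm (V i) 2 m ^ 2 ≤ gradSq m V := by
  rw [eLpNorm_two_sq_eq]
  exact lintegral_mono fun p => ENNReal.ofReal_le_ofReal
    (Finset.single_le_sum (f := fun j => V j p ^ 2) (fun j _ => sq_nonneg _) (Finset.mem_univ i))

variable (μ : Measure (S × (Fin d → ℝ)))

/-- Cut-off functions: measurable with values in the unit interval. -/
def IsCut (κ : S × (Fin d → ℝ) → ℝ) : Prop := Measurable κ ∧ ∀ p, κ p ∈ Icc (0 : ℝ) 1

variable {κ : S × (Fin d → ℝ) → ℝ}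

theorem cutMeasure_le (hκ : IsCut κ) : cutMeasure μ κ ≤ μ := by
  have h : cutMeasure μ κ ≤ μ.withDensity 1 := withDensity_mono (ae_of_all _ fun p => by
    simpa using (hκ.2 p).2)
  rwa [withDensity_one] at h

theorem integral_cutMeasure (hκ : IsCut κ) (F : S × (Fin d → ℝ) → ℝ) :
    ∫ p, F p ∂cutMeasure μ κ = ∫ p, F p * κ p ∂μ := by
  unfold cutMeasure
  rw [integral_withDensity_eq_integral_toReal_smul hκ.1.ennreal_ofReal
    (ae_of_all _ fun p => ENNReal.ofReal_lt_top)]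
  refine integral_congr_ae (ae_of_all _ fun p => ?_)
  simp only [smul_eq_mul, ENNReal.toReal_ofReal (hκ.2 p).1, mul_comm]

theorem cutMeasure_one : cutMeasure μ (fun _ => 1) = μ := by
  unfold cutMeasure
  simp only [ENNReal.ofReal_one]
  exact withDensity_one

variable [IsFiniteMeasure μ]

theorem isFiniteMeasure_cutMeasure (hκ : IsCut κ) : IsFiniteMeasure (cutMeasure μ κ) :=
  isFiniteMeasure_of_le μ (cutMeasure_le μ hκ)

theorem lintegral_cutMeasure (hκ : IsCut κ) {F : S × (Fin d → ℝ) → ℝ≥0∞} (hF : Measurable F) :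
    ∫⁻ p, F p ∂cutMeasure μ κ
      = ∫⁻ s, ∫⁻ x, F (s, x) * ENNReal.ofReal (κ (s, x)) ∂μ.condKernel s ∂μ.fst := by
  unfold cutMeasure
  rw [lintegral_withDensity_eq_lintegral_mul _ hκ.1.ennreal_ofReal hF,
    Measure.lintegral_condKernel (f := fun p => F p * ENNReal.ofReal (κ p))
      (hF.mul hκ.1.ennreal_ofReal)]
  simp only [Pi.mul_apply, mul_comm]

variable {u : S × (Fin d → ℝ) → ℝ} {V : Fin d → S × (Fin d → ℝ) → ℝ}

theorem IsGrad.energy_eq (h : IsGrad u V) (s : S) (κ : S × (Fin d → ℝ) → ℝ) :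
    energy (cutDensity μ κ s) (fun x => u (s, x)) (fun x => u (s, x))
      = ∫ x, (∑ i, V i (s, x) ^ 2) * κ (s, x) * density (μ.condKernel s) x := by
  unfold energy cutDensity condDensity
  refine integral_congr_ae ?_
  filter_upwards [ae_all_iff.2 fun i => h.weakPartial_ae_eq i s] with x hx
  simp only [hx, pow_two, mul_assoc]

theorem energy_nonneg (hκ : IsCut κ) (s : S) (f : (Fin d → ℝ) → ℝ) :
    0 ≤ energy (cutDensity μ κ s) f f :=
  integral_nonneg fun x => mul_nonneg (Finset.sum_nonneg fun _ _ => mul_self_nonneg _)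
    (mul_nonneg (hκ.2 _).1 (density_nonneg _ x))

theorem IsGrad.bddMeas_sum_sq (h : IsGrad u V) (s : S) :
    BddMeas fun x => ∑ i, V i (s, x) ^ 2 := by
  choose M hM using fun i => (h.bddMeas_grad i s).sq.2
  refine ⟨Finset.measurable_sum _ fun i _ => (h.bddMeas_grad i s).sq.1, ∑ i, M i, fun x => ?_⟩
  exact (Finset.abs_sum_le_sum_abs _ _).trans (Finset.sum_le_sum fun i _ => hM i x)

theorem bddMeas_cut_section (hκ : IsCut κ) (s : S) : BddMeas fun x => κ (s, x) :=
  ⟨hκ.1.comp measurable_prodMk_left, 1, fun x => by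
    rw [abs_of_nonneg (hκ.2 _).1]; exact (hκ.2 _).2⟩

theorem IsGrad.ofReal_energy (h : IsGrad u V) (hκ : IsCut κ) {s : S}
    (hs : μ.condKernel s ≪ volume) :
    ENNReal.ofReal (energy (cutDensity μ κ s) (fun x => u (s, x)) (fun x => u (s, x)))
      = ∫⁻ x, ENNReal.ofReal (∑ i, V i (s, x) ^ 2) * ENNReal.ofReal (κ (s, x))
          ∂μ.condKernel s := by
  have hs1 : IsFiniteMeasure (μ.condKernel s) := inferInstance
  rw [h.energy_eq μ s κ, integral_mul_density (m := μ.condKernel s) hs,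
    ofReal_integral_eq_lintegral_ofReal
      (((h.bddMeas_sum_sq s).mul (bddMeas_cut_section hκ s)).integrable _)
      (ae_of_all _ fun x => mul_nonneg (Finset.sum_nonneg fun i _ => sq_nonneg _) (hκ.2 _).1)]
  exact lintegral_congr fun x => ENNReal.ofReal_mul (Finset.sum_nonneg fun i _ => sq_nonneg _)

/-- Disintegration turns the direct integral of the energies into a squared norm on `L²(κ μ)`. From
here on the forms are handled through gradients in that space. -/
theorem IsGrad.lintegral_energy (h : IsGrad u V) (hκ : IsCut κ)
    (hac : ∀ᵐ s ∂μ.fst, μ.condKernel s ≪ volume) :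
    ∫⁻ s, ENNReal.ofReal (energy (cutDensity μ κ s) (fun x => u (s, x)) (fun x => u (s, x)))
      ∂μ.fst = gradSq (cutMeasure μ κ) V := by
  unfold gradSq
  rw [lintegral_cutMeasure μ hκ
    (Finset.measurable_sum _ fun i _ => (h.measurable i).pow_const 2).ennreal_ofReal]
  refine lintegral_congr_ae ?_
  filter_upwards [hac] with s hs
  exact h.ofReal_energy μ hκ hs

theorem IsGrad.aemeasurable_energy (h : IsGrad u V) (hκ : IsCut κ)
    (hac : ∀ᵐ s ∂μ.fst, μ.condKernel s ≪ volume) :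
    AEMeasurable (fun s => energy (cutDensity μ κ s) (fun x => u (s, x)) (fun x => u (s, x)))
      μ.fst := by
  have hm : Measurable fun s => ∫⁻ x, ENNReal.ofReal (∑ i, V i (s, x) ^ 2) *
      ENNReal.ofReal (κ (s, x)) ∂μ.condKernel s :=
    Measurable.lintegral_kernel_prod_right' (f := fun p : S × (Fin d → ℝ) =>
      ENNReal.ofReal (∑ i, V i p ^ 2) * ENNReal.ofReal (κ p))
      ((Finset.measurable_sum _ fun i _ => (h.measurable i).pow_const 2).ennreal_ofReal.mul
        hκ.1.ennreal_ofReal)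
  refine ⟨_, hm.ennreal_toReal, ?_⟩
  filter_upwards [hac] with s hs
  rw [← h.ofReal_energy μ hκ hs, ENNReal.toReal_ofReal (energy_nonneg μ hκ s _)]

theorem IsGrad.ofReal_directEnergy (h : IsGrad u V) (hκ : IsCut κ)
    (hac : ∀ᵐ s ∂μ.fst, μ.condKernel s ≪ volume) (hfin : gradSq (cutMeasure μ κ) V < ⊤) :
    ENNReal.ofReal (directEnergy μ.fst (cutDensity μ κ) u u) = gradSq (cutMeasure μ κ) V := by
  unfold directEnergy
  rw [ofReal_integral_eq_lintegral_ofReal _ (ae_of_all _ fun s => energy_nonneg μ hκ s _),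
    h.lintegral_energy μ hκ hac]
  refine ⟨(h.aemeasurable_energy μ hκ hac).aestronglyMeasurable, ?_⟩
  rw [hasFiniteIntegral_iff_ofReal (ae_of_all _ fun s => energy_nonneg μ hκ s _),
    h.lintegral_energy μ hκ hac]
  exact hfin

theorem exists_isGrad_of_mem_directDomain (hκ : IsCut κ)
    (hac : ∀ᵐ s ∂μ.fst, μ.condKernel s ≪ volume)
    (hu : u ∈ directDomain μ.fst (cutDensity μ κ)) :
    ∃ V : Fin d → S × (Fin d → ℝ) → ℝ, IsGrad u V ∧ gradSq (cutMeasure μ κ) V < ⊤ := by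
  obtain ⟨h1, h2, -, h4⟩ := hu
  obtain ⟨V, hV⟩ := exists_isGrad h1 fun s i => (h2 s).2.2 i
  refine ⟨V, hV, ?_⟩
  rw [← hV.lintegral_energy μ hκ hac]
  exact (hasFiniteIntegral_iff_ofReal (ae_of_all _ fun s => energy_nonneg μ hκ s _)).1 h4.2

theorem memLp_of_gradSq_lt_top {X : Type*} [MeasurableSpace X] {m : Measure X}
    {V : Fin d → X → ℝ} (hV : ∀ i, Measurable (V i)) (h : gradSq m V < ⊤) (i : Fin d) :
    MemLp (V i) 2 m := by
  refine ⟨(hV i).aestronglyMeasurable, ?_⟩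
  have := (eLpNorm_sq_le_gradSq i).trans_lt h
  by_contra hc
  rw [not_lt, top_le_iff] at hc
  rw [hc] at this
  simp at this

theorem gradSq_lt_top {X : Type*} [MeasurableSpace X] {m : Measure X} {V : Fin d → X → ℝ}
    (hV : ∀ i, MemLp (V i) 2 m) : gradSq m V < ⊤ := by
  rw [gradSq_eq_sum fun i => (hV i).1]
  exact ENNReal.sum_lt_top.2 fun i _ => ENNReal.pow_lt_top (hV i).2

/-- The densities of a kernel have a jointly measurable version. -/
theorem exists_measurable_density (K : Kernel S (Fin d → ℝ)) [IsFiniteKernel K] :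
    ∃ ϱ : S × (Fin d → ℝ) → ℝ, Measurable ϱ ∧ ∀ s, density (K s) =ᵐ[volume] fun x => ϱ (s, x) := by
  -- Ratios over shrinking balls are jointly measurable and converge almost everywhere to the
  -- density by Besicovitch differentiation.
  let q : ℕ → S × (Fin d → ℝ) → ℝ≥0∞ := fun n p =>
    K p.1 (Metric.closedBall p.2 (1 / ((n : ℝ) + 1))) /
      volume (Metric.closedBall p.2 (1 / ((n : ℝ) + 1)))
  have hq : ∀ n, Measurable (q n) := by
    intro n
    refine Measurable.div ?_ ?_
    · have hset : MeasurableSet {z : (S × (Fin d → ℝ)) × (Fin d → ℝ) |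
          dist z.2 z.1.2 ≤ 1 / ((n : ℝ) + 1)} :=
        measurableSet_le (measurable_snd.dist (measurable_snd.comp measurable_fst))
          measurable_const
      exact Kernel.measurable_kernel_prodMk_left (κ := K.comap Prod.fst measurable_fst) hset
    · have hset : MeasurableSet {z : (S × (Fin d → ℝ)) × (Fin d → ℝ) |
          dist z.2 z.1.2 ≤ 1 / ((n : ℝ) + 1)} :=
        measurableSet_le (measurable_snd.dist (measurable_snd.comp measurable_fst))
          measurable_const
      exact measurable_measure_prodMk_left (ν := volume) hset
  refine ⟨fun p => (limsup (fun n => q n p) atTop).toReal,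
    (Measurable.limsup hq).ennreal_toReal, fun s => ?_⟩
  have hseq : Tendsto (fun n : ℕ => 1 / ((n : ℝ) + 1)) atTop (𝓝[>] 0) :=
    tendsto_nhdsWithin_iff.2 ⟨tendsto_one_div_add_atTop_nhds_zero_nat,
      Eventually.of_forall fun n => by simp only [mem_Ioi]; positivity⟩
  filter_upwards [Besicovitch.ae_tendsto_rnDeriv (K s) (volume : Measure (Fin d → ℝ))] with x hx
  unfold density
  rw [(hx.comp hseq).limsup_eq.symm]
  rfl

theorem IsSmoothBdd.mem_directDomain [TopologicalSpace S]
    [OpensMeasurableSpace (S × (Fin d → ℝ))] {w : S × (Fin d → ℝ) → ℝ} (h : IsSmoothBdd w)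
    (hκ : IsCut κ) (hac : ∀ᵐ s ∂μ.fst, μ.condKernel s ≪ volume) :
    w ∈ directDomain μ.fst (cutDensity μ κ) := by
  have hg := h.isGrad
  -- The pre-domain asks for genuine, not merely almost everywhere, measurability of the energy in
  -- `s`. A jointly measurable density valid for every `s` provides it.
  obtain ⟨ϱ, hϱ, hϱe⟩ := exists_measurable_density μ.condKernel
  refine ⟨hg.bddMeas, h.isClassD, ?_, ⟨(hg.aemeasurable_energy μ hκ hac).aestronglyMeasurable, ?_⟩⟩
  · have hsm : StronglyMeasurable fun p : S × (Fin d → ℝ) =>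
        (∑ i, pgrad i w p ^ 2) * κ p * ϱ p :=
      (((Finset.measurable_sum _ fun i _ => (hg.measurable i).pow_const 2).mul hκ.1).mul
        hϱ).stronglyMeasurable
    have hm := (hsm.integral_prod_right' (ν := volume)).measurable
    convert! hm using 1
    funext s
    rw [hg.energy_eq μ s κ]
    refine integral_congr_ae ?_
    filter_upwards [hϱe s] with x hx
    rw [hx]
  · rw [hasFiniteIntegral_iff_ofReal (ae_of_all _ fun s => energy_nonneg μ hκ s _),
      hg.lintegral_energy μ hκ hac]
    have := isFiniteMeasure_cutMeasure μ hκ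
    exact gradSq_lt_top fun i => BddMeas.memLp ⟨hg.measurable i, h.bdd_grad i⟩ _ 2

theorem cutDensity_one : cutDensity μ (fun _ => 1) = condDensity μ := by
  funext s x
  simp [cutDensity]

theorem isCut_one : IsCut (fun _ : S × (Fin d → ℝ) => (1 : ℝ)) :=
  ⟨measurable_const, fun _ => by simp⟩

theorem gradForm_eq_cutForm (u : S × (Fin d → ℝ) → ℝ) :
    gradForm μ u = cutForm μ (fun _ => 1) u := by
  unfold gradForm cutForm
  rw [cutMeasure_one, cutDensity_one]

theorem memGradMin_iff_memCutMin [TopologicalSpace S] (u : S × (Fin d → ℝ) → ℝ) :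
    MemGradMin μ u ↔ MemCutMin μ (fun _ => 1) u := by
  unfold MemGradMin MemCutMin
  rw [cutMeasure_one, cutDensity_one]

end Energy

/-! ### Closability -/

section Closability

/-- Cauchy–Schwarz for `g h^{1/2} · h^{-1/2}`. Integrability of the inverse weight on `B` excludes
zeros of `h` there, up to a null set. -/
theorem lintegral_enorm_le_of_weight {X : Type*} [MeasurableSpace X] {m : Measure X}
    {h : X → ℝ≥0∞} (hm : Measurable h) (htop : ∀ᵐ x ∂m, h x < ⊤) {B : Set X}
    (hfin : ∫⁻ x in B, (h x)⁻¹ ∂m < ⊤) {g : X → ℝ} (hg : AEMeasurable g m) :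
    ∫⁻ x in B, ‖g x‖ₑ ∂m
      ≤ (∫⁻ x, ENNReal.ofReal (g x ^ 2) * h x ∂m) ^ (1 / 2 : ℝ)
        * (∫⁻ x in B, (h x)⁻¹ ∂m) ^ (1 / 2 : ℝ) := by
  have hpos : ∀ᵐ x ∂m.restrict B, h x ≠ 0 := by
    filter_upwards [ae_lt_top hm.inv hfin.ne] with x hx h0
    rw [Pi.inv_apply, h0, ENNReal.inv_zero] at hx
    exact lt_irrefl _ hx
  have h1 : ∫⁻ x in B, ‖g x‖ₑ ∂m
      ≤ ∫⁻ x in B, ((fun x => ‖g x‖ₑ * h x ^ (1 / 2 : ℝ)) * fun x => (h x)⁻¹ ^ (1 / 2 : ℝ)) x ∂m := by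
    refine lintegral_mono_ae ?_
    filter_upwards [hpos, ae_restrict_of_ae htop] with x hx hx'
    rw [Pi.mul_apply, mul_assoc, ← ENNReal.mul_rpow_of_nonneg _ _ (by norm_num),
      ENNReal.mul_inv_cancel hx hx'.ne, ENNReal.one_rpow, mul_one]
  refine h1.trans ((ENNReal.lintegral_mul_le_Lp_mul_Lq (m.restrict B)
    Real.HolderConjugate.two_two (hg.restrict.enorm.mul (hm.pow_const _).aemeasurable)
    (hm.inv.pow_const _).aemeasurable).trans ?_)
  refine mul_le_mul' (ENNReal.rpow_le_rpow ?_ (by norm_num)) (ENNReal.rpow_le_rpow ?_ (by norm_num))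
  · refine (setLIntegral_le_lintegral _ _).trans (lintegral_mono fun x => ?_)
    simp only [Pi.mul_apply]
    rw [ENNReal.mul_rpow_of_nonneg _ _ (by norm_num), ← ENNReal.rpow_mul]
    norm_num
    rw [← enorm_pow, Real.enorm_of_nonneg (sq_nonneg _)]
  · refine lintegral_mono fun x => ?_
    rw [← ENNReal.rpow_mul]
    norm_num

variable {d : ℕ}

/-- The points near which the inverse density is integrable. -/
def hamzaSet (m : Measure (Fin d → ℝ)) : Set (Fin d → ℝ) :=
  {x | ∃ ε : ℝ, 0 < ε ∧ ∫⁻ y in Icc (fun i => x i - ε) (fun i => x i + ε),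
    (m.rnDeriv volume y)⁻¹ < ⊤}

theorem box_mem_nhds (x : Fin d → ℝ) {ε : ℝ} (hε : 0 < ε) :
    Icc (fun i => x i - ε) (fun i => x i + ε) ∈ 𝓝 x := by
  have : Icc (fun i => x i - ε) (fun i => x i + ε) = univ.pi fun i => Icc (x i - ε) (x i + ε) :=
    (pi_univ_Icc _ _).symm
  rw [this]
  exact set_pi_mem_nhds finite_univ fun i _ => Icc_mem_nhds (by linarith) (by linarith)

theorem isOpen_hamzaSet (m : Measure (Fin d → ℝ)) : IsOpen (hamzaSet m) := by
  rw [isOpen_iff_mem_nhds]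
  rintro x ⟨ε, hε, hx⟩
  filter_upwards [box_mem_nhds x (half_pos hε)] with y hy
  refine ⟨ε / 2, half_pos hε, lt_of_le_of_lt (lintegral_mono_set ?_) hx⟩
  refine Icc_subset_Icc (fun i => ?_) (fun i => ?_)
  · have := hy.1 i
    dsimp only at this ⊢
    linarith
  · have := hy.2 i
    dsimp only at this ⊢
    linarith

variable {m : Measure (Fin d → ℝ)} {κ : (Fin d → ℝ) → ℝ}

/-- The property is local, so compactness suffices. Near a point with `κ x > 0` the cut-off exceeds
`κ x / 2`, and Hamza's condition handles the density. -/
theorem setLIntegral_inv_weight_lt_top (hκ : Continuous κ) {B : Set (Fin d → ℝ)}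
    (hB : IsCompact B) (hBG : B ⊆ hamzaSet m ∩ {x | 0 < κ x}) :
    ∫⁻ x in B, (ENNReal.ofReal (κ x) * m.rnDeriv volume x)⁻¹ < ⊤ := by
  refine hB.induction_on (p := fun B => ∫⁻ x in B, (ENNReal.ofReal (κ x) *
    m.rnDeriv volume x)⁻¹ < ⊤) (by simp) (fun s t hst ht => ?_) (fun s t hs ht => ?_)
    fun x hx => ?_
  · exact (lintegral_mono_set hst).trans_lt ht
  · exact (lintegral_union_le _ s t).trans_lt (ENNReal.add_lt_top.2 ⟨hs, ht⟩)
  · obtain ⟨⟨ε, hε, h1⟩, h2⟩ := hBG hx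
    have h3 : {y | κ x / 2 < κ y} ∈ 𝓝 x :=
      (isOpen_lt continuous_const hκ).mem_nhds (show κ x / 2 < κ x from half_lt_self h2)
    have hx2 : 0 < κ x / 2 := half_pos h2
    refine ⟨_, mem_nhdsWithin_of_mem_nhds (inter_mem h3 (box_mem_nhds x hε)), ?_⟩
    have hmeas : MeasurableSet ({y | κ x / 2 < κ y} ∩
        Icc (fun i => x i - ε) (fun i => x i + ε)) :=
      (isOpen_lt continuous_const hκ).measurableSet.inter measurableSet_Icc
    calc ∫⁻ y in {y | κ x / 2 < κ y} ∩ Icc (fun i => x i - ε) (fun i => x i + ε),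
          (ENNReal.ofReal (κ y) * m.rnDeriv volume y)⁻¹
        ≤ ∫⁻ y in {y | κ x / 2 < κ y} ∩ Icc (fun i => x i - ε) (fun i => x i + ε),
          (ENNReal.ofReal (κ x / 2))⁻¹ * (m.rnDeriv volume y)⁻¹ := by
          refine setLIntegral_mono' hmeas fun y hy => ?_
          have hy1 : κ x / 2 < κ y := hy.1
          rw [ENNReal.mul_inv (Or.inl (ENNReal.ofReal_pos.2 (hx2.trans hy1)).ne')
            (Or.inl ENNReal.ofReal_ne_top)]
          exact mul_le_mul_left (ENNReal.inv_le_inv.2 (ENNReal.ofReal_le_ofReal hy1.le)) _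
      _ ≤ ∫⁻ y in Icc (fun i => x i - ε) (fun i => x i + ε),
          (ENNReal.ofReal (κ x / 2))⁻¹ * (m.rnDeriv volume y)⁻¹ :=
          lintegral_mono_set inter_subset_right
      _ = (ENNReal.ofReal (κ x / 2))⁻¹ * ∫⁻ y in Icc (fun i => x i - ε) (fun i => x i + ε),
          (m.rnDeriv volume y)⁻¹ :=
          lintegral_const_mul _ (Measure.measurable_rnDeriv _ _).inv
      _ < ⊤ := ENNReal.mul_lt_top (ENNReal.inv_lt_top.2 (ENNReal.ofReal_pos.2 hx2)) h1

theorem abs_integral_mul_le_of_support {g ψ : (Fin d → ℝ) → ℝ} {M : ℝ} (hM : ∀ x, |ψ x| ≤ M)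
    {B : Set (Fin d → ℝ)} (hB : MeasurableSet B) (hψ : ∀ x, x ∉ B → ψ x = 0) :
    ENNReal.ofReal |∫ x, g x * ψ x| ≤ ENNReal.ofReal M * ∫⁻ x in B, ‖g x‖ₑ := by
  rw [← Real.enorm_eq_ofReal_abs, ← lintegral_const_mul' _ _ ENNReal.ofReal_ne_top,
    ← lintegral_indicator hB]
  refine (enorm_integral_le_lintegral_enorm _).trans (lintegral_mono fun x => ?_)
  by_cases hx : x ∈ B
  · rw [indicator_of_mem hx, enorm_mul, mul_comm, Real.enorm_eq_ofReal_abs (ψ x)]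
    exact mul_le_mul_left (ENNReal.ofReal_le_ofReal (hM x)) _
  · simp [hψ x hx]

/-- Hamza's closability argument. On compact subsets of the open set where the weight has locally
integrable inverse, the weighted `L²` limits are `L¹` limits. The weak derivative identity for `f k
→ 0` then passes to the limit, and `W` annihilates all test functions supported there. -/
theorem ae_eq_zero_of_tendsto_weighted [IsFiniteMeasure m] (hκ : Continuous κ) {i : Fin d}
    {f v : ℕ → (Fin d → ℝ) → ℝ} (hf : ∀ k, BddMeas (f k)) (hv : ∀ k, BddMeas (v k))
    (hw : ∀ k, IsWeakPartial i (f k) (v k)) {W : (Fin d → ℝ) → ℝ} (hW : Measurable W)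
    (ha : Tendsto (fun k => ∫⁻ x, ENNReal.ofReal (f k x ^ 2) *
      (ENNReal.ofReal (κ x) * m.rnDeriv volume x)) atTop (𝓝 0))
    (hb : Tendsto (fun k => ∫⁻ x, ENNReal.ofReal ((v k x - W x) ^ 2) *
      (ENNReal.ofReal (κ x) * m.rnDeriv volume x)) atTop (𝓝 0)) :
    ∀ᵐ x, x ∈ hamzaSet m ∩ {x | 0 < κ x} → W x = 0 := by
  set h : (Fin d → ℝ) → ℝ≥0∞ := fun x => ENNReal.ofReal (κ x) * m.rnDeriv volume x with hh
  have hhm : Measurable h := hκ.measurable.ennreal_ofReal.mul (Measure.measurable_rnDeriv _ _)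
  have htop : ∀ᵐ x, h x < ⊤ := by
    filter_upwards [Measure.rnDeriv_lt_top m volume] with x hx
    exact ENNReal.mul_lt_top ENNReal.ofReal_lt_top hx
  have hG : IsOpen (hamzaSet m ∩ {x | 0 < κ x}) :=
    (isOpen_hamzaSet m).inter (isOpen_lt continuous_const hκ)
  have hlim : ∀ {g : ℕ → (Fin d → ℝ) → ℝ}, (∀ k, Measurable (g k)) →
      Tendsto (fun k => ∫⁻ x, ENNReal.ofReal (g k x ^ 2) * h x) atTop (𝓝 0) →
      ∀ {B : Set (Fin d → ℝ)}, IsCompact B → B ⊆ hamzaSet m ∩ {x | 0 < κ x} →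
      Tendsto (fun k => ∫⁻ x in B, ‖g k x‖ₑ) atTop (𝓝 0) := by
    intro g hg hg0 B hB hBG
    have hfin := setLIntegral_inv_weight_lt_top hκ hB hBG
    refine tendsto_of_tendsto_of_tendsto_of_le_of_le tendsto_const_nhds ?_ (fun _ => zero_le)
      (fun k => lintegral_enorm_le_of_weight hhm htop hfin (hg k).aemeasurable)
    have h1 := (ENNReal.continuous_rpow_const (y := (1 / 2 : ℝ))).tendsto (0 : ℝ≥0∞)
    rw [ENNReal.zero_rpow_of_pos (by norm_num)] at h1
    have h2 := ENNReal.Tendsto.mul_const (h1.comp hg0)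
      (b := (∫⁻ x in B, (h x)⁻¹) ^ (1 / 2 : ℝ))
      (Or.inr (ENNReal.rpow_ne_top_of_nonneg (by norm_num) hfin.ne))
    rwa [zero_mul] at h2
  have hWint : ∀ {B : Set (Fin d → ℝ)}, IsCompact B → B ⊆ hamzaSet m ∩ {x | 0 < κ x} →
      IntegrableOn W B := by
    intro B hB hBG
    have h1 := hlim (fun k => (hv k).1.sub hW) hb hB hBG
    obtain ⟨k, hk⟩ := (h1.eventually_lt_const (by simp : (0 : ℝ≥0∞) < 1)).exists
    have i1 : IntegrableOn (fun x => v k x - W x) B :=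
      ⟨((hv k).1.sub hW).aestronglyMeasurable, hk.trans ENNReal.one_lt_top⟩
    have i2 : IntegrableOn (v k) B :=
      (locallyIntegrable_of_memLp_top (hv k).memLp_top).integrableOn_isCompact hB
    have i3 := i2.sub i1
    refine i3.congr_fun (fun x _ => ?_) hB.measurableSet
    simp
  refine hG.ae_eq_zero_of_integral_contDiff_smul_eq_zero ?_ fun ψ hψ hc hsupp => ?_
  · exact (locallyIntegrableOn_iff hG.isLocallyClosed).2 fun B hBG hB => hWint hB hBG
  · set B := tsupport ψ
    have hB : IsCompact B := hc
    have hψB : ∀ x, x ∉ B → ψ x = 0 := fun x hx => image_eq_zero_of_notMem_tsupport hx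
    have hdB : ∀ x, x ∉ B → fderiv ℝ ψ x (Pi.single i 1) = 0 := fun x hx => by
      rw [fderiv_of_notMem_tsupport ℝ hx]; rfl
    have hdc : Continuous fun x => fderiv ℝ ψ x (Pi.single i 1) :=
      (hψ.continuous_fderiv (by simp)).clm_apply continuous_const
    obtain ⟨M, hM⟩ := hc.exists_bound_of_continuous hψ.continuous
    obtain ⟨M', hM'⟩ := (hc.fderiv_apply (𝕜 := ℝ) (v := Pi.single i 1)).exists_bound_of_continuous
      hdc
    have hWψ : Integrable fun x => W x * ψ x := by
      have h1 : IntegrableOn (fun x => W x * ψ x) B :=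
        (hWint hB hsupp).mul_bdd (c := M) hψ.continuous.aestronglyMeasurable
          (ae_of_all _ hM)
      refine (integrableOn_iff_integrable_of_support_subset fun x hx => ?_).1 h1
      by_contra hxB
      exact hx (by simp [hψB x hxB])
    have hvψ : ∀ k, Integrable fun x => v k x * ψ x := fun k =>
      integrable_mul_test (hv k).memLp_top hψ.continuous hc
    have hle : ∀ k, ENNReal.ofReal |∫ x, W x * ψ x|
        ≤ ENNReal.ofReal M * (∫⁻ x in B, ‖v k x - W x‖ₑ)
          + ENNReal.ofReal M' * ∫⁻ x in B, ‖f k x‖ₑ := by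
      intro k
      -- The weak derivative of `f k` splits the pairing into two terms, each controlled by an `L¹`
      -- norm on the support of `ψ` that tends to zero.
      have e1 : ∫ x, W x * ψ x
          = -(∫ x, (v k x - W x) * ψ x) - ∫ x, f k x * fderiv ℝ ψ x (Pi.single i 1) := by
        rw [hw k ψ hψ hc]
        simp only [sub_mul]
        rw [integral_sub (hvψ k) hWψ]
        ring
      have e2 := abs_integral_mul_le_of_support (g := fun x => v k x - W x) hM hB.measurableSet hψB
      have e3 := abs_integral_mul_le_of_support (g := f k) hM' hB.measurableSet hdB
      rw [e1]
      refine le_trans ?_ (add_le_add e2 e3)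
      rw [← ENNReal.ofReal_add (abs_nonneg _) (abs_nonneg _)]
      refine ENNReal.ofReal_le_ofReal ((abs_sub _ _).trans ?_)
      rw [abs_neg]
    have hlim0 : Tendsto (fun k => ENNReal.ofReal M * (∫⁻ x in B, ‖v k x - W x‖ₑ)
          + ENNReal.ofReal M' * ∫⁻ x in B, ‖f k x‖ₑ) atTop (𝓝 0) := by
      have h1 := ENNReal.Tendsto.const_mul (a := ENNReal.ofReal M)
        (hlim (fun k => (hv k).1.sub hW) hb hB hsupp) (Or.inr ENNReal.ofReal_ne_top)
      have h2 := ENNReal.Tendsto.const_mul (a := ENNReal.ofReal M')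
        (hlim (fun k => (hf k).1) ha hB hsupp) (Or.inr ENNReal.ofReal_ne_top)
      simpa using h1.add h2
    have h0 := ge_of_tendsto' hlim0 hle
    rw [nonpos_iff_eq_zero, ENNReal.ofReal_eq_zero] at h0
    simp only [smul_eq_mul, mul_comm (ψ _)]
    exact abs_eq_zero.1 (le_antisymm h0 (abs_nonneg _))

end Closability

/-! ### Limits of gradients and the closed forms -/

section LimitLemmas

variable {X : Type*} [MeasurableSpace X] {m : Measure X}

/-- Along a subsequence with integrals below `2^{-k}`, the series is integrable, so its terms vanish
almost everywhere. -/
theorem exists_subseq_ae_tendsto_zero {F : ℕ → X → ℝ≥0∞} (hF : ∀ k, Measurable (F k))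
    (h : Tendsto (fun k => ∫⁻ x, F k x ∂m) atTop (𝓝 0)) :
    ∃ σ : ℕ → ℕ, StrictMono σ ∧ ∀ᵐ x ∂m, Tendsto (fun k => F (σ k) x) atTop (𝓝 0) := by
  have hev : ∀ k : ℕ, ∀ᶠ j in atTop, ∫⁻ x, F j x ∂m < (2⁻¹ : ℝ≥0∞) ^ k := fun k =>
    h.eventually_lt_const (ENNReal.pow_pos (by simp) k)
  obtain ⟨σ, hσ, hσF⟩ := extraction_forall_of_eventually hev
  refine ⟨σ, hσ, ?_⟩
  have hsum : ∫⁻ x, ∑' k, F (σ k) x ∂m ≠ ⊤ := by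
    rw [lintegral_tsum fun k => (hF _).aemeasurable]
    refine ne_top_of_le_ne_top ?_ (ENNReal.tsum_le_tsum fun k => (hσF k).le)
    rw [ENNReal.tsum_geometric, ENNReal.one_sub_inv_two, inv_inv]
    simp
  filter_upwards [ae_lt_top (Measurable.tsum fun k => hF (σ k)) hsum] with x hx
  exact ENNReal.tendsto_atTop_zero_of_tsum_ne_top hx.ne

theorem tendsto_eLpNorm_of_tendsto_sub {f : ℕ → X → ℝ} {g : X → ℝ}
    (hf : ∀ k, AEStronglyMeasurable (f k) m) (hg : MemLp g 2 m)
    (h : Tendsto (fun k => eLpNorm (f k - g) 2 m) atTop (𝓝 0)) :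
    Tendsto (fun k => eLpNorm (f k) 2 m) atTop (𝓝 (eLpNorm g 2 m)) := by
  have h1 : Tendsto (fun k => eLpNorm g 2 m - eLpNorm (f k - g) 2 m) atTop
      (𝓝 (eLpNorm g 2 m - 0)) :=
    ENNReal.Tendsto.sub tendsto_const_nhds h (Or.inl hg.2.ne)
  have h2 : Tendsto (fun k => eLpNorm (f k - g) 2 m + eLpNorm g 2 m) atTop
      (𝓝 (0 + eLpNorm g 2 m)) := h.add tendsto_const_nhds
  rw [tsub_zero] at h1
  rw [zero_add] at h2
  refine tendsto_of_tendsto_of_tendsto_of_le_of_le h1 h2 (fun k => ?_) (fun k => ?_)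
  · rw [tsub_le_iff_left]
    calc eLpNorm g 2 m = eLpNorm (f k - (f k - g)) 2 m := by congr 1; simp
      _ ≤ eLpNorm (f k) 2 m + eLpNorm (f k - g) 2 m :=
        eLpNorm_sub_le (hf k) ((hf k).sub hg.1) (by norm_num)
      _ = _ := add_comm _ _
  · calc eLpNorm (f k) 2 m = eLpNorm ((f k - g) + g) 2 m := by congr 1; simp
      _ ≤ _ := eLpNorm_add_le ((hf k).sub hg.1) hg.1 (by norm_num)

theorem tendsto_eLpNorm_sub_sub {f f' : ℕ → X → ℝ} {g g' : X → ℝ}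
    (hf : ∀ k, AEStronglyMeasurable (f k) m) (hf' : ∀ k, AEStronglyMeasurable (f' k) m)
    (hg : AEStronglyMeasurable g m) (hg' : AEStronglyMeasurable g' m)
    (h : Tendsto (fun k => eLpNorm (f k - g) 2 m) atTop (𝓝 0))
    (h' : Tendsto (fun k => eLpNorm (f' k - g') 2 m) atTop (𝓝 0)) :
    Tendsto (fun k => eLpNorm ((f k - f' k) - (g - g')) 2 m) atTop (𝓝 0) := by
  have h2 := h.add h'
  rw [add_zero] at h2
  refine tendsto_of_tendsto_of_tendsto_of_le_of_le tendsto_const_nhds h2 (fun _ => zero_le)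
    fun k => ?_
  have e : (f k - f' k) - (g - g') = (f k - g) - (f' k - g') := by abel
  rw [e]
  exact eLpNorm_sub_le ((hf k).sub hg) ((hf' k).sub hg') (by norm_num)

theorem tendsto_gradSq_of_tendsto_sub {d : ℕ} {V : ℕ → Fin d → X → ℝ} {W : Fin d → X → ℝ}
    (hV : ∀ k i, AEStronglyMeasurable (V k i) m) (hW : ∀ i, MemLp (W i) 2 m)
    (h : ∀ i, Tendsto (fun k => eLpNorm (V k i - W i) 2 m) atTop (𝓝 0)) :
    Tendsto (fun k => gradSq m (V k)) atTop (𝓝 (gradSq m W)) := by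
  rw [gradSq_eq_sum fun i => (hW i).1]
  simp only [fun k => gradSq_eq_sum (hV k)]
  exact tendsto_finsetSum _ fun i _ =>
    ENNReal.Tendsto.pow (tendsto_eLpNorm_of_tendsto_sub (fun k => hV k i) (hW i) (h i))

theorem exists_tendsto_of_cauchy_eLpNorm {f : ℕ → X → ℝ} (hf : ∀ k, MemLp (f k) 2 m)
    (h : ∀ ε : ℝ, 0 < ε → ∃ K : ℕ, ∀ k l, K ≤ k → K ≤ l →
      eLpNorm (f k - f l) 2 m < ENNReal.ofReal ε) :
    ∃ g : X → ℝ, MemLp g 2 m ∧ Tendsto (fun k => eLpNorm (f k - g) 2 m) atTop (𝓝 0) := by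
  have hc : CauchySeq fun k => (hf k).toLp (f k) := by
    rw [EMetric.cauchySeq_iff]
    intro ε hε
    obtain ⟨δ, hδ0, hδ1, hδ2⟩ := ENNReal.lt_iff_exists_real_btwn.1 hε
    have hδ : 0 < δ := by
      by_contra hcon
      rw [ENNReal.ofReal_of_nonpos (not_lt.1 hcon)] at hδ1
      exact lt_irrefl _ hδ1
    obtain ⟨K, hK⟩ := h δ hδ
    refine ⟨K, fun k hk l hl => ?_⟩
    rw [Lp.edist_toLp_toLp]
    exact (hK k l hk hl).trans hδ2
  obtain ⟨g, hg⟩ := cauchySeq_tendsto_of_complete hc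
  refine ⟨g, Lp.memLp g, ?_⟩
  rw [Lp.tendsto_Lp_iff_tendsto_eLpNorm'] at hg
  refine hg.congr fun k => eLpNorm_congr_ae ?_
  filter_upwards [(hf k).coeFn_toLp] with x hx
  simp [hx]

end LimitLemmas

/-! ### Uniqueness of limit gradients and evaluation of the closed forms -/

section ClosedForms

variable {d : ℕ} {S : Type*} [MeasurableSpace S]

/-- `W` is a limit of weak gradients along a sequence converging to `u`. -/
def IsWeakLimGrad (m : Measure (S × (Fin d → ℝ))) (u : S × (Fin d → ℝ) → ℝ)
    (W : Fin d → S × (Fin d → ℝ) → ℝ) : Prop :=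
  ∃ (w : ℕ → S × (Fin d → ℝ) → ℝ) (V : ℕ → Fin d → S × (Fin d → ℝ) → ℝ),
    (∀ k, IsGrad (w k) (V k)) ∧ Tendsto (fun k => eLpNorm (w k - u) 2 m) atTop (𝓝 0) ∧
    ∀ i, Tendsto (fun k => eLpNorm (V k i - W i) 2 m) atTop (𝓝 0)

variable (μ : Measure (S × (Fin d → ℝ))) [IsProbabilityMeasure μ] {κ : S × (Fin d → ℝ) → ℝ}

theorem Hamza.ae_eq_one {μ : Measure (S × (Fin d → ℝ))} [IsProbabilityMeasure μ] (h : Hamza μ) :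
    ∀ᵐ s ∂μ.fst, ∀ᵐ x ∂μ.condKernel s, x ∈ hamzaSet (μ.condKernel s) := by
  -- The measure of the Hamza set is not known to be measurable in `s`, so it is replaced by a
  -- measurable minorant with the same integral.
  obtain ⟨g, hg, hgle, hgeq⟩ := exists_measurable_le_lintegral_eq (μ := μ.fst)
    fun s => μ.condKernel s (hamzaSet (μ.condKernel s))
  have h1 : ∫⁻ s, g s ∂μ.fst = 1 := hgeq.symm.trans h.2
  have hle1 : ∀ s, g s ≤ 1 := fun s => (hgle s).trans prob_le_one
  have h2 : ∫⁻ s, (1 - g s) ∂μ.fst = 0 := by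
    rw [lintegral_sub hg (by rw [h1]; simp) (ae_of_all _ hle1), h1]
    simp
  rw [lintegral_eq_zero_iff (by fun_prop)] at h2
  filter_upwards [h2] with s hs
  have hs1 : 1 ≤ g s := tsub_eq_zero_iff_le.1 hs
  have hs2 : μ.condKernel s (hamzaSet (μ.condKernel s)) = 1 :=
    le_antisymm prob_le_one (hs1.trans (hgle s))
  exact (mem_ae_iff_prob_eq_one (isOpen_hamzaSet _).measurableSet).2 hs2

/-- Closability of the superposition reduces to closability on sections: a subsequence converges in
the weighted norms on almost every section, where Hamza's argument applies. -/
theorem ae_eq_zero_of_isWeakLimGrad_zero (hH : Hamza μ) (hκ : IsCut κ)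
    (hκc : ∀ s, Continuous fun x => κ (s, x)) {W : Fin d → S × (Fin d → ℝ) → ℝ}
    (h : IsWeakLimGrad (cutMeasure μ κ) 0 W) {i : Fin d} (hW : Measurable (W i)) :
    W i =ᵐ[cutMeasure μ κ] 0 := by
  obtain ⟨w, V, hg, hw, hV⟩ := h
  -- Adding both errors lets a single subsequence serve the functions and the derivatives.
  let G : ℕ → S × (Fin d → ℝ) → ℝ≥0∞ := fun k p =>
    ENNReal.ofReal (w k p ^ 2) + ENNReal.ofReal ((V k i p - W i p) ^ 2)
  have hGm : ∀ k, Measurable (G k) := fun k =>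
    ((hg k).bddMeas.1.pow_const 2).ennreal_ofReal.add
      ((((hg k).measurable i).sub hW).pow_const 2).ennreal_ofReal
  let F : ℕ → S → ℝ≥0∞ := fun k s =>
    ∫⁻ x, G k (s, x) * ENNReal.ofReal (κ (s, x)) ∂μ.condKernel s
  have hFm : ∀ k, Measurable (F k) := fun k =>
    Measurable.lintegral_kernel_prod_right' (f := fun p : S × (Fin d → ℝ) =>
      G k p * ENNReal.ofReal (κ p)) ((hGm k).mul hκ.1.ennreal_ofReal)
  have hF0 : Tendsto (fun k => ∫⁻ s, F k s ∂μ.fst) atTop (𝓝 0) := by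
    have e : ∀ k, ∫⁻ s, F k s ∂μ.fst
        = eLpNorm (w k - 0) 2 (cutMeasure μ κ) ^ 2 + eLpNorm (V k i - W i) 2 (cutMeasure μ κ) ^ 2 := by
      intro k
      rw [← lintegral_cutMeasure μ hκ (hGm k), eLpNorm_two_sq_eq, eLpNorm_two_sq_eq,
        ← lintegral_add_left]
      · simp [G]
      · simpa using ((hg k).bddMeas.1.pow_const 2).ennreal_ofReal
    simp only [e]
    simpa using (ENNReal.Tendsto.pow (n := 2) hw).add (ENNReal.Tendsto.pow (n := 2) (hV i))
  obtain ⟨σ, -, hσ⟩ := exists_subseq_ae_tendsto_zero hFm hF0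
  have hmain : ∀ᵐ s ∂μ.fst, ∫⁻ x, ENNReal.ofReal (W i (s, x) ^ 2) * ENNReal.ofReal (κ (s, x))
      ∂μ.condKernel s = 0 := by
    filter_upwards [hσ, hH.1, hH.ae_eq_one] with s hs hac hone
    have hsec : ∀ {g : (Fin d → ℝ) → ℝ≥0∞}, Measurable g →
        ∫⁻ x, g x * ENNReal.ofReal (κ (s, x)) ∂μ.condKernel s
          = ∫⁻ x, g x * (ENNReal.ofReal (κ (s, x)) * (μ.condKernel s).rnDeriv volume x) := by
      intro g hg
      rw [← lintegral_rnDeriv_mul hac (f := fun x => g x * ENNReal.ofReal (κ (s, x)))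
        (hg.mul (hκc s).measurable.ennreal_ofReal).aemeasurable]
      exact lintegral_congr fun x => by ring
    have hsm : ∀ {g : S × (Fin d → ℝ) → ℝ}, Measurable g → Measurable fun x => g (s, x) :=
      fun hg => hg.comp measurable_prodMk_left
    have hle : ∀ {g : ℕ → S × (Fin d → ℝ) → ℝ}, (∀ k, Measurable (g k)) →
        (∀ k p, ENNReal.ofReal (g k p ^ 2) ≤ G (σ k) p) →
        Tendsto (fun k => ∫⁻ x, ENNReal.ofReal (g k (s, x) ^ 2) *
          (ENNReal.ofReal (κ (s, x)) * (μ.condKernel s).rnDeriv volume x)) atTop (𝓝 0) := by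
      intro g hg hgG
      refine tendsto_of_tendsto_of_tendsto_of_le_of_le tendsto_const_nhds hs (fun _ => zero_le)
        fun k => ?_
      rw [← hsec ((hsm (hg k)).pow_const 2).ennreal_ofReal]
      exact lintegral_mono fun x => mul_le_mul_left (hgG k (s, x)) _
    have hz := ae_eq_zero_of_tendsto_weighted (m := μ.condKernel s) (hκc s) (i := i)
      (fun k => bddMeas_section (hg (σ k)).bddMeas s) (fun k => (hg (σ k)).bddMeas_grad i s)
      (fun k => (hg (σ k)).weak i s) (hsm hW)
      (hle (fun k => (hg (σ k)).bddMeas.1) fun k p => le_self_add)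
      (hle (g := fun k p => V (σ k) i p - W i p) (fun k => ((hg (σ k)).measurable i).sub hW)
        fun k p => le_add_self)
    rw [lintegral_eq_zero_iff (f := fun x => ENNReal.ofReal (W i (s, x) ^ 2) *
      ENNReal.ofReal (κ (s, x))) (((hsm hW).pow_const 2).ennreal_ofReal.mul
        (hκc s).measurable.ennreal_ofReal)]
    filter_upwards [hac.ae_le hz, hone] with x hx1 hx2
    by_cases hpos : 0 < κ (s, x)
    · simp [hx1 ⟨hx2, hpos⟩]
    · simp [le_antisymm (not_lt.1 hpos) (hκ.2 (s, x)).1]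
  have hzero : ∫⁻ p, ENNReal.ofReal (W i p ^ 2) ∂cutMeasure μ κ = 0 := by
    rw [lintegral_cutMeasure μ hκ (hW.pow_const 2).ennreal_ofReal, lintegral_congr_ae hmain]
    simp
  rw [lintegral_eq_zero_iff (hW.pow_const 2).ennreal_ofReal] at hzero
  filter_upwards [hzero] with p hp
  simp only [Pi.zero_apply, ENNReal.ofReal_eq_zero] at hp
  simpa using le_antisymm hp (sq_nonneg _)

theorem IsWeakLimGrad.sub {m : Measure (S × (Fin d → ℝ))} {u u' : S × (Fin d → ℝ) → ℝ}
    {W W' : Fin d → S × (Fin d → ℝ) → ℝ} (hu : AEStronglyMeasurable u m)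
    (hu' : AEStronglyMeasurable u' m) (hW : ∀ i, AEStronglyMeasurable (W i) m)
    (hW' : ∀ i, AEStronglyMeasurable (W' i) m) (h : IsWeakLimGrad m u W)
    (h' : IsWeakLimGrad m u' W') : IsWeakLimGrad m (u - u') fun i => W i - W' i := by
  obtain ⟨w, V, hg, hw, hV⟩ := h
  obtain ⟨w', V', hg', hw', hV'⟩ := h'
  refine ⟨fun k => w k - w' k, fun k i => V k i - V' k i, fun k => (hg k).sub (hg' k), ?_,
    fun i => ?_⟩
  · exact tendsto_eLpNorm_sub_sub (fun k => (hg k).bddMeas.1.aestronglyMeasurable)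
      (fun k => (hg' k).bddMeas.1.aestronglyMeasurable) hu hu' hw hw'
  · exact tendsto_eLpNorm_sub_sub (fun k => ((hg k).measurable i).aestronglyMeasurable)
      (fun k => ((hg' k).measurable i).aestronglyMeasurable) (hW i) (hW' i) (hV i) (hV' i)

theorem IsWeakLimGrad.congr {m : Measure (S × (Fin d → ℝ))} {u u' : S × (Fin d → ℝ) → ℝ}
    {W W' : Fin d → S × (Fin d → ℝ) → ℝ} (hu : u =ᵐ[m] u') (hW : ∀ i, W i =ᵐ[m] W' i)
    (h : IsWeakLimGrad m u W) : IsWeakLimGrad m u' W' := by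
  obtain ⟨w, V, hg, hw, hV⟩ := h
  refine ⟨w, V, hg, hw.congr fun k => eLpNorm_congr_ae ((ae_eq_refl (w k)).sub hu), fun i =>
    (hV i).congr fun k => eLpNorm_congr_ae ((ae_eq_refl (V k i)).sub (hW i))⟩

/-- The difference of two limit gradients of `u` is a limit gradient of zero. -/
theorem IsWeakLimGrad.ae_unique (hH : Hamza μ) (hκ : IsCut κ)
    (hκc : ∀ s, Continuous fun x => κ (s, x)) {u : S × (Fin d → ℝ) → ℝ}
    {W W' : Fin d → S × (Fin d → ℝ) → ℝ} (hu : AEStronglyMeasurable u (cutMeasure μ κ))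
    (hW : ∀ i, AEStronglyMeasurable (W i) (cutMeasure μ κ))
    (hW' : ∀ i, AEStronglyMeasurable (W' i) (cutMeasure μ κ))
    (h : IsWeakLimGrad (cutMeasure μ κ) u W) (h' : IsWeakLimGrad (cutMeasure μ κ) u W')
    (i : Fin d) : W i =ᵐ[cutMeasure μ κ] W' i := by
  have h1 := h.sub hu hu hW hW' h'
  have h2 : IsWeakLimGrad (cutMeasure μ κ) 0 fun i => ((hW i).sub (hW' i)).mk _ :=
    h1.congr (by simp) fun i => ((hW i).sub (hW' i)).ae_eq_mk
  have h3 := ae_eq_zero_of_isWeakLimGrad_zero μ hH hκ hκc h2 (i := i)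
    ((hW i).sub (hW' i)).stronglyMeasurable_mk.measurable
  have h4 := ((hW i).sub (hW' i)).ae_eq_mk.trans h3
  filter_upwards [h4] with p hp
  simpa [sub_eq_zero] using hp

/-- The energy of a difference bounds the `L²` distance of the gradients, so an energy-Cauchy
sequence has convergent gradients by completeness. -/
theorem IsClosureValue.exists_isWeakLimGrad (hac : ∀ᵐ s ∂μ.fst, μ.condKernel s ≪ volume)
    (hκ : IsCut κ) {u : S × (Fin d → ℝ) → ℝ} {e : ℝ≥0∞}
    (h : IsClosureValue (cutMeasure μ κ) μ.fst (cutDensity μ κ) u e) :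
    ∃ W : Fin d → S × (Fin d → ℝ) → ℝ, (∀ i, MemLp (W i) 2 (cutMeasure μ κ)) ∧
      IsWeakLimGrad (cutMeasure μ κ) u W ∧ e = gradSq (cutMeasure μ κ) W := by
  obtain ⟨w, hw, hwu, hcau, hlim⟩ := h
  choose V hV hfin using fun k => exists_isGrad_of_mem_directDomain μ hκ hac (hw k)
  have hmem : ∀ k i, MemLp (V k i) 2 (cutMeasure μ κ) := fun k =>
    memLp_of_gradSq_lt_top (hV k).measurable (hfin k)
  have hc : ∀ i, ∀ ε : ℝ, 0 < ε → ∃ K : ℕ, ∀ k l, K ≤ k → K ≤ l →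
      eLpNorm (V k i - V l i) 2 (cutMeasure μ κ) < ENNReal.ofReal ε := by
    intro i ε hε
    obtain ⟨K, hK⟩ := hcau (ε ^ 2) (by positivity)
    refine ⟨K, fun k l hk hl => ?_⟩
    have h1 := ((hV k).sub (hV l)).ofReal_directEnergy μ hκ hac
      (gradSq_lt_top fun i => (hmem k i).sub (hmem l i))
    have h2 : eLpNorm (V k i - V l i) 2 (cutMeasure μ κ) ^ 2 < ENNReal.ofReal ε ^ 2 := by
      refine (eLpNorm_sq_le_gradSq (V := fun i => V k i - V l i) i).trans_lt ?_
      rw [← h1, ← ENNReal.ofReal_pow hε.le]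
      exact (ENNReal.ofReal_lt_ofReal_iff (by positivity)).2 (hK k l hk hl)
    exact lt_of_not_ge fun hge => h2.not_ge (pow_le_pow_left' hge 2)
  choose W hWm hWt using fun i => exists_tendsto_of_cauchy_eLpNorm (fun k => hmem k i) (hc i)
  refine ⟨W, hWm, ⟨w, V, hV, hwu, hWt⟩, ?_⟩
  refine tendsto_nhds_unique hlim ?_
  simp only [fun k => (hV k).ofReal_directEnergy μ hκ hac (hfin k)]
  exact tendsto_gradSq_of_tendsto_sub (fun k i => (hmem k i).1) hWm hWt

/-- Uniqueness of the limit gradient makes all closure values equal, hence the infimum defining the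
closed form is this common value. -/
theorem exists_isWeakLimGrad_of_closedForm_lt_top (hH : Hamza μ) (hκ : IsCut κ)
    (hκc : ∀ s, Continuous fun x => κ (s, x)) {u : S × (Fin d → ℝ) → ℝ}
    (hu : AEStronglyMeasurable u (cutMeasure μ κ)) (h : cutForm μ κ u < ⊤) :
    ∃ W : Fin d → S × (Fin d → ℝ) → ℝ, (∀ i, MemLp (W i) 2 (cutMeasure μ κ)) ∧
      IsWeakLimGrad (cutMeasure μ κ) u W ∧ cutForm μ κ u = gradSq (cutMeasure μ κ) W := by
  unfold cutForm closedForm at h ⊢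
  obtain ⟨e, he, -⟩ := sInf_lt_iff.1 h
  obtain ⟨W, hW, hlim, heq⟩ := IsClosureValue.exists_isWeakLimGrad μ hH.1 hκ he
  refine ⟨W, hW, hlim, le_antisymm ((sInf_le he).trans_eq heq) (le_sInf fun e' he' => ?_)⟩
  obtain ⟨W', hW', hlim', heq'⟩ := IsClosureValue.exists_isWeakLimGrad μ hH.1 hκ he'
  rw [heq', gradSq_congr fun i => IsWeakLimGrad.ae_unique μ hH hκ hκc hu (fun i => (hW i).1)
    (fun i => (hW' i).1) hlim hlim' i]

theorem closedForm_congr {m : Measure (S × (Fin d → ℝ))} {ν : Measure S}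
    {ϱ : S → (Fin d → ℝ) → ℝ} {u u' : S × (Fin d → ℝ) → ℝ} (h : u =ᵐ[m] u') :
    closedForm m ν ϱ u = closedForm m ν ϱ u' := by
  have key : ∀ {u u' : S × (Fin d → ℝ) → ℝ}, u =ᵐ[m] u' → ∀ e, IsClosureValue m ν ϱ u e →
      IsClosureValue m ν ϱ u' e := by
    rintro u u' h e ⟨w, h1, h2, h3⟩
    exact ⟨w, h1, h2.congr fun k => eLpNorm_congr_ae ((ae_eq_refl (w k)).sub h), h3⟩
  unfold closedForm
  congr 1
  ext e
  exact ⟨key h e, key h.symm e⟩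

variable [TopologicalSpace S]

/-- `V` is a limit of gradients of functions of the core converging to `u`. -/
def IsLimGrad (m : Measure (S × (Fin d → ℝ))) (u : S × (Fin d → ℝ) → ℝ)
    (V : Fin d → S × (Fin d → ℝ) → ℝ) : Prop :=
  ∃ w : ℕ → S × (Fin d → ℝ) → ℝ, (∀ k, w k ∈ core S d) ∧
    Tendsto (fun k => eLpNorm (w k - u) 2 m) atTop (𝓝 0) ∧
    ∀ i, Tendsto (fun k => eLpNorm (pgrad i (w k) - V i) 2 m) atTop (𝓝 0)

theorem IsLimGrad.core_sub {m : Measure (S × (Fin d → ℝ))} {u w : S × (Fin d → ℝ) → ℝ}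
    {V : Fin d → S × (Fin d → ℝ) → ℝ} (hw : w ∈ core S d) (h : IsLimGrad m u V) :
    IsLimGrad m (w - u) fun i => pgrad i w - V i := by
  obtain ⟨w', hw', h1, h2⟩ := h
  have hs := fun k => isSmoothBdd_of_mem_core (hw' k)
  refine ⟨fun k => w - w' k, fun k => Submodule.sub_mem _ hw (hw' k), ?_, fun i => ?_⟩
  · refine h1.congr fun k => ?_
    rw [← eLpNorm_neg]
    congr 1; funext p; simp
  · refine (h2 i).congr fun k => ?_
    rw [pgrad_sub (isSmoothBdd_of_mem_core hw) (hs k), ← eLpNorm_neg]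
    congr 1; funext p; simp

variable [OpensMeasurableSpace (S × (Fin d → ℝ))]

theorem IsLimGrad.isWeakLimGrad {m : Measure (S × (Fin d → ℝ))} {u : S × (Fin d → ℝ) → ℝ}
    {V : Fin d → S × (Fin d → ℝ) → ℝ} (h : IsLimGrad m u V) : IsWeakLimGrad m u V := by
  obtain ⟨w, hw, h1, h2⟩ := h
  exact ⟨w, fun k i => pgrad i (w k), fun k => (isSmoothBdd_of_mem_core (hw k)).isGrad, h1, h2⟩

theorem IsSmoothBdd.memLp_pgrad {w : S × (Fin d → ℝ) → ℝ} (h : IsSmoothBdd w)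
    (m : Measure (S × (Fin d → ℝ))) [IsFiniteMeasure m] (i : Fin d) : MemLp (pgrad i w) 2 m :=
  BddMeas.memLp ⟨(h.continuous_grad i).measurable, h.bdd_grad i⟩ _ _

/-- Core functions belong to the pre-domain, so a sequence with convergent gradients is admissible
in the definition of the closure. -/
theorem IsLimGrad.cutForm_le (hac : ∀ᵐ s ∂μ.fst, μ.condKernel s ≪ volume) (hκ : IsCut κ)
    {u : S × (Fin d → ℝ) → ℝ} {V : Fin d → S × (Fin d → ℝ) → ℝ}
    (hV : ∀ i, MemLp (V i) 2 (cutMeasure μ κ)) (h : IsLimGrad (cutMeasure μ κ) u V) :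
    cutForm μ κ u ≤ gradSq (cutMeasure μ κ) V := by
  have := isFiniteMeasure_cutMeasure μ hκ
  obtain ⟨w, hw, h1, h2⟩ := h
  have hs := fun k => isSmoothBdd_of_mem_core (hw k)
  have hm := fun k i => (hs k).memLp_pgrad (cutMeasure μ κ) i
  have hE : ∀ k, ENNReal.ofReal (directEnergy μ.fst (cutDensity μ κ) (w k) (w k))
      = gradSq (cutMeasure μ κ) fun i => pgrad i (w k) := fun k =>
    (hs k).isGrad.ofReal_directEnergy μ hκ hac (gradSq_lt_top (hm k))
  refine sInf_le ⟨w, fun k => (hs k).mem_directDomain μ hκ hac, h1, fun ε hε => ?_, ?_⟩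
  · have hlim : Tendsto (fun k => gradSq (cutMeasure μ κ) fun i => pgrad i (w k) - V i) atTop
        (𝓝 0) := by
      simp only [fun k => gradSq_eq_sum fun i => ((hm k i).sub (hV i)).1]
      simpa using tendsto_finsetSum Finset.univ fun i _ => ENNReal.Tendsto.pow (n := 2) (h2 i)
    -- The bound `(a + b)² ≤ 2a² + 2b²` is applied below to each component, which leads to `ε / 4`.
    obtain ⟨K, hK⟩ := eventually_atTop.1 (hlim.eventually_lt_const
      (ENNReal.ofReal_pos.2 (show 0 < ε / 4 by positivity)))
    refine ⟨K, fun k l hk hl => ?_⟩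
    have e1 := ((hs k).isGrad.sub (hs l).isGrad).ofReal_directEnergy μ hκ hac
      (gradSq_lt_top fun i => (hm k i).sub (hm l i))
    rw [← ENNReal.ofReal_lt_ofReal_iff hε, e1]
    have e2 : (gradSq (cutMeasure μ κ) fun i => pgrad i (w k) - pgrad i (w l))
        ≤ 2 * (gradSq (cutMeasure μ κ) fun i => pgrad i (w k) - V i)
          + 2 * gradSq (cutMeasure μ κ) fun i => pgrad i (w l) - V i := by
      rw [gradSq_eq_sum fun i => ((hm k i).sub (hm l i)).1,
        gradSq_eq_sum fun i => ((hm k i).sub (hV i)).1,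
        gradSq_eq_sum fun i => ((hm l i).sub (hV i)).1, Finset.mul_sum, Finset.mul_sum,
        ← Finset.sum_add_distrib]
      refine Finset.sum_le_sum fun i _ => ?_
      have e : pgrad i (w k) - pgrad i (w l) = (pgrad i (w k) - V i) - (pgrad i (w l) - V i) := by
        abel
      rw [e]
      refine (pow_le_pow_left₀ zero_le (eLpNorm_sub_le ((hm k i).sub (hV i)).1
        ((hm l i).sub (hV i)).1 (by norm_num)) 2).trans ?_
      have := ENNReal.rpow_add_le_mul_rpow_add_rpow
        (eLpNorm (pgrad i (w k) - V i) 2 (cutMeasure μ κ))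
        (eLpNorm (pgrad i (w l) - V i) 2 (cutMeasure μ κ)) (p := 2) (by norm_num)
      norm_num at this
      rwa [mul_add] at this
    refine e2.trans_lt ?_
    have e3 : ENNReal.ofReal ε = 2 * ENNReal.ofReal (ε / 4) + 2 * ENNReal.ofReal (ε / 4) := by
      rw [← two_mul, ← mul_assoc, show (2 * 2 : ℝ≥0∞) = ENNReal.ofReal 4 by norm_num,
        ← ENNReal.ofReal_mul (by norm_num)]
      congr 1; ring
    rw [e3]
    exact ENNReal.add_lt_add
      (ENNReal.mul_lt_mul_right (by simp) (by simp) (hK k hk))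
      (ENNReal.mul_lt_mul_right (by simp) (by simp) (hK l hl))
  · simp only [hE]
    exact tendsto_gradSq_of_tendsto_sub (fun k i => (hm k i).1) hV h2

theorem IsLimGrad.memCutMin (hac : ∀ᵐ s ∂μ.fst, μ.condKernel s ≪ volume) (hκ : IsCut κ)
    {u : S × (Fin d → ℝ) → ℝ} {V : Fin d → S × (Fin d → ℝ) → ℝ}
    (hV : ∀ i, MemLp (V i) 2 (cutMeasure μ κ)) (h : IsLimGrad (cutMeasure μ κ) u V) :
    MemCutMin μ κ u := by
  have := isFiniteMeasure_cutMeasure μ hκ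
  refine ⟨(h.cutForm_le μ hac hκ hV).trans_lt (gradSq_lt_top hV), ?_⟩
  obtain ⟨w, hw, h1, h2⟩ := id h
  refine ⟨w, hw, h1, ?_⟩
  have hm := fun k i => (isSmoothBdd_of_mem_core (hw k)).memLp_pgrad (cutMeasure μ κ) i
  have hlim : Tendsto (fun k => gradSq (cutMeasure μ κ) fun i => pgrad i (w k) - V i) atTop
      (𝓝 0) := by
    simp only [fun k => gradSq_eq_sum fun i => ((hm k i).sub (hV i)).1]
    simpa using tendsto_finsetSum Finset.univ fun i _ => ENNReal.Tendsto.pow (n := 2) (h2 i)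
  exact tendsto_of_tendsto_of_tendsto_of_le_of_le tendsto_const_nhds hlim (fun _ => zero_le)
    fun k => (h.core_sub (hw k)).cutForm_le μ hac hκ fun i => (hm k i).sub (hV i)

theorem IsSmoothBdd.isWeakLimGrad {w : S × (Fin d → ℝ) → ℝ} (h : IsSmoothBdd w)
    (m : Measure (S × (Fin d → ℝ))) : IsWeakLimGrad m w fun i => pgrad i w :=
  ⟨fun _ => w, fun _ i => pgrad i w, fun _ => h.isGrad, by simp, fun i => by simp⟩

/-- Converse of `IsLimGrad.memCutMin`. Convergence in the form norm is turned into convergence of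
gradients, since the form at `w k - u` is the squared norm of the difference of the gradients. -/
theorem MemCutMin.exists_isLimGrad (hH : Hamza μ) (hκ : IsCut κ)
    (hκc : ∀ s, Continuous fun x => κ (s, x)) {u : S × (Fin d → ℝ) → ℝ}
    (hu : AEStronglyMeasurable u (cutMeasure μ κ)) (h : MemCutMin μ κ u) :
    ∃ V : Fin d → S × (Fin d → ℝ) → ℝ, (∀ i, MemLp (V i) 2 (cutMeasure μ κ)) ∧
      IsLimGrad (cutMeasure μ κ) u V ∧ cutForm μ κ u = gradSq (cutMeasure μ κ) V := by
  have := isFiniteMeasure_cutMeasure μ hκ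
  obtain ⟨hfin, w, hw, h1, h2⟩ := h
  obtain ⟨W, hW, hlim, heq⟩ := exists_isWeakLimGrad_of_closedForm_lt_top μ hH hκ hκc hu hfin
  have hs := fun k => isSmoothBdd_of_mem_core (hw k)
  have hm := fun k i => (hs k).memLp_pgrad (cutMeasure μ κ) i
  have hwm : ∀ k, AEStronglyMeasurable (w k) (cutMeasure μ κ) := fun k =>
    (hs k).continuous.measurable.aestronglyMeasurable
  have hval : ∀ᶠ k in atTop, gradSq (cutMeasure μ κ) (fun i => pgrad i (w k) - W i)
      = cutForm μ κ (w k - u) := by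
    -- The value of the form at `w k - u` is attached to a limit gradient as soon as it is finite,
    -- which holds for large `k`.
    filter_upwards [h2.eventually_lt_const (by simp : (0 : ℝ≥0∞) < ⊤)] with k hk
    obtain ⟨W', hW', hlim', heq'⟩ :=
      exists_isWeakLimGrad_of_closedForm_lt_top μ hH hκ hκc ((hwm k).sub hu) hk
    rw [heq']
    refine gradSq_congr fun i => IsWeakLimGrad.ae_unique μ hH hκ hκc ((hwm k).sub hu)
      (fun i => ((hm k i).sub (hW i)).1) (fun i => (hW' i).1) ?_ hlim' i
    exact ((hs k).isWeakLimGrad _).sub (hwm k) hu (fun i => (hm k i).1) (fun i => (hW i).1) hlim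
  have hlim0 : Tendsto (fun k => gradSq (cutMeasure μ κ) fun i => pgrad i (w k) - W i) atTop
      (𝓝 0) := (tendsto_congr' hval).2 h2
  refine ⟨W, hW, ⟨w, hw, h1, fun i => ?_⟩, heq⟩
  have hsq : Tendsto (fun k => eLpNorm (pgrad i (w k) - W i) 2 (cutMeasure μ κ) ^ 2) atTop
      (𝓝 0) := tendsto_of_tendsto_of_tendsto_of_le_of_le tendsto_const_nhds hlim0
    (fun _ => zero_le) fun k => eLpNorm_sq_le_gradSq (V := fun i => pgrad i (w k) - W i) i
  have h3 := ((ENNReal.continuous_rpow_const (y := (1 / 2 : ℝ))).tendsto (0 : ℝ≥0∞)).comp hsq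
  rw [ENNReal.zero_rpow_of_pos (by norm_num)] at h3
  refine h3.congr fun k => ?_
  simp only [Function.comp]
  rw [← ENNReal.rpow_natCast, ← ENNReal.rpow_mul]
  norm_num

theorem cutForm_of_mem_core (hH : Hamza μ) (hκ : IsCut κ)
    (hκc : ∀ s, Continuous fun x => κ (s, x)) {w : S × (Fin d → ℝ) → ℝ} (hw : w ∈ core S d) :
    cutForm μ κ w = gradSq (cutMeasure μ κ) fun i => pgrad i w := by
  have := isFiniteMeasure_cutMeasure μ hκ
  have hs := isSmoothBdd_of_mem_core hw
  have hm := fun i => hs.memLp_pgrad (cutMeasure μ κ) i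
  have hlim : IsLimGrad (cutMeasure μ κ) w fun i => pgrad i w :=
    ⟨fun _ => w, fun _ => hw, by simp, fun i => by simp⟩
  have hwm : AEStronglyMeasurable w (cutMeasure μ κ) :=
    hs.continuous.measurable.aestronglyMeasurable
  obtain ⟨W, hW, hlim', heq⟩ := exists_isWeakLimGrad_of_closedForm_lt_top μ hH hκ hκc hwm
    ((hlim.cutForm_le μ hH.1 hκ hm).trans_lt (gradSq_lt_top hm))
  rw [heq]
  exact gradSq_congr fun i => IsWeakLimGrad.ae_unique μ hH hκ hκc hwm (fun i => (hW i).1)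
    (fun i => (hm i).1) hlim' hlim.isWeakLimGrad i

end ClosedForms

/-! ### Test functions and weak closedness of the set of limits of gradients -/

theorem memLp_fst {d : ℕ} {S : Type*} [MeasurableSpace S]
    {μ : Measure (S × (Fin d → ℝ))} {b : S → ℝ} (hb : MemLp b 2 μ.fst) :
    MemLp (fun p : S × (Fin d → ℝ) => b p.1) 2 μ :=
  hb.comp_measurePreserving (measurable_fst.measurePreserving μ)

theorem eLpNorm_fst {d : ℕ} {S : Type*} [MeasurableSpace S] {μ : Measure (S × (Fin d → ℝ))}
    {b : S → ℝ}
    (hb : AEStronglyMeasurable b μ.fst) :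
    eLpNorm (fun p : S × (Fin d → ℝ) => b p.1) 2 μ = eLpNorm b 2 μ.fst :=
  eLpNorm_comp_measurePreserving hb (measurable_fst.measurePreserving μ)

section TestFunctions

variable {d : ℕ} {S : Type*} [TopologicalSpace S]

/-- Compactly supported continuous cut-off functions increasing to one. -/
def plateau (n : ℕ) (x : Fin d → ℝ) : ℝ := max 0 (min 1 ((n : ℝ) + 1 - ‖x‖))

theorem continuous_plateau (n : ℕ) : Continuous (plateau n : (Fin d → ℝ) → ℝ) := by
  unfold plateau; fun_prop

theorem plateau_mem_Icc (n : ℕ) (x : Fin d → ℝ) : plateau n x ∈ Icc (0 : ℝ) 1 :=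
  ⟨le_max_left _ _, max_le zero_le_one (min_le_left _ _)⟩

theorem hasCompactSupport_plateau (n : ℕ) :
    HasCompactSupport (plateau n : (Fin d → ℝ) → ℝ) := by
  refine HasCompactSupport.intro (isCompact_closedBall 0 ((n : ℝ) + 1)) fun x hx => ?_
  rw [mem_closedBall_zero_iff, not_le] at hx
  unfold plateau
  rw [max_eq_left]
  exact (min_le_right _ _).trans (by linarith)

theorem tendsto_plateau (x : Fin d → ℝ) : Tendsto (fun n => plateau n x) atTop (𝓝 1) := by
  obtain ⟨n₀, hn₀⟩ := exists_nat_ge ‖x‖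
  refine tendsto_const_nhds.congr' ?_
  filter_upwards [eventually_ge_atTop n₀] with n hn
  have : (n₀ : ℝ) ≤ n := Nat.cast_le.2 hn
  unfold plateau
  rw [min_eq_left (by linarith), max_eq_right zero_le_one]

variable [MeasurableSpace S] [BorelSpace S]

theorem bddMeas_tensor (f : S →ᵇ ℝ) {g : (Fin d → ℝ) → ℝ} (hg : Continuous g)
    (hc : HasCompactSupport g) : BddMeas fun p : S × (Fin d → ℝ) => f p.1 * g p.2 := by
  obtain ⟨M, hM⟩ := hc.exists_bound_of_continuous hg
  refine ⟨(f.continuous.measurable.comp measurable_fst).mul (hg.measurable.comp measurable_snd),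
    ‖f‖ * M, fun p => ?_⟩
  rw [abs_mul]
  exact mul_le_mul (f.norm_coe_le_norm _) (hM _) (abs_nonneg _) (norm_nonneg _)

theorem memLp_pgrad_core {m : Measure (S × (Fin d → ℝ))} [IsFiniteMeasure m]
    {w : S × (Fin d → ℝ) → ℝ} (hw : w ∈ core S d) (o : Option (Fin d)) :
    MemLp (o.elim w fun i => pgrad i w) 2 m := by
  have hs := isSmoothBdd_of_mem_core hw
  cases o with
  | none => exact BddMeas.memLp ⟨hs.continuous.measurable, hs.bdd⟩ _ _
  | some i => exact hs.memLp_pgrad m i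

/-- The graph of the gradient on the core, in the Hilbert space of `(d+1)`-tuples. -/
def coreGraph (m : Measure (S × (Fin d → ℝ))) [IsFiniteMeasure m] :
    Submodule ℝ (PiLp 2 fun _ : Option (Fin d) => Lp ℝ 2 m) where
  carrier := {y | ∃ w ∈ core S d, ∀ o : Option (Fin d), y o =ᵐ[m] o.elim w fun i => pgrad i w}
  zero_mem' := by
    refine ⟨0, Submodule.zero_mem _, fun o => ?_⟩
    have h0 : (o.elim (0 : S × (Fin d → ℝ) → ℝ) fun i => pgrad i 0) = 0 := by
      cases o with
      | none => rfl
      | some i => funext p; simp [pgrad]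
    rw [h0]
    exact Lp.coeFn_zero ℝ 2 m
  add_mem' := by
    rintro y y' ⟨w, hw, h⟩ ⟨w', hw', h'⟩
    refine ⟨w + w', Submodule.add_mem _ hw hw', fun o => ?_⟩
    have h1 : (o.elim (w + w') fun i => pgrad i (w + w'))
        = (o.elim w fun i => pgrad i w) + (o.elim w' fun i => pgrad i w') := by
      cases o with
      | none => rfl
      | some i => exact pgrad_add (isSmoothBdd_of_mem_core hw) (isSmoothBdd_of_mem_core hw') i
    rw [h1]
    exact (Lp.coeFn_add (y o) (y' o)).trans ((h o).add (h' o))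
  smul_mem' := by
    rintro c y ⟨w, hw, h⟩
    refine ⟨c • w, Submodule.smul_mem _ c hw, fun o => ?_⟩
    have h1 : (o.elim (c • w) fun i => pgrad i (c • w)) = c • (o.elim w fun i => pgrad i w) := by
      cases o with
      | none => rfl
      | some i => exact pgrad_smul (isSmoothBdd_of_mem_core hw) c i
    rw [h1]
    exact (Lp.coeFn_smul c (y o)).trans ((h o).const_smul c)

/-- Recasts convergence of functions together with gradients as membership in a closed subspace of a
Hilbert space, so that weak limits become available. The index `none` carries the function, `some i`
the partial derivatives. -/
theorem isLimGrad_iff_mem_closure {m : Measure (S × (Fin d → ℝ))} [IsFiniteMeasure m]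
    {u : S × (Fin d → ℝ) → ℝ} {V : Fin d → S × (Fin d → ℝ) → ℝ} (hu : MemLp u 2 m)
    (hV : ∀ i, MemLp (V i) 2 m) :
    IsLimGrad m u V ↔ (WithLp.toLp 2 fun o : Option (Fin d) => o.elim (hu.toLp u) fun i =>
      (hV i).toLp (V i)) ∈ (coreGraph m).topologicalClosure := by
  set y₀ : PiLp 2 fun _ : Option (Fin d) => Lp ℝ 2 m :=
    WithLp.toLp 2 fun o : Option (Fin d) => o.elim (hu.toLp u) fun i => (hV i).toLp (V i)
  have hconv : ∀ y : ℕ → PiLp 2 fun _ : Option (Fin d) => Lp ℝ 2 m,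
      Tendsto y atTop (𝓝 y₀) ↔ ∀ o, Tendsto (fun k => y k o) atTop (𝓝 (y₀ o)) := by
    intro y
    have hi : Topology.IsInducing (WithLp.ofLp : (PiLp 2 fun _ : Option (Fin d) => Lp ℝ 2 m) → _) :=
      (PiLp.homeomorph 2 _).isInducing
    rw [hi.tendsto_nhds_iff, tendsto_pi_nhds]
    rfl
  have hy₀ : ∀ o, y₀ o =ᵐ[m] o.elim u V := by
    intro o
    cases o with
    | none => exact hu.coeFn_toLp
    | some i => exact (hV i).coeFn_toLp
  rw [← SetLike.mem_coe, Submodule.topologicalClosure_coe, mem_closure_iff_seq_limit]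
  constructor
  · rintro ⟨w, hw, h1, h2⟩
    refine ⟨fun k => WithLp.toLp 2 fun o => (memLp_pgrad_core (m := m) (hw k) o).toLp _,
      fun k => ⟨w k, hw k, fun o => (memLp_pgrad_core (m := m) (hw k) o).coeFn_toLp⟩, ?_⟩
    rw [hconv]
    intro o
    rw [Lp.tendsto_Lp_iff_tendsto_eLpNorm']
    have : ∀ k, eLpNorm (⇑((memLp_pgrad_core (m := m) (hw k) o).toLp _) - ⇑(y₀ o)) 2 m
        = eLpNorm ((o.elim (w k) fun i => pgrad i (w k)) - o.elim u V) 2 m := fun k =>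
      eLpNorm_congr_ae ((memLp_pgrad_core (m := m) (hw k) o).coeFn_toLp.sub (hy₀ o))
    refine Tendsto.congr (fun k => (this k).symm) ?_
    cases o with
    | none => exact h1
    | some i => exact h2 i
  · rintro ⟨y, hy, hlim⟩
    choose w hw hyw using hy
    rw [hconv] at hlim
    have hall : ∀ o : Option (Fin d), Tendsto (fun k => eLpNorm ((o.elim (w k) fun i =>
        pgrad i (w k)) - o.elim u V) 2 m) atTop (𝓝 0) := by
      intro o
      have := hlim o
      rw [Lp.tendsto_Lp_iff_tendsto_eLpNorm'] at this
      exact this.congr fun k => eLpNorm_congr_ae ((hyw k o).sub (hy₀ o))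
    exact ⟨w, hw, hall none, fun i => hall (some i)⟩

variable [PolishSpace S]

/-- Continuous cut-offs and dominated convergence remove the compact support. The measures with
densities given by the positive and negative parts of `F` then agree on products of bounded
continuous functions, hence coincide. -/
theorem ae_eq_zero_of_integral_tensor_eq_zero {m : Measure (S × (Fin d → ℝ))} [IsFiniteMeasure m]
    {F : S × (Fin d → ℝ) → ℝ} (hF : Integrable F m)
    (h : ∀ (f : S →ᵇ ℝ) (g : (Fin d → ℝ) → ℝ), Continuous g → HasCompactSupport g →
      ∫ p, F p * (f p.1 * g p.2) ∂m = 0) : F =ᵐ[m] 0 := by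
  have hb : ∀ (f : S →ᵇ ℝ) (g : (Fin d → ℝ) →ᵇ ℝ), ∫ p, F p * (f p.1 * g p.2) ∂m = 0 := by
    intro f g
    have hlim : Tendsto (fun n => ∫ p, F p * (f p.1 * (plateau n p.2 * g p.2)) ∂m) atTop
        (𝓝 (∫ p, F p * (f p.1 * g p.2) ∂m)) := by
      refine tendsto_integral_of_dominated_convergence (fun p => ‖F p‖ * (‖f‖ * ‖g‖))
        (fun n => ?_) (hF.norm.mul_const _) (fun n => ae_of_all _ fun p => ?_)
        (ae_of_all _ fun p => ?_)
      · refine hF.1.mul (Measurable.aestronglyMeasurable ?_)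
        exact (f.continuous.measurable.comp measurable_fst).mul
          (((continuous_plateau n).measurable.comp measurable_snd).mul
            (g.continuous.measurable.comp measurable_snd))
      · rw [norm_mul, norm_mul, norm_mul]
        have h1 : ‖plateau n p.2‖ ≤ 1 := by
          rw [Real.norm_of_nonneg (plateau_mem_Icc n p.2).1]; exact (plateau_mem_Icc n p.2).2
        have h2 := f.norm_coe_le_norm p.1
        have h3 := g.norm_coe_le_norm p.2
        have h4 : ‖plateau n p.2‖ * ‖g p.2‖ ≤ ‖g‖ :=
          (mul_le_of_le_one_left (norm_nonneg _) h1).trans h3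
        exact mul_le_mul_of_nonneg_left (mul_le_mul h2 h4 (by positivity) (norm_nonneg _))
          (norm_nonneg _)
      · have := ((tendsto_plateau p.2).mul_const (g p.2)).const_mul (f p.1) |>.const_mul (F p)
        simpa using this
    have hz : ∀ n, ∫ p, F p * (f p.1 * (plateau n p.2 * g p.2)) ∂m = 0 := fun n =>
      h f (fun x => plateau n x * g x) ((continuous_plateau n).mul g.continuous)
        (hasCompactSupport_plateau n).mul_right
    simp only [hz] at hlim
    exact (tendsto_nhds_unique hlim tendsto_const_nhds)
  have hfin1 : ∫⁻ p, ENNReal.ofReal (F p) ∂m ≠ ⊤ :=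
    (hF.lintegral_lt_top).ne
  have hfin2 : ∫⁻ p, ENNReal.ofReal (-F p) ∂m ≠ ⊤ :=
    (hF.neg.lintegral_lt_top).ne
  have i1 : IsFiniteMeasure (m.withDensity fun p => ENNReal.ofReal (F p)) :=
    isFiniteMeasure_withDensity hfin1
  have i2 : IsFiniteMeasure (m.withDensity fun p => ENNReal.ofReal (-F p)) :=
    isFiniteMeasure_withDensity hfin2
  have hm1 : AEMeasurable (fun p => ENNReal.ofReal (F p)) m := hF.1.aemeasurable.ennreal_ofReal
  have hm2 : AEMeasurable (fun p => ENNReal.ofReal (-F p)) m :=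
    hF.1.aemeasurable.neg.ennreal_ofReal
  have heq : (m.withDensity fun p => ENNReal.ofReal (F p))
      = m.withDensity fun p => ENNReal.ofReal (-F p) := by
    refine Measure.ext_of_integral_mul_boundedContinuousFunction fun f g => ?_
    rw [integral_withDensity_eq_integral_toReal_smul₀ hm1 (ae_of_all _ fun p => by simp),
      integral_withDensity_eq_integral_toReal_smul₀ hm2 (ae_of_all _ fun p => by simp),
      ← sub_eq_zero]
    have hbd : ∀ {G : S × (Fin d → ℝ) → ℝ}, Integrable G m →
        Integrable (fun p => G p • (f p.1 * g p.2)) m := fun hG =>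
      hG.mul_bdd (c := ‖f‖ * ‖g‖) ((f.continuous.comp continuous_fst).mul
        (g.continuous.comp continuous_snd)).aestronglyMeasurable (ae_of_all _ fun p => by
          rw [norm_mul]
          exact mul_le_mul (f.norm_coe_le_norm _) (g.norm_coe_le_norm _) (norm_nonneg _)
            (norm_nonneg _))
    have j1 : Integrable (fun p => (ENNReal.ofReal (F p)).toReal) m :=
      integrable_toReal_of_lintegral_ne_top hm1 hfin1
    have j2 : Integrable (fun p => (ENNReal.ofReal (-F p)).toReal) m :=
      integrable_toReal_of_lintegral_ne_top hm2 hfin2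
    rw [← integral_sub (hbd j1) (hbd j2), ← hb f g]
    refine integral_congr_ae (ae_of_all _ fun p => ?_)
    simp only [smul_eq_mul]
    rw [← sub_mul]
    congr 1
    rw [ENNReal.toReal_ofReal', ENNReal.toReal_ofReal']
    rcases le_total 0 (F p) with h0 | h0
    · rw [max_eq_left h0, max_eq_right (by linarith)]; ring
    · rw [max_eq_right h0, max_eq_left (by linarith)]; ring
  have hae := (withDensity_eq_iff hm1 hm2 hfin1).1 heq
  filter_upwards [hae] with p hp
  rcases le_total 0 (F p) with h0 | h0
  · rw [ENNReal.ofReal_of_nonpos (p := -F p) (by linarith), ENNReal.ofReal_eq_zero] at hp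
    simpa using le_antisymm hp h0
  · rw [ENNReal.ofReal_of_nonpos h0, eq_comm, ENNReal.ofReal_eq_zero] at hp
    simpa using le_antisymm h0 (by linarith)

/-- The classes of the test functions `f(s) g(x)`. -/
def tensorClasses (m : Measure (S × (Fin d → ℝ))) [IsFiniteMeasure m] : Set (Lp ℝ 2 m) :=
  {y | ∃ (f : S →ᵇ ℝ) (g : (Fin d → ℝ) → ℝ) (hg : Continuous g) (hc : HasCompactSupport g),
    y = ((bddMeas_tensor f hg hc).memLp m 2).toLp _}

theorem dense_span_tensorClasses (m : Measure (S × (Fin d → ℝ))) [IsFiniteMeasure m] :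
    Dense (Submodule.span ℝ (tensorClasses m) : Set (Lp ℝ 2 m)) := by
  rw [Submodule.dense_iff_topologicalClosure_eq_top, Submodule.topologicalClosure_eq_top_iff,
    Submodule.eq_bot_iff]
  intro F hF
  have h := ae_eq_zero_of_integral_tensor_eq_zero (m := m) (F := F)
    ((Lp.memLp F).integrable (by norm_num)) fun f g hg hc => by
      rw [integral_mul_eq_inner (Lp.memLp F) ((bddMeas_tensor f hg hc).memLp m 2), Lp.toLp_coeFn]
      have hmem : ((bddMeas_tensor f hg hc).memLp m 2).toLp _ ∈ tensorClasses m :=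
        ⟨f, g, hg, hc, rfl⟩
      exact Submodule.inner_left_of_mem_orthogonal (Submodule.subset_span hmem) hF
  exact Lp.eq_zero_iff_ae_eq_zero.2 h

theorem tendsto_inner_of_tensor {m : Measure (S × (Fin d → ℝ))} [IsFiniteMeasure m]
    {U : ℕ → S × (Fin d → ℝ) → ℝ} {u : S × (Fin d → ℝ) → ℝ} (hU : ∀ n, MemLp (U n) 2 m)
    (hu : MemLp u 2 m) {B : ℝ} (hB : ∀ᶠ n in atTop, ∫ p, U n p ^ 2 ∂m ≤ B)
    (h : ∀ (f : S →ᵇ ℝ) (g : (Fin d → ℝ) → ℝ), Continuous g → HasCompactSupport g →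
      Tendsto (fun n => ∫ p, U n p * (f p.1 * g p.2) ∂m) atTop
        (𝓝 (∫ p, u p * (f p.1 * g p.2) ∂m))) (z : Lp ℝ 2 m) :
    Tendsto (fun n => inner ℝ ((hU n).toLp (U n)) z) atTop (𝓝 (inner ℝ (hu.toLp u) z)) := by
  refine tendsto_inner_of_dense (dense_span_tensorClasses m) (B := √B) ?_ (fun y hy => ?_) z
  · filter_upwards [hB] with n hn
    rw [integral_sq_eq_norm_sq (hU n)] at hn
    exact Real.le_sqrt_of_sq_le hn
  · induction hy using Submodule.span_induction with
    | mem y hy =>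
      obtain ⟨f, g, hg, hc, rfl⟩ := hy
      simp only [← integral_mul_eq_inner]
      exact h f g hg hc
    | zero => simp
    | add x y _ _ hx hy => simpa only [inner_add_right] using hx.add hy
    | smul c x _ hx => simpa only [inner_smul_right] using hx.const_mul c

/-- The closure of the graph of the gradient is a closed subspace, hence weakly closed. For bounded
sequences, testing against the total family of products `f(s) g(x)` is enough for weak convergence.
-/
theorem isLimGrad_of_weak {m : Measure (S × (Fin d → ℝ))} [IsFiniteMeasure m]
    {U : ℕ → S × (Fin d → ℝ) → ℝ} {V : ℕ → Fin d → S × (Fin d → ℝ) → ℝ}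
    {u : S × (Fin d → ℝ) → ℝ} {v : Fin d → S × (Fin d → ℝ) → ℝ}
    (hU : ∀ n, MemLp (U n) 2 m) (hV : ∀ n i, MemLp (V n i) 2 m) (hu : MemLp u 2 m)
    (hv : ∀ i, MemLp (v i) 2 m) (hK : ∀ᶠ n in atTop, IsLimGrad m (U n) (V n)) {B : ℝ}
    (hBU : ∀ᶠ n in atTop, ∫ p, U n p ^ 2 ∂m ≤ B)
    (hBV : ∀ i, ∀ᶠ n in atTop, ∫ p, V n i p ^ 2 ∂m ≤ B)
    (htU : ∀ (f : S →ᵇ ℝ) (g : (Fin d → ℝ) → ℝ), Continuous g → HasCompactSupport g →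
      Tendsto (fun n => ∫ p, U n p * (f p.1 * g p.2) ∂m) atTop
        (𝓝 (∫ p, u p * (f p.1 * g p.2) ∂m)))
    (htV : ∀ i, ∀ (f : S →ᵇ ℝ) (g : (Fin d → ℝ) → ℝ), Continuous g → HasCompactSupport g →
      Tendsto (fun n => ∫ p, V n i p * (f p.1 * g p.2) ∂m) atTop
        (𝓝 (∫ p, v i p * (f p.1 * g p.2) ∂m))) : IsLimGrad m u v := by
  rw [isLimGrad_iff_mem_closure hu hv]
  refine mem_of_tendsto_inner (Submodule.isClosed_topologicalClosure _)
    (x := fun n => WithLp.toLp 2 fun o : Option (Fin d) => o.elim ((hU n).toLp (U n)) fun i =>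
      (hV n i).toLp (V n i)) ?_ fun y => ?_
  · filter_upwards [hK] with n hn
    exact (isLimGrad_iff_mem_closure (hU n) (hV n)).1 hn
  · simp only [PiLp.inner_apply, Fintype.sum_option]
    refine (tendsto_inner_of_tensor hU hu hBU htU _).add (tendsto_finsetSum _ fun i _ => ?_)
    exact tendsto_inner_of_tensor (fun n => hV n i) (hv i) (hBV i) (htV i) _

theorem ae_eq_of_integral_bcf_eq {X : Type*} [TopologicalSpace X] [PolishSpace X]
    [MeasurableSpace X] [BorelSpace X] {m : Measure X} [IsFiniteMeasure m] {F G : X → ℝ}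
    (hF : MemLp F 2 m) (hG : MemLp G 2 m)
    (h : ∀ ψ : X →ᵇ ℝ, ∫ x, F x * ψ x ∂m = ∫ x, G x * ψ x ∂m) : F =ᵐ[m] G := by
  have hde : DenseRange (BoundedContinuousFunction.toLp 2 m ℝ : (X →ᵇ ℝ) →L[ℝ] Lp ℝ 2 m) := by
    have := weaklyRegular_of_finite m
    let _ := TopologicalSpace.upgradeIsCompletelyMetrizable X
    exact BoundedContinuousFunction.toLp_denseRange ℝ m ℝ (by norm_num)
  have h0 : ∀ y : Lp ℝ 2 m, inner ℝ (hF.toLp F) y = inner ℝ (hG.toLp G) y := by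
    intro y
    refine hde.induction_on (p := fun y => inner ℝ (hF.toLp F) y = inner ℝ (hG.toLp G) y) y
      (isClosed_eq (by fun_prop) (by fun_prop)) fun ψ => ?_
    rw [toLp_bcf_eq, ← integral_mul_eq_inner, ← integral_mul_eq_inner]
    exact h ψ
  have h1 := ext_inner_right ℝ h0
  exact (MemLp.toLp_eq_toLp_iff hF hG).1 h1

/-- Lower semicontinuity of the norm: the Riesz limit of `exists_weak_limit_of_le` obeys the bound
and coincides with `F`, having the same pairings. -/
theorem integral_sq_le_of_tendsto {X : Type*} [TopologicalSpace X] [PolishSpace X]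
    [MeasurableSpace X] [BorelSpace X] {m : ℕ → Measure X} [∀ N, IsFiniteMeasure (m N)]
    {m₀ : Measure X} [IsFiniteMeasure m₀] (𝒰 : Ultrafilter ℕ)
    (hm : ∀ ψ : X →ᵇ ℝ, Tendsto (fun N => ∫ x, ψ x ∂m N) 𝒰 (𝓝 (∫ x, ψ x ∂m₀)))
    {f : ℕ → X → ℝ} (hf : ∀ N, MemLp (f N) 2 (m N)) {B : ℝ}
    (hB : ∀ᶠ N in (𝒰 : Filter ℕ), ∫ x, f N x ^ 2 ∂m N ≤ B) {F : X → ℝ} (hF : MemLp F 2 m₀)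
    (hlim : ∀ ψ : X →ᵇ ℝ,
      Tendsto (fun N => ∫ x, f N x * ψ x ∂m N) 𝒰 (𝓝 (∫ x, F x * ψ x ∂m₀))) :
    ∫ x, F x ^ 2 ∂m₀ ≤ B := by
  obtain ⟨G, hG, hGB, hGlim⟩ := exists_weak_limit_of_le 𝒰 hm hf hB
  have h := ae_eq_of_integral_bcf_eq hF hG fun ψ => tendsto_nhds_unique (hlim ψ) (hGlim ψ)
  refine le_trans (le_of_eq (integral_congr_ae ?_)) hGB
  filter_upwards [h] with x hx
  rw [hx]

end TestFunctions

/-! ### Superpositions with square integrable coefficients -/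

section Coefficients

variable {d : ℕ} {S : Type*} [TopologicalSpace S] [MeasurableSpace S] [BorelSpace S]

theorem IsLimGrad.add {m : Measure (S × (Fin d → ℝ))} {u u' : S × (Fin d → ℝ) → ℝ}
    {V V' : Fin d → S × (Fin d → ℝ) → ℝ} (hu : AEStronglyMeasurable u m)
    (hu' : AEStronglyMeasurable u' m) (hV : ∀ i, AEStronglyMeasurable (V i) m)
    (hV' : ∀ i, AEStronglyMeasurable (V' i) m) (h : IsLimGrad m u V) (h' : IsLimGrad m u' V') :
    IsLimGrad m (u + u') fun i => V i + V' i := by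
  obtain ⟨w, hw, h1, h2⟩ := h
  obtain ⟨w', hw', h1', h2'⟩ := h'
  have hs := fun k => isSmoothBdd_of_mem_core (hw k)
  have hs' := fun k => isSmoothBdd_of_mem_core (hw' k)
  have key : ∀ {f f' : ℕ → S × (Fin d → ℝ) → ℝ} {g g' : S × (Fin d → ℝ) → ℝ},
      (∀ k, Continuous (f k)) → (∀ k, Continuous (f' k)) → AEStronglyMeasurable g m →
      AEStronglyMeasurable g' m → Tendsto (fun k => eLpNorm (f k - g) 2 m) atTop (𝓝 0) →
      Tendsto (fun k => eLpNorm (f' k - g') 2 m) atTop (𝓝 0) →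
      Tendsto (fun k => eLpNorm ((f k + f' k) - (g + g')) 2 m) atTop (𝓝 0) := by
    intro f f' g g' hf hf' hg hg' a1 a2
    have h2 := a1.add a2
    rw [add_zero] at h2
    refine tendsto_of_tendsto_of_tendsto_of_le_of_le tendsto_const_nhds h2 (fun _ => zero_le)
      fun k => ?_
    have e : (f k + f' k) - (g + g') = (f k - g) + (f' k - g') := by abel
    rw [e]
    exact eLpNorm_add_le ((hf k).aestronglyMeasurable.sub hg)
      ((hf' k).aestronglyMeasurable.sub hg') (by norm_num)
  refine ⟨fun k => w k + w' k, fun k => Submodule.add_mem _ (hw k) (hw' k),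
    key (fun k => (hs k).continuous) (fun k => (hs' k).continuous) hu hu' h1 h1', fun i => ?_⟩
  simp only [fun k => pgrad_add (hs k) (hs' k) i]
  exact key (fun k => (hs k).continuous_grad i) (fun k => (hs' k).continuous_grad i) (hV i) (hV' i)
    (h2 i) (h2' i)

theorem IsLimGrad.finset_sum {m : Measure (S × (Fin d → ℝ))} {ι : Type*} (A : Finset ι)
    {u : ι → S × (Fin d → ℝ) → ℝ} {V : ι → Fin d → S × (Fin d → ℝ) → ℝ}
    (hu : ∀ a, AEStronglyMeasurable (u a) m) (hV : ∀ a i, AEStronglyMeasurable (V a i) m)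
    (h : ∀ a, IsLimGrad m (u a) (V a)) :
    IsLimGrad m (∑ a ∈ A, u a) fun i => ∑ a ∈ A, V a i := by
  classical
  induction A using Finset.induction_on with
  | empty =>
    refine ⟨fun _ => 0, fun _ => Submodule.zero_mem _, by simp, fun i => ?_⟩
    have : pgrad i (0 : S × (Fin d → ℝ) → ℝ) = 0 := by funext p; simp [pgrad]
    simp [this]
  | insert a A ha ih =>
    simp only [Finset.sum_insert ha]
    exact (h a).add (hu a) (Finset.aestronglyMeasurable_sum _ fun a _ => hu a) (hV a)
      (fun i => Finset.aestronglyMeasurable_sum _ fun a _ => hV a i) ih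

theorem tendsto_eLpNorm_tensor {μ m : Measure (S × (Fin d → ℝ))} (hm : m ≤ μ)
    {b : S → ℝ} (hb : AEStronglyMeasurable b μ.fst) {ψ : ℕ → S →ᵇ ℝ}
    (hψ : Tendsto (fun k => eLpNorm (fun x => ψ k x - b x) 2 μ.fst) atTop (𝓝 0))
    {h : (Fin d → ℝ) → ℝ} (hh : Continuous h) (hhc : HasCompactSupport h) :
    Tendsto (fun k => eLpNorm ((fun p : S × (Fin d → ℝ) => ψ k p.1 * h p.2)
      - fun p => b p.1 * h p.2) 2 m) atTop (𝓝 0) := by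
  obtain ⟨M, hM⟩ := hhc.exists_bound_of_continuous hh
  have h1 := ENNReal.Tendsto.const_mul (a := ENNReal.ofReal M) hψ
    (Or.inr ENNReal.ofReal_ne_top)
  rw [mul_zero] at h1
  refine tendsto_of_tendsto_of_tendsto_of_le_of_le tendsto_const_nhds h1 (fun _ => zero_le)
    fun k => ?_
  have hmeas : AEStronglyMeasurable (fun s => ψ k s - b s) μ.fst :=
    (ψ k).continuous.aestronglyMeasurable.sub hb
  have h2 := eLpNorm_fst (d := d) (μ := μ) hmeas
  have h3 := eLpNorm_mono_measure (p := 2) ((fun p : S × (Fin d → ℝ) => ψ k p.1 * h p.2)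
      - fun p => b p.1 * h p.2) hm
  have h4 : eLpNorm ((fun p : S × (Fin d → ℝ) => ψ k p.1 * h p.2)
      - fun p => b p.1 * h p.2) 2 μ
      ≤ ENNReal.ofReal M * eLpNorm (fun p : S × (Fin d → ℝ) => ψ k p.1 - b p.1) 2 μ := by
    refine eLpNorm_le_mul_eLpNorm_of_ae_le_mul (ae_of_all _ fun p => ?_) 2
    simp only [Pi.sub_apply]
    rw [← sub_mul, norm_mul, mul_comm]
    exact mul_le_mul_of_nonneg_right (hM _) (norm_nonneg _)
  rw [h2] at h4
  exact h3.trans h4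

variable [PolishSpace S]

theorem exists_bcf_tendsto {X : Type*} [TopologicalSpace X] [PolishSpace X] [MeasurableSpace X]
    [BorelSpace X] {m : Measure X} [IsFiniteMeasure m] {b : X → ℝ} (hb : MemLp b 2 m) :
    ∃ ψ : ℕ → X →ᵇ ℝ, Tendsto (fun k => eLpNorm (fun x => ψ k x - b x) 2 m) atTop (𝓝 0) := by
  have := weaklyRegular_of_finite m
  let _ := TopologicalSpace.upgradeIsCompletelyMetrizable X
  have h : ∀ k : ℕ, ∃ ψ : X →ᵇ ℝ,
      eLpNorm (b - ⇑ψ) 2 m ≤ ENNReal.ofReal (1 / ((k : ℝ) + 1)) := fun k => by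
    obtain ⟨ψ, h1, -⟩ := hb.exists_boundedContinuous_eLpNorm_sub_le (by norm_num)
      (ε := ENNReal.ofReal (1 / ((k : ℝ) + 1)))
      (ENNReal.ofReal_pos.2 (by positivity)).ne'
    exact ⟨ψ, h1⟩
  choose ψ hψ using h
  refine ⟨ψ, ?_⟩
  have h0 : Tendsto (fun k : ℕ => ENNReal.ofReal (1 / ((k : ℝ) + 1))) atTop (𝓝 0) := by
    simpa using ENNReal.tendsto_ofReal (tendsto_one_div_add_atTop_nhds_zero_nat (𝕜 := ℝ))
  refine tendsto_of_tendsto_of_tendsto_of_le_of_le tendsto_const_nhds h0 (fun _ => zero_le)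
    fun k => ?_
  refine le_trans (le_of_eq ?_) (hψ k)
  rw [← eLpNorm_neg]
  congr 1
  funext x
  simp

/-- Coefficients in `L²` of the marginal are approximated by bounded continuous ones. As `η` and its
derivatives are bounded, products and gradients converge in `L²`. -/
theorem isLimGrad_tensor {μ m : Measure (S × (Fin d → ℝ))} [IsFiniteMeasure μ] (hm : m ≤ μ)
    {b : S → ℝ} (hb : MemLp b 2 μ.fst) {η : (Fin d → ℝ) → ℝ} (hη : ContDiff ℝ 1 η)
    (hc : HasCompactSupport η) :
    IsLimGrad m (fun p => b p.1 * η p.2) fun i p => b p.1 * fderiv ℝ η p.2 (Pi.single i 1) := by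
  obtain ⟨ψ, hψ⟩ := exists_bcf_tendsto hb
  refine ⟨fun k p => ψ k p.1 * η p.2, fun k => Submodule.subset_span ⟨ψ k, η, hη, hc, rfl⟩,
    tendsto_eLpNorm_tensor hm hb.1 hψ hη.continuous hc, fun i => ?_⟩
  have hd : ∀ k, pgrad i (fun p : S × (Fin d → ℝ) => ψ k p.1 * η p.2)
      = fun p => ψ k p.1 * fderiv ℝ η p.2 (Pi.single i 1) := fun k =>
    pgrad_tensor (ψ k) (hη.differentiable (by simp)) i
  have h1 : Continuous fun x => fderiv ℝ η x (Pi.single i 1) :=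
    (hη.continuous_fderiv (by simp)).clm_apply continuous_const
  have h2 : HasCompactSupport fun x => fderiv ℝ η x (Pi.single i 1) :=
    hc.fderiv_apply (𝕜 := ℝ) (v := Pi.single i 1)
  refine (tendsto_eLpNorm_tensor hm hb.1 hψ h1 h2).congr fun k => ?_
  rw [hd k]

/-- Weak limits of bounded coefficients are compatible with the conditional integrals, provided
the conditional integrals converge. -/
theorem tendsto_integral_coef_mul {μ : ℕ → Measure (S × (Fin d → ℝ))}
    [∀ N, IsProbabilityMeasure (μ N)] {μ₀ : Measure (S × (Fin d → ℝ))} [IsProbabilityMeasure μ₀]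
    (𝒰 : Ultrafilter ℕ)
    (hm : ∀ ψ : (S × (Fin d → ℝ)) →ᵇ ℝ,
      Tendsto (fun N => ∫ p, ψ p ∂μ N) 𝒰 (𝓝 (∫ p, ψ p ∂μ₀)))
    (hcond : ∀ g : (S × (Fin d → ℝ)) →ᵇ ℝ,
      Tendsto (fun N => ∫ s, |∫ x, g (s, x) ∂((μ N).condKernel s)| ^ 2 ∂(μ N).fst) 𝒰
        (𝓝 (∫ s, |∫ x, g (s, x) ∂(μ₀.condKernel s)| ^ 2 ∂μ₀.fst)))
    {b : ℕ → S → ℝ} {M : ℝ} (hb : ∀ N, Measurable (b N)) (hbM : ∀ N s, |b N s| ≤ M)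
    {b₀ : S → ℝ} (hb₀ : MemLp b₀ 2 μ₀.fst)
    (hlim : ∀ ψ : S →ᵇ ℝ,
      Tendsto (fun N => ∫ s, b N s * ψ s ∂(μ N).fst) 𝒰 (𝓝 (∫ s, b₀ s * ψ s ∂μ₀.fst)))
    (g : (S × (Fin d → ℝ)) →ᵇ ℝ) :
    Tendsto (fun N => ∫ p, b N p.1 * g p ∂μ N) 𝒰 (𝓝 (∫ p, b₀ p.1 * g p ∂μ₀)) := by
  have hGdef : ∀ (ρ : Measure (S × (Fin d → ℝ))) [IsProbabilityMeasure ρ],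
      BddMeas fun s => ∫ x, g (s, x) ∂(ρ.condKernel s) := by
    intro ρ _
    refine ⟨?_, ‖g‖, fun s => ?_⟩
    · exact (g.continuous.stronglyMeasurable.integral_kernel_prod_right'
        (κ := ρ.condKernel)).measurable
    · have := norm_integral_le_of_norm_le_const (μ := ρ.condKernel s) (f := fun x => g (s, x))
        (ae_of_all _ fun x => g.norm_coe_le_norm (s, x))
      simpa using this
  have hfub : ∀ (ρ : Measure (S × (Fin d → ℝ))) [IsProbabilityMeasure ρ] (c : S → ℝ),
      MemLp c 2 ρ.fst → ∫ p, c p.1 * g p ∂ρ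
        = ∫ s, c s * ∫ x, g (s, x) ∂(ρ.condKernel s) ∂ρ.fst := by
    intro ρ _ c hc
    have hint : Integrable (fun p => c p.1 * g p) ρ :=
      integrable_mul_of_memLp (memLp_fst hc) (memLp_two_bcf ρ g)
    rw [← Measure.integral_condKernel hint]
    refine integral_congr_ae (ae_of_all _ fun s => ?_)
    simp only
    rw [integral_const_mul]
  have hbmem : ∀ N, MemLp (b N) 2 (μ N).fst := fun N =>
    BddMeas.memLp ⟨hb N, M, hbM N⟩ _ _
  have hM0 : 0 ≤ M := by
    have : Nonempty S := by
      by_contra hne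
      rw [not_nonempty_iff] at hne
      have h1 : μ₀.fst univ = 1 := measure_univ
      rw [univ_eq_empty_iff.2 hne] at h1
      simp at h1
    exact (abs_nonneg _).trans (hbM 0 (Classical.arbitrary S))
  -- Expanding the square, condition (i) handles the squared conditional integral and weak
  -- convergence of the measures the other two terms. In effect the conditional integrals converge
  -- strongly: they stay near any `ψ` that is near the limit.
  have hsq : ∀ (ψ : S →ᵇ ℝ), Tendsto (fun N => ∫ s, ((∫ x, g (s, x) ∂((μ N).condKernel s)) - ψ s) ^ 2
      ∂(μ N).fst) 𝒰 (𝓝 (∫ s, ((∫ x, g (s, x) ∂(μ₀.condKernel s)) - ψ s) ^ 2 ∂μ₀.fst)) := by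
    intro ψ
    have hexp : ∀ (ρ : Measure (S × (Fin d → ℝ))) [IsProbabilityMeasure ρ],
        ∫ s, ((∫ x, g (s, x) ∂(ρ.condKernel s)) - ψ s) ^ 2 ∂ρ.fst
          = (∫ s, |∫ x, g (s, x) ∂(ρ.condKernel s)| ^ 2 ∂ρ.fst) - 2 * (∫ p, ψ p.1 * g p ∂ρ)
            + ∫ p, ψ p.1 ^ 2 ∂ρ := by
      intro ρ _
      have hψ2 : BddMeas fun s => ψ s := ⟨ψ.continuous.measurable, ‖ψ‖, ψ.norm_coe_le_norm⟩
      have e1 : ∫ p, ψ p.1 ^ 2 ∂ρ = ∫ s, ψ s ^ 2 ∂ρ.fst := by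
        rw [Measure.fst, integral_map measurable_fst.aemeasurable]
        exact (ψ.continuous.pow 2).aestronglyMeasurable
      rw [e1, hfub ρ _ (memLp_two_bcf _ ψ), ← integral_const_mul]
      have i1 := (hGdef ρ).sq.integrable ρ.fst
      have i2 := ((hψ2.mul (hGdef ρ)).integrable ρ.fst).const_mul 2
      have i3 := hψ2.sq.integrable ρ.fst
      simp only [sq_abs]
      rw [← integral_sub i1 i2, ← integral_add (i1.sub' i2) i3]
      refine integral_congr_ae (ae_of_all _ fun s => ?_)
      simp only
      ring
    simp only [hexp]
    let ψ' : (S × (Fin d → ℝ)) →ᵇ ℝ := ψ.compContinuous ⟨Prod.fst, continuous_fst⟩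
    have t1 := hm (ψ' * g)
    have t2 := hm (ψ' * ψ')
    refine ((hcond g).sub (t1.const_mul 2)).add ?_
    simpa [pow_two, ψ'] using t2
  have hGm₀ := (hGdef μ₀).memLp μ₀.fst 2
  obtain ⟨ψ, hψ⟩ := exists_bcf_tendsto hGm₀
  have hψ' : Tendsto (fun k => √(∫ s, ((∫ x, g (s, x) ∂(μ₀.condKernel s)) - ψ k s) ^ 2 ∂μ₀.fst))
      atTop (𝓝 0) := by
    have h1 := (ENNReal.tendsto_toReal ENNReal.zero_ne_top).comp hψ
    rw [ENNReal.toReal_zero] at h1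
    refine h1.congr fun k => ?_
    simp only [Function.comp]
    have h2 := eLpNorm_two_eq_ofReal (f := fun s => ψ k s - ∫ x, g (s, x) ∂(μ₀.condKernel s))
      ((memLp_two_bcf μ₀.fst (ψ k)).sub hGm₀)
    rw [h2, ENNReal.toReal_ofReal (Real.sqrt_nonneg _)]
    congr 1
    refine integral_congr_ae (ae_of_all _ fun s => ?_)
    ring
  rw [Metric.tendsto_nhds]
  intro ε hε
  set c := √(∫ s, b₀ s ^ 2 ∂μ₀.fst) with hc
  have hc0 : 0 ≤ c := Real.sqrt_nonneg _
  -- The three errors are at most `M * δ`, `δ` and `c * δ`: replacing the conditional integral by `ψ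
  -- k` for `N`, the weak limit against `ψ k`, and replacing it back in the limit.
  set δ := ε / (2 * (M + c + 1)) with hδ
  have hδ0 : 0 < δ := by positivity
  obtain ⟨k, hk⟩ := (hψ'.eventually_lt_const hδ0).exists
  have ev1 := ((hsq (ψ k)).sqrt).eventually_lt_const hk
  have ev2 := (Metric.tendsto_nhds.1 (hlim (ψ k))) δ hδ0
  filter_upwards [ev1, ev2] with N h1 h2
  rw [Real.dist_eq] at h2 ⊢
  rw [hfub (μ N) _ (hbmem N), hfub μ₀ _ hb₀]
  have i1 := integrable_mul_of_memLp (hbmem N) ((hGdef (μ N)).memLp _ 2)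
  have i2 := integrable_mul_of_memLp (hbmem N) (memLp_two_bcf (μ N).fst (ψ k))
  have i3 := integrable_mul_of_memLp hb₀ hGm₀
  have i4 := integrable_mul_of_memLp hb₀ (memLp_two_bcf μ₀.fst (ψ k))
  have e1 : (∫ s, b N s * ∫ x, g (s, x) ∂((μ N).condKernel s) ∂(μ N).fst)
      - ∫ s, b₀ s * ∫ x, g (s, x) ∂(μ₀.condKernel s) ∂μ₀.fst
      = (∫ s, b N s * ((∫ x, g (s, x) ∂((μ N).condKernel s)) - ψ k s) ∂(μ N).fst)
        + ((∫ s, b N s * ψ k s ∂(μ N).fst) - ∫ s, b₀ s * ψ k s ∂μ₀.fst)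
        - ∫ s, b₀ s * ((∫ x, g (s, x) ∂(μ₀.condKernel s)) - ψ k s) ∂μ₀.fst := by
    simp only [mul_sub]
    rw [integral_sub i1 i2, integral_sub i3 i4]
    ring
  have b1 := abs_integral_mul_le (hbmem N)
    (((hGdef (μ N)).memLp (μ N).fst 2).sub (memLp_two_bcf (μ N).fst (ψ k)))
  have b2 := abs_integral_mul_le hb₀ (hGm₀.sub (memLp_two_bcf μ₀.fst (ψ k)))
  simp only [Pi.sub_apply] at b1 b2
  have b3 : √(∫ s, b N s ^ 2 ∂(μ N).fst) ≤ M := by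
    refine Real.sqrt_le_iff.2 ⟨hM0, ?_⟩
    have := integral_mono (μ := (μ N).fst) (BddMeas.sq ⟨hb N, M, hbM N⟩ |>.integrable _)
      (integrable_const (M ^ 2)) fun s => sq_le_sq' (abs_le.1 (hbM N s)).1 (abs_le.1 (hbM N s)).2
    simpa using this
  rw [e1]
  have b4 := mul_le_mul b3 h1.le (Real.sqrt_nonneg _) hM0
  have b5 := mul_le_mul_of_nonneg_left hk.le hc0
  have b6 : (M + c + 1) * δ < ε := by
    rw [hδ]
    field_simp
    linarith
  have a1 := abs_sub ((∫ s, b N s * ((∫ x, g (s, x) ∂((μ N).condKernel s)) - ψ k s) ∂(μ N).fst)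
        + ((∫ s, b N s * ψ k s ∂(μ N).fst) - ∫ s, b₀ s * ψ k s ∂μ₀.fst))
        (∫ s, b₀ s * ((∫ x, g (s, x) ∂(μ₀.condKernel s)) - ψ k s) ∂μ₀.fst)
  have a2 := abs_add_le (∫ s, b N s * ((∫ x, g (s, x) ∂((μ N).condKernel s)) - ψ k s) ∂(μ N).fst)
        ((∫ s, b N s * ψ k s ∂(μ N).fst) - ∫ s, b₀ s * ψ k s ∂μ₀.fst)
  have e7 : (M + c + 1) * δ = M * δ + c * δ + δ := by ring
  linarith

end Coefficients

/-! ### Estimates for the perturbation along the sections -/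

section Estimates

variable {d : ℕ} {S : Type*} [MeasurableSpace S]

/-- Measurable functions with bounded sections. -/
def BddSec (f : S × (Fin d → ℝ) → ℝ) : Prop :=
  Measurable f ∧ ∀ s, ∃ M : ℝ, ∀ x, |f (s, x)| ≤ M

/-- The perturbation along the sections. -/
def pertSec (r : ℝ) (φ η : (Fin d → ℝ) → ℝ) (f : S × (Fin d → ℝ) → ℝ) (p : S × (Fin d → ℝ)) : ℝ :=
  perturbation r φ η (fun x => f (p.1, x)) p.2

variable {f : S × (Fin d → ℝ) → ℝ}

theorem BddMeas.bddSec (hf : BddMeas f) : BddSec f :=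
  ⟨hf.1, fun s => ⟨hf.2.choose, fun x => hf.2.choose_spec (s, x)⟩⟩

theorem BddSec.bddMeas (hf : BddSec f) (s : S) : BddMeas fun x => f (s, x) :=
  ⟨hf.1.comp measurable_prodMk_left, hf.2 s⟩

theorem BddSec.sq (hf : BddSec f) : BddSec fun p => f p ^ 2 :=
  ⟨hf.1.pow_const 2, fun s => (hf.bddMeas s).sq.2⟩

theorem BddSec.abs (hf : BddSec f) : BddSec fun p => |f p| :=
  ⟨(hf.1.norm : Measurable fun p => ‖f p‖), fun s => (hf.bddMeas s).abs.2⟩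

theorem BddSec.mul_snd (hf : BddSec f) {g : (Fin d → ℝ) → ℝ} (hg : BddMeas g) :
    BddSec fun p => f p * g p.2 :=
  ⟨hf.1.mul (hg.1.comp measurable_snd), fun s => ((hf.bddMeas s).mul hg).2⟩

variable {r : ℝ} {φ η : (Fin d → ℝ) → ℝ}

theorem measurable_pertSec (hf : BddSec f) (hr : 0 < r) (hφ : IsPrimal φ) (hη : IsPrimal η) :
    Measurable (pertSec r φ η f) :=
  measurable_perturbation_section hf.1 hr.ne' hφ hη

theorem memLp_cutMeasure {μ : Measure (S × (Fin d → ℝ))} {κ : S × (Fin d → ℝ) → ℝ} (hκ : IsCut κ)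
    {p : ℝ≥0∞} (hf : MemLp f p μ) : MemLp f p (cutMeasure μ κ) :=
  hf.mono_measure (cutMeasure_le μ hκ)

variable (μ : Measure (S × (Fin d → ℝ))) [IsProbabilityMeasure μ] {κ : S × (Fin d → ℝ) → ℝ}

/-- The uniform bound `C` on the perturbation constant of the conditional distributions. -/
def PertBound (r : ℝ) (κ : S × (Fin d → ℝ) → ℝ) (C : ℝ) : Prop :=
  0 ≤ C ∧ ∀ᵐ s ∂μ.fst, cPert r (fun x => κ (s, x)) (μ.condKernel s) ≤ ENNReal.ofReal C

variable {μ} {C : ℝ}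

theorem lintegral_pertSec_le (hac : ∀ᵐ s ∂μ.fst, μ.condKernel s ≪ volume) (hκ : IsCut κ)
    (hC : PertBound μ r κ C) (hr : 0 < r) (hφ : IsPrimal φ) (hη : IsPrimal η) (hf : BddSec f)
    (hf0 : ∀ p, 0 ≤ f p) :
    ∫⁻ p, ENNReal.ofReal (pertSec r φ η f p) ∂cutMeasure μ κ
      ≤ ENNReal.ofReal C * ∫⁻ p, ENNReal.ofReal (f p) ∂μ := by
  rw [lintegral_cutMeasure μ hκ (measurable_pertSec hf hr hφ hη).ennreal_ofReal,
    ← Measure.lintegral_condKernel hf.1.ennreal_ofReal,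
    ← lintegral_const_mul _ (hf.1.ennreal_ofReal.lintegral_kernel_prod_right')]
  refine lintegral_mono_ae ?_
  filter_upwards [hac, hC.2] with s hs hCs
  have hb := hf.bddMeas s
  have hk := bddMeas_cut_section hκ s
  have hp := (hb.perturbation hr hφ hη)
  have h1 : ∫⁻ x, ENNReal.ofReal (pertSec r φ η f (s, x)) * ENNReal.ofReal (κ (s, x))
      ∂μ.condKernel s
      = ENNReal.ofReal (∫ x, perturbation r φ η (fun x => f (s, x)) x * κ (s, x)
        ∂μ.condKernel s) := by
    rw [ofReal_integral_eq_lintegral_ofReal ((hp.mul hk).integrable _)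
      (ae_of_all _ fun x => mul_nonneg (perturbation_nonneg hr hφ hη (fun x => hf0 (s, x)) x)
        (hκ.2 _).1)]
    refine lintegral_congr fun x => ?_
    rw [ENNReal.ofReal_mul (perturbation_nonneg hr hφ hη (fun x => hf0 (s, x)) x)]
    rfl
  rw [h1, ← ofReal_integral_eq_lintegral_ofReal (hb.integrable _)
    (ae_of_all _ fun x => hf0 (s, x)), ← ENNReal.ofReal_mul hC.1]
  exact ENNReal.ofReal_le_ofReal (integral_perturbation_le_of_cPert hs hk.1
    (fun x => hκ.2 _) hr hφ hη hb (fun x => hf0 (s, x)) hC.1 hCs)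

theorem integrable_pertSec (hac : ∀ᵐ s ∂μ.fst, μ.condKernel s ≪ volume) (hκ : IsCut κ)
    (hC : PertBound μ r κ C) (hr : 0 < r) (hφ : IsPrimal φ) (hη : IsPrimal η) (hf : BddSec f)
    (hf0 : ∀ p, 0 ≤ f p) (hfi : Integrable f μ) :
    Integrable (pertSec r φ η f) (cutMeasure μ κ) ∧
      ∫ p, pertSec r φ η f p ∂cutMeasure μ κ ≤ C * ∫ p, f p ∂μ := by
  have h := lintegral_pertSec_le hac hκ hC hr hφ hη hf hf0
  have h0 : ∀ p, 0 ≤ pertSec r φ η f p := fun p =>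
    perturbation_nonneg hr hφ hη (fun x => hf0 (p.1, x)) p.2
  rw [← ofReal_integral_eq_lintegral_ofReal hfi (ae_of_all _ hf0),
    ← ENNReal.ofReal_mul hC.1] at h
  have hi : Integrable (pertSec r φ η f) (cutMeasure μ κ) := by
    refine ⟨(measurable_pertSec hf hr hφ hη).aestronglyMeasurable, ?_⟩
    rw [hasFiniteIntegral_iff_ofReal (ae_of_all _ h0)]
    exact h.trans_lt ENNReal.ofReal_lt_top
  refine ⟨hi, ?_⟩
  rw [← ofReal_integral_eq_lintegral_ofReal hi (ae_of_all _ h0)] at h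
  exact (ENNReal.ofReal_le_ofReal_iff (mul_nonneg hC.1 (integral_nonneg hf0))).1 h

/-- Jensen reduces the `L²` bound to the `L¹` bound for `f ^ 2`. The constant does not depend on the
primal functions, so it serves functions and gradients alike. -/
theorem memLp_pertSec (hac : ∀ᵐ s ∂μ.fst, μ.condKernel s ≪ volume) (hκ : IsCut κ)
    (hC : PertBound μ r κ C) (hr : 0 < r) (hφ : IsPrimal φ) (hη : IsPrimal η) (hf : BddSec f)
    (hf2 : MemLp f 2 μ) :
    MemLp (pertSec r φ η f) 2 (cutMeasure μ κ) ∧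
      ∫ p, pertSec r φ η f p ^ 2 ∂cutMeasure μ κ ≤ C * ∫ p, f p ^ 2 ∂μ := by
  obtain ⟨hi, hle⟩ := integrable_pertSec hac hκ hC hr hφ hη hf.sq (fun p => sq_nonneg _)
    hf2.integrable_sq
  have hpt : ∀ p, pertSec r φ η f p ^ 2 ≤ pertSec r φ η (fun p => f p ^ 2) p := fun p =>
    sq_perturbation_le hr hφ hη (hf.bddMeas p.1) p.2
  have hm := (measurable_pertSec hf hr hφ hη)
  have hi2 : Integrable (fun p => pertSec r φ η f p ^ 2) (cutMeasure μ κ) :=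
    hi.mono' (hm.pow_const 2).aestronglyMeasurable (ae_of_all _ fun p => by
      rw [Real.norm_of_nonneg (sq_nonneg _)]; exact hpt p)
  exact ⟨(memLp_two_iff_integrable_sq hm.aestronglyMeasurable).2 hi2,
    (integral_mono hi2 hi hpt).trans hle⟩

/-- Cauchy-Schwarz with a possibly nonmeasurable majorant of the quotient. -/
theorem lintegral_le_of_div_le {X : Type*} [MeasurableSpace X] {m : Measure X} {A b δ : X → ℝ≥0∞}
    (hA : Measurable A) (hb : Measurable b) (hbt : ∀ x, b x ≠ ⊤)
    (hδ : ∀ᵐ x ∂m, A x / b x ≤ δ x) {D : ℝ} (hD : eLpNorm δ 2 m ≤ ENNReal.ofReal D) :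
    ∫⁻ x, A x ∂m ≤ ENNReal.ofReal D * (∫⁻ x, b x ^ 2 ∂m) ^ (1 / 2 : ℝ) := by
  have hq : eLpNorm (fun x => A x / b x) 2 m ≤ ENNReal.ofReal D := by
    refine le_trans (eLpNorm_mono_enorm_ae ?_) hD
    filter_upwards [hδ] with x hx
    simpa using hx
  have hq2 : eLpNorm (fun x => A x / b x) 2 m = (∫⁻ x, (A x / b x) ^ (2 : ℝ) ∂m) ^ (1 / 2 : ℝ) := by
    rw [eLpNorm_eq_lintegral_rpow_enorm_toReal (by norm_num) (by norm_num)]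
    simp
  have hlt : ∫⁻ x, (A x / b x) ^ (2 : ℝ) ∂m ≠ ⊤ := by
    intro h
    rw [hq2, h, ENNReal.top_rpow_of_pos (by norm_num)] at hq
    exact ENNReal.ofReal_ne_top (top_le_iff.1 hq)
  have hae := ae_lt_top ((hA.div hb).pow_const (2 : ℝ)) hlt
  calc ∫⁻ x, A x ∂m ≤ ∫⁻ x, (A x / b x) * b x ∂m := by
        refine lintegral_mono_ae ?_
        filter_upwards [hae] with x hx
        rw [Pi.div_apply] at hx
        -- Where `b` vanishes, finiteness of the quotient forces `A` to vanish too.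
        by_cases h0 : b x = 0
        · by_cases hA0 : A x = 0
          · simp [hA0]
          · rw [h0, ENNReal.div_zero hA0, ENNReal.top_rpow_of_pos (by norm_num)] at hx
            exact absurd hx (lt_irrefl _)
        · rw [ENNReal.div_mul_cancel h0 (hbt x)]
    _ ≤ (∫⁻ x, (A x / b x) ^ (2 : ℝ) ∂m) ^ (1 / 2 : ℝ) * (∫⁻ x, b x ^ (2 : ℝ) ∂m) ^ (1 / 2 : ℝ) :=
        ENNReal.lintegral_mul_le_Lp_mul_Lq m Real.HolderConjugate.two_two
          (hA.div hb).aemeasurable hb.aemeasurable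
    _ ≤ ENNReal.ofReal D * (∫⁻ x, b x ^ 2 ∂m) ^ (1 / 2 : ℝ) := by
        rw [hq2] at hq
        simp only [ENNReal.rpow_two] at hq ⊢
        gcongr

variable {D : ℝ}

/-- A test function of `s` alone is constant on each fibre, so the fibrewise error is at most
`deltaRes` times the fibre norm of `f`. Cauchy–Schwarz in `s` concludes. -/
theorem abs_integral_pertSec_sub_le_fst (hac : ∀ᵐ s ∂μ.fst, μ.condKernel s ≪ volume)
    (hκ : IsCut κ) (hC : PertBound μ r κ C) (hD0 : 0 ≤ D)
    (hD : eLpNorm (fun s => deltaRes r (fun x => κ (s, x)) (μ.condKernel s)) 2 μ.fst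
      ≤ ENNReal.ofReal D) (hr : 0 < r) (hφ : IsPrimal φ) (hη : IsPrimal η) (hf : BddSec f)
    (hf2 : MemLp f 2 μ) {F : S → ℝ} {L : ℝ} (hF : Measurable F) (hL : ∀ s, |F s| ≤ L)
    (hL0 : 0 ≤ L) :
    |∫ p, (pertSec r φ η f p - f p) * F p.1 ∂cutMeasure μ κ| ≤ L * (D * √(∫ p, f p ^ 2 ∂μ)) := by
  have hfin := isFiniteMeasure_cutMeasure μ hκ
  have hP := memLp_pertSec hac hκ hC hr hφ hη hf hf2
  have hG : MemLp (fun p => pertSec r φ η f p - f p) 2 (cutMeasure μ κ) :=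
    hP.1.sub (memLp_cutMeasure hκ hf2)
  have hF2 : BddMeas fun p : S × (Fin d → ℝ) => F p.1 := ⟨hF.comp measurable_fst, L, fun p => hL _⟩
  have hint := integrable_mul_of_memLp hG (hF2.memLp (cutMeasure μ κ) 2)
  set H : S → ℝ := fun s => ∫ x, (pertSec r φ η f (s, x) - f (s, x)) * κ (s, x) ∂μ.condKernel s
    with hH
  have hmeasG : Measurable fun p => (pertSec r φ η f p - f p) * κ p :=
    ((measurable_pertSec hf hr hφ hη).sub hf.1).mul hκ.1
  have hHm : Measurable H :=
    (hmeasG.stronglyMeasurable.integral_kernel_prod_right' (κ := μ.condKernel)).measurable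
  have hint' : Integrable (fun p => (pertSec r φ η f p - f p) * F p.1 * κ p) μ := by
    unfold cutMeasure at hint
    rw [integrable_withDensity_iff_integrable_smul' (hκ.1.ennreal_ofReal)
      (ae_of_all _ fun p => ENNReal.ofReal_lt_top)] at hint
    refine hint.congr (ae_of_all _ fun p => ?_)
    simp only [smul_eq_mul]
    rw [ENNReal.toReal_ofReal (hκ.2 p).1, mul_comm]
  have e1 : ∫ p, (pertSec r φ η f p - f p) * F p.1 ∂cutMeasure μ κ = ∫ s, H s * F s ∂μ.fst := by
    rw [integral_cutMeasure μ hκ, ← Measure.integral_condKernel hint']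
    refine integral_congr_ae (ae_of_all _ fun s => ?_)
    simp only [hH]
    rw [← integral_mul_const]
    refine integral_congr_ae (ae_of_all _ fun x => ?_)
    simp only
    ring
  set b : S → ℝ≥0∞ := fun s => (∫⁻ x, ENNReal.ofReal (f (s, x) ^ 2) ∂μ.condKernel s) ^ (1 / 2 : ℝ)
    with hb
  have hb2 : ∀ s, b s ^ 2 = ∫⁻ x, ENNReal.ofReal (f (s, x) ^ 2) ∂μ.condKernel s := by
    intro s
    rw [hb, ← ENNReal.rpow_natCast, ← ENNReal.rpow_mul]
    norm_num
  have hbe : ∀ s, b s = eLpNorm (fun x => f (s, x)) 2 (μ.condKernel s) := by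
    intro s
    simp only [hb]
    rw [← eLpNorm_two_sq_eq, ← ENNReal.rpow_natCast, ← ENNReal.rpow_mul]
    norm_num
  have hbm : Measurable b :=
    (hf.1.pow_const 2).ennreal_ofReal.lintegral_kernel_prod_right'.pow_const _
  have hbt : ∀ s, b s ≠ ⊤ := fun s => by
    rw [hbe]; exact ((hf.bddMeas s).memLp (μ.condKernel s) 2).2.ne
  have key := lintegral_le_of_div_le (m := μ.fst) (A := fun s => ENNReal.ofReal |H s|)
    (hHm.norm : Measurable fun s => ‖H s‖).ennreal_ofReal hbm hbt
    (δ := fun s => deltaRes r (fun x => κ (s, x)) (μ.condKernel s)) (by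
      filter_upwards [hac] with s hs
      have hk := bddMeas_cut_section hκ s
      have h := div_le_deltaRes hs hk.1 (fun x => hκ.2 _) hr hφ hη (hf.bddMeas s)
      rw [hbe]
      refine le_trans (le_of_eq ?_) h
      congr 3
      simp only [hH, sub_mul]
      exact integral_sub ((((hf.bddMeas s).perturbation hr hφ hη).mul hk).integrable _)
        (((hf.bddMeas s).mul hk).integrable _)) hD
  have e2 : (∫⁻ s, b s ^ 2 ∂μ.fst) ^ (1 / 2 : ℝ) = ENNReal.ofReal √(∫ p, f p ^ 2 ∂μ) := by
    simp only [hb2]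
    rw [Measure.lintegral_condKernel (hf.1.pow_const 2).ennreal_ofReal, ← eLpNorm_two_sq_eq,
      ← ENNReal.rpow_natCast, ← ENNReal.rpow_mul, ← eLpNorm_two_eq_ofReal hf2]
    norm_num
  rw [e2, ← ENNReal.ofReal_mul hD0] at key
  rw [e1]
  have hHi : Integrable H μ.fst := by
    refine ⟨hHm.aestronglyMeasurable, ?_⟩
    rw [hasFiniteIntegral_iff_norm]
    exact key.trans_lt ENNReal.ofReal_lt_top
  have key2 : ∫ s, |H s| ∂μ.fst ≤ D * √(∫ p, f p ^ 2 ∂μ) := by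
    rw [← ofReal_integral_eq_lintegral_ofReal hHi.abs (ae_of_all _ fun s => abs_nonneg _)] at key
    exact (ENNReal.ofReal_le_ofReal_iff (by positivity)).1 key
  rw [← Real.norm_eq_abs]
  refine (norm_integral_le_of_norm_le (hHi.abs.const_mul L) (ae_of_all _ fun s => ?_)).trans ?_
  · rw [norm_mul, mul_comm]
    exact mul_le_mul_of_nonneg_right (hL s) (norm_nonneg _)
  · rw [integral_const_mul]
    exact mul_le_mul_of_nonneg_left key2 hL0

/-- The factor `g` is moved inside the perturbation at the cost of its oscillation `w` over the
range of the kernel. What remains is the estimate for `f * g` and a test function of `s` alone. -/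
theorem abs_integral_pertSec_sub_le (hac : ∀ᵐ s ∂μ.fst, μ.condKernel s ≪ volume)
    (hκ : IsCut κ) (hC : PertBound μ r κ C) (hD0 : 0 ≤ D)
    (hD : eLpNorm (fun s => deltaRes r (fun x => κ (s, x)) (μ.condKernel s)) 2 μ.fst
      ≤ ENNReal.ofReal D) (hr : 0 < r) (hφ : IsPrimal φ) (hη : IsPrimal η) (hf : BddSec f)
    (hf2 : MemLp f 2 μ) {F : S → ℝ} {L : ℝ} (hF : Measurable F) (hL : ∀ s, |F s| ≤ L)
    (hL0 : 0 ≤ L) {g : (Fin d → ℝ) → ℝ} {G w : ℝ} (hg : Measurable g) (hG : ∀ x, |g x| ≤ G)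
    (hG0 : 0 ≤ G) (hw : ∀ x y, dist y x ≤ 4 * r → |g y - g x| ≤ w) :
    |∫ p, (pertSec r φ η f p - f p) * (F p.1 * g p.2) ∂cutMeasure μ κ|
      ≤ L * ((D * G + w * C) * √(∫ p, f p ^ 2 ∂μ)) := by
  have hfin := isFiniteMeasure_cutMeasure μ hκ
  have hgb : BddMeas g := ⟨hg, G, hG⟩
  have hfg := hf.mul_snd hgb
  have hgsq : ∀ x, g x ^ 2 ≤ G ^ 2 := fun x => sq_le_sq' (abs_le.1 (hG x)).1 (abs_le.1 (hG x)).2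
  have hw0 : 0 ≤ w := (abs_nonneg _).trans (hw 0 0 (by simp; positivity))
  have hfg2 : MemLp (fun p => f p * g p.2) 2 μ := by
    have h0 : BddMeas fun p : S × (Fin d → ℝ) => g p.2 := ⟨hg.comp measurable_snd, G, fun p => hG _⟩
    rw [memLp_two_iff_integrable_sq hfg.1.aestronglyMeasurable]
    simp only [mul_pow]
    refine (hf2.integrable_sq.mul_const (G ^ 2)).mono'
      ((hf.1.pow_const 2).mul (h0.1.pow_const 2)).aestronglyMeasurable (ae_of_all _ fun p => ?_)
    rw [Real.norm_of_nonneg (by positivity)]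
    exact mul_le_mul_of_nonneg_left (hgsq _) (sq_nonneg _)
  have hfg3 : √(∫ p, (f p * g p.2) ^ 2 ∂μ) ≤ G * √(∫ p, f p ^ 2 ∂μ) := by
    rw [Real.sqrt_le_left (by positivity), mul_pow, Real.sq_sqrt (integral_nonneg fun p => sq_nonneg _),
      ← integral_const_mul]
    refine integral_mono hfg2.integrable_sq (hf2.integrable_sq.const_mul _) fun p => ?_
    simp only
    rw [mul_pow, mul_comm]
    exact mul_le_mul_of_nonneg_right (hgsq _) (sq_nonneg _)
  have hF2 : BddMeas fun p : S × (Fin d → ℝ) => F p.1 := ⟨hF.comp measurable_fst, L, fun p => hL _⟩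
  have hg2 : BddMeas fun p : S × (Fin d → ℝ) => g p.2 := ⟨hg.comp measurable_snd, G, fun p => hG _⟩
  have hP := (memLp_pertSec hac hκ hC hr hφ hη hf hf2).1
  have hPg := (memLp_pertSec hac hκ hC hr hφ hη hfg hfg2).1
  have hFm := hF2.memLp (cutMeasure μ κ) 2
  have i1 : Integrable (fun p => pertSec r φ η f p * (F p.1 * g p.2)) (cutMeasure μ κ) :=
    integrable_mul_of_memLp hP ((hF2.mul hg2).memLp _ 2)
  have i2 : Integrable (fun p => pertSec r φ η (fun p => f p * g p.2) p * F p.1) (cutMeasure μ κ) :=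
    integrable_mul_of_memLp hPg hFm
  have i3 : Integrable (fun p => (pertSec r φ η (fun p => f p * g p.2) p - f p * g p.2) * F p.1)
      (cutMeasure μ κ) :=
    integrable_mul_of_memLp (hPg.sub (memLp_cutMeasure hκ hfg2)) hFm
  have hsplit : ∫ p, (pertSec r φ η f p - f p) * (F p.1 * g p.2) ∂cutMeasure μ κ
      = (∫ p, (pertSec r φ η f p * (F p.1 * g p.2)
          - pertSec r φ η (fun p => f p * g p.2) p * F p.1) ∂cutMeasure μ κ)
        + ∫ p, (pertSec r φ η (fun p => f p * g p.2) p - f p * g p.2) * F p.1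
            ∂cutMeasure μ κ := by
    rw [← integral_add (i1.sub' i2) i3]
    refine integral_congr_ae (ae_of_all _ fun p => ?_)
    simp only
    ring
  have b2 := abs_integral_pertSec_sub_le_fst hac hκ hC hD0 hD hr hφ hη hfg hfg2 hF hL hL0
  have hfi : Integrable (fun p => |f p|) μ := (hf2.integrable (by norm_num)).abs
  obtain ⟨hai, hale⟩ := integrable_pertSec hac hκ hC hr hφ hη hf.abs (fun p => abs_nonneg _) hfi
  have hf1 : ∫ p, |f p| ∂μ ≤ √(∫ p, f p ^ 2 ∂μ) := by
    have := abs_integral_mul_le hf2.abs (memLp_const (1 : ℝ))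
    simp only [Pi.abs_apply, mul_one, sq_abs, one_pow, integral_const, probReal_univ, smul_eq_mul,
      Real.sqrt_one] at this
    exact (le_abs_self _).trans this
  have b1 : |∫ p, (pertSec r φ η f p * (F p.1 * g p.2)
          - pertSec r φ η (fun p => f p * g p.2) p * F p.1) ∂cutMeasure μ κ|
      ≤ L * (w * (C * √(∫ p, f p ^ 2 ∂μ))) := by
    rw [← Real.norm_eq_abs]
    refine (norm_integral_le_of_norm_le ((hai.const_mul w).const_mul L)
      (ae_of_all _ fun p => ?_)).trans ?_
    · have e : pertSec r φ η f p * (F p.1 * g p.2) - pertSec r φ η (fun p => f p * g p.2) p * F p.1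
          = F p.1 * (pertSec r φ η f p * g p.2 - pertSec r φ η (fun p => f p * g p.2) p) := by ring
      rw [e, norm_mul]
      exact mul_le_mul (hL _) (abs_mul_perturbation_sub_le hr hφ hη (hf.bddMeas p.1) hgb hw p.2)
        (norm_nonneg _) hL0
    · rw [integral_const_mul, integral_const_mul]
      have := mul_le_mul_of_nonneg_left hf1 hC.1
      gcongr
      exact hale.trans this
  rw [hsplit]
  have b3 := mul_le_mul_of_nonneg_left (mul_le_mul_of_nonneg_left hfg3 hD0) hL0
  calc _ ≤ _ := abs_add_le _ _
    _ ≤ L * (w * (C * √(∫ p, f p ^ 2 ∂μ))) + L * (D * (G * √(∫ p, f p ^ 2 ∂μ))) :=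
      add_le_add b1 (b2.trans b3)
    _ = _ := by ring

end Estimates

/-! ### Truncated expansions -/

section Truncation

variable {d : ℕ} {S : Type*} {r : ℝ} {φ η θ : (Fin d → ℝ) → ℝ}

/-- The lattice points of a cube. -/
def box (d k : ℕ) : Finset (Fin d → ℤ) := Fintype.piFinset fun _ => Finset.Icc (-(k : ℤ)) k

theorem eventually_near_subset_box (hr : 0 < r) {g : (Fin d → ℝ) → ℝ} (hc : HasCompactSupport g) :
    ∀ᶠ k in atTop, ∀ x, g x ≠ 0 → near r x ⊆ box d k := by
  obtain ⟨R, hR⟩ := hc.isCompact.isBounded.exists_norm_le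
  -- Points of `near r x` differ from `x / r` by at most `4` in each coordinate: three from the
  -- offset and one from the floor.
  obtain ⟨k₀, hk₀⟩ := exists_nat_ge (R / r + 4)
  filter_upwards [eventually_ge_atTop k₀] with k hk x hx a ha
  have hxR := hR x (subset_tsupport g hx)
  have hk' : R / r + 4 ≤ (k : ℝ) := hk₀.trans (Nat.cast_le.2 hk)
  rw [box, Fintype.mem_piFinset]
  intro i
  have ha' := Fintype.mem_piFinset.1 ha i
  simp only [Finset.mem_map, Finset.mem_range] at ha'
  obtain ⟨j, hj, hja⟩ := ha'
  replace hja : ⌊x i / r⌋ - 3 + (j : ℤ) = a i := hja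
  have hxi : |x i| ≤ R := (norm_le_pi_norm x i).trans hxR
  have hxr : |x i / r| ≤ R / r := by
    rw [abs_div, abs_of_pos hr]
    gcongr
  have hxr' := abs_le.1 hxr
  have f1 := Int.floor_le (x i / r)
  have f2 := Int.lt_floor_add_one (x i / r)
  have hj' : (j : ℝ) ≤ 6 := by exact_mod_cast Nat.lt_succ_iff.1 hj
  have hj0 : (0 : ℝ) ≤ j := Nat.cast_nonneg j
  have hcast : (a i : ℝ) = ⌊x i / r⌋ - 3 + j := by rw [← hja]; push_cast; ring
  rw [Finset.mem_Icc]
  constructor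
  · have : -(k : ℝ) ≤ a i := by rw [hcast]; linarith
    exact_mod_cast this
  · have : (a i : ℝ) ≤ k := by rw [hcast]; linarith
    exact_mod_cast this

/-- Truncation at height `k`. -/
def clamp (k t : ℝ) : ℝ := max (-k) (min k t)

theorem abs_clamp_le {k : ℝ} (hk : 0 ≤ k) (t : ℝ) : |clamp k t| ≤ k :=
  abs_le.2 ⟨le_max_left _ _, max_le (by linarith) (min_le_left _ _)⟩

theorem abs_clamp_le_abs {k : ℝ} (hk : 0 ≤ k) (t : ℝ) : |clamp k t| ≤ |t| := by
  unfold clamp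
  rcases le_total k t with h | h
  · rw [min_eq_left h, max_eq_right (by linarith), abs_of_nonneg hk]
    exact h.trans (le_abs_self t)
  · rw [min_eq_right h]
    rcases le_total (-k) t with h' | h'
    · rw [max_eq_right h']
    · rw [max_eq_left h', abs_neg, abs_of_nonneg hk]
      exact (by linarith : k ≤ -t).trans (neg_le_abs t)

/-- The truncation error is paid for by the second moment with a factor `k⁻¹`, so an `L²` bound
makes it vanish uniformly in `N` in the `L¹` sense. -/
theorem abs_clamp_sub_le {k : ℝ} (hk : 0 < k) (t : ℝ) : |clamp k t - t| ≤ k⁻¹ * t ^ 2 := by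
  have key : ∀ τ : ℝ, k ≤ τ → τ - k ≤ k⁻¹ * τ ^ 2 := by
    intro τ h
    rw [inv_mul_eq_div, le_div_iff₀ hk]
    nlinarith
  unfold clamp
  rcases le_total k t with h | h
  · rw [min_eq_left h, max_eq_right (by linarith), abs_sub_comm, abs_of_nonneg (by linarith)]
    exact key t h
  · rw [min_eq_right h]
    rcases le_total (-k) t with h' | h'
    · rw [max_eq_right h', sub_self, abs_zero]
      positivity
    · rw [max_eq_left h', abs_of_nonneg (by linarith)]
      have := key (-t) (by linarith)
      rw [neg_sq] at this
      linarith

theorem sum_rescale_le_one (hr : r ≠ 0) (hφ : IsPrimal φ) (A : Finset (Fin d → ℤ))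
    (x : Fin d → ℝ) : ∑ a ∈ A, rescale φ r a x ≤ 1 := by
  classical
  rw [← sum_rescale hr hφ x]
  calc ∑ a ∈ A, rescale φ r a x ≤ ∑ a ∈ A ∪ near r x, rescale φ r a x :=
        Finset.sum_le_sum_of_subset_of_nonneg Finset.subset_union_left
          fun a _ _ => rescale_nonneg hφ a x
    _ = ∑ a ∈ near r x, rescale φ r a x :=
        (Finset.sum_subset Finset.subset_union_right
          fun a _ ha => rescale_eq_zero hr hφ ha).symm

/-- A finite expansion with truncated coefficients. -/
def truncSum (r : ℝ) (φ : (Fin d → ℝ) → ℝ) (h : (Fin d → ℤ) → (Fin d → ℝ) → ℝ)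
    (u : S × (Fin d → ℝ) → ℝ) (k : ℕ) (p : S × (Fin d → ℝ)) : ℝ :=
  ∑ a ∈ box d k, clamp k (coef r φ (fun x => u (p.1, x)) a) * h a p.2

variable {h : (Fin d → ℤ) → (Fin d → ℝ) → ℝ} {A : ℝ} [MeasurableSpace S]
  {u : S × (Fin d → ℝ) → ℝ}

/-- Cauchy–Schwarz with the weights `rescale θ r a`, whose sum is at most one, followed by Jensen
for the coefficients. The bound is independent of the truncation level. -/
theorem sq_truncSum_le (hr : 0 < r) (hφ : IsPrimal φ) (hθ : IsPrimal θ)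
    (hh : ∀ a x, |h a x| ≤ A * rescale θ r a x) (hu : BddMeas u) (k : ℕ)
    (p : S × (Fin d → ℝ)) :
    truncSum r φ h u k p ^ 2 ≤ A ^ 2 * pertSec r θ φ (fun p => u p ^ 2) p := by
  set c : (Fin d → ℤ) → ℝ := fun a => coef r φ (fun x => u (p.1, x)) a
  have h1 : |truncSum r φ h u k p| ≤ |A| * ∑ a ∈ box d k, |c a| * rescale θ r a p.2 := by
    unfold truncSum
    refine (Finset.abs_sum_le_sum_abs _ _).trans ?_
    rw [Finset.mul_sum]
    refine Finset.sum_le_sum fun a _ => ?_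
    rw [abs_mul]
    have h0 := rescale_nonneg (r := r) hθ a p.2
    calc _ ≤ |c a| * (|A| * rescale θ r a p.2) :=
          mul_le_mul (abs_clamp_le_abs (Nat.cast_nonneg k) _)
            ((hh a p.2).trans (mul_le_mul_of_nonneg_right (le_abs_self A) h0)) (abs_nonneg _)
            (abs_nonneg _)
      _ = _ := by ring
  have h2 : (∑ a ∈ box d k, |c a| * rescale θ r a p.2) ^ 2
      ≤ (∑ a ∈ box d k, c a ^ 2 * rescale θ r a p.2) * ∑ a ∈ box d k, rescale θ r a p.2 :=
    Finset.sum_sq_le_sum_mul_sum_of_sq_le_mul _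
      (fun a _ => mul_nonneg (sq_nonneg _) (rescale_nonneg hθ a p.2))
      (fun a _ => rescale_nonneg hθ a p.2) fun a _ => le_of_eq (by rw [mul_pow, sq_abs]; ring)
  have h3 := sum_sq_coef_mul_le hr hθ hφ (bddMeas_section hu p.1) (box d k) p.2
  have h4 := sum_rescale_le_one hr.ne' hθ (box d k) p.2
  have h5 : 0 ≤ ∑ a ∈ box d k, c a ^ 2 * rescale θ r a p.2 :=
    Finset.sum_nonneg fun a _ => mul_nonneg (sq_nonneg _) (rescale_nonneg hθ a p.2)
  rw [← sq_abs]
  calc _ ≤ (|A| * ∑ a ∈ box d k, |c a| * rescale θ r a p.2) ^ 2 :=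
        pow_le_pow_left₀ (abs_nonneg _) h1 2
    _ = A ^ 2 * (∑ a ∈ box d k, |c a| * rescale θ r a p.2) ^ 2 := by rw [mul_pow, sq_abs]
    _ ≤ A ^ 2 * pertSec r θ φ (fun p => u p ^ 2) p := by
        refine mul_le_mul_of_nonneg_left (h2.trans ?_) (sq_nonneg _)
        exact (mul_le_of_le_one_right h5 h4).trans h3

theorem abs_truncSum_sub_le (hr : 0 < r) (hφ : IsPrimal φ) (hθ : IsPrimal θ) (hA : 0 ≤ A)
    (hh : ∀ a x, |h a x| ≤ A * rescale θ r a x) (hu : BddMeas u) {k : ℕ} (hk : 0 < k)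
    {p : S × (Fin d → ℝ)} (hp : near r p.2 ⊆ box d k) :
    |truncSum r φ h u k p - ∑ a ∈ near r p.2, coef r φ (fun x => u (p.1, x)) a * h a p.2|
      ≤ (k : ℝ)⁻¹ * A * pertSec r θ φ (fun p => u p ^ 2) p := by
  set c : (Fin d → ℤ) → ℝ := fun a => coef r φ (fun x => u (p.1, x)) a
  have hz : ∀ a, a ∉ near r p.2 → h a p.2 = 0 := fun a ha => by
    have := hh a p.2
    rw [rescale_eq_zero hr.ne' hθ ha, mul_zero] at this
    exact abs_eq_zero.1 (le_antisymm this (abs_nonneg _))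
  have e : truncSum r φ h u k p = ∑ a ∈ near r p.2, clamp k (c a) * h a p.2 :=
    (Finset.sum_subset hp fun a _ ha => by rw [hz a ha, mul_zero]).symm
  rw [e, ← Finset.sum_sub_distrib]
  have h3 := sum_sq_coef_mul_le hr hθ hφ (bddMeas_section hu p.1) (near r p.2) p.2
  refine (Finset.abs_sum_le_sum_abs _ _).trans ?_
  calc _ ≤ ∑ a ∈ near r p.2, (k : ℝ)⁻¹ * A * (c a ^ 2 * rescale θ r a p.2) := by
        refine Finset.sum_le_sum fun a _ => ?_
        rw [← sub_mul, abs_mul]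
        calc _ ≤ ((k : ℝ)⁻¹ * c a ^ 2) * (A * rescale θ r a p.2) :=
              mul_le_mul (abs_clamp_sub_le (Nat.cast_pos.2 hk) _) (hh a p.2) (abs_nonneg _)
                (by positivity)
          _ = _ := by ring
    _ = (k : ℝ)⁻¹ * A * ∑ a ∈ near r p.2, c a ^ 2 * rescale θ r a p.2 := by
        rw [Finset.mul_sum]
    _ ≤ _ := mul_le_mul_of_nonneg_left h3 (by positivity)

theorem measurable_coef (hφ : IsPrimal φ) (hu : Measurable u) (a : Fin d → ℤ) :
    Measurable fun s => coef r φ (fun x => u (s, x)) a := by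
  unfold coef
  refine Measurable.const_mul ?_ _
  have hm : Measurable fun p : S × (Fin d → ℝ) => rescale φ r a p.2 * u p :=
    ((measurable_rescale hφ a).comp measurable_snd).mul hu
  exact (hm.stronglyMeasurable.integral_prod_right' (ν := volume)).measurable

theorem measurable_clamp (k : ℝ) : Measurable (clamp k) :=
  measurable_const.max (measurable_const.min measurable_id)

theorem bddMeas_clamp_coef (hφ : IsPrimal φ) (hu : Measurable u) (k : ℕ) (a : Fin d → ℤ) :
    BddMeas fun s => clamp k (coef r φ (fun x => u (s, x)) a) :=
  ⟨(measurable_clamp k).comp (measurable_coef hφ hu a), k, fun _ =>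
    abs_clamp_le (Nat.cast_nonneg k) _⟩

theorem measurable_truncSum (hφ : IsPrimal φ) (hh : ∀ a, Measurable (h a)) (hu : Measurable u)
    (k : ℕ) : Measurable (truncSum r φ h u k) :=
  Finset.measurable_sum _ fun a _ =>
    ((bddMeas_clamp_coef hφ hu k a).1.comp measurable_fst).mul ((hh a).comp measurable_snd)

variable {μ : Measure (S × (Fin d → ℝ))} [IsProbabilityMeasure μ] {κ : S × (Fin d → ℝ) → ℝ} {C : ℝ}

theorem memLp_truncSum (hac : ∀ᵐ s ∂μ.fst, μ.condKernel s ≪ volume) (hκ : IsCut κ)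
    (hC : PertBound μ r κ C) (hr : 0 < r) (hφ : IsPrimal φ) (hθ : IsPrimal θ)
    (hhm : ∀ a, Measurable (h a)) (hh : ∀ a x, |h a x| ≤ A * rescale θ r a x) (hu : BddMeas u)
    (k : ℕ) :
    MemLp (truncSum r φ h u k) 2 (cutMeasure μ κ) ∧
      ∫ p, truncSum r φ h u k p ^ 2 ∂cutMeasure μ κ ≤ A ^ 2 * (C * ∫ p, u p ^ 2 ∂μ) := by
  obtain ⟨hi, hle⟩ := integrable_pertSec hac hκ hC hr hθ hφ hu.sq.bddSec (fun p => sq_nonneg _)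
    (hu.sq.integrable μ)
  have hm := measurable_truncSum (r := r) hφ hhm hu.1 k
  have hpt := sq_truncSum_le hr hφ hθ hh hu k
  have hi2 : Integrable (fun p => truncSum r φ h u k p ^ 2) (cutMeasure μ κ) :=
    (hi.const_mul (A ^ 2)).mono' (hm.pow_const 2).aestronglyMeasurable (ae_of_all _ fun p => by
      rw [Real.norm_of_nonneg (sq_nonneg _)]; exact hpt p)
  refine ⟨(memLp_two_iff_integrable_sq hm.aestronglyMeasurable).2 hi2,
    (integral_mono hi2 (hi.const_mul (A ^ 2)) hpt).trans ?_⟩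
  rw [integral_const_mul]
  exact mul_le_mul_of_nonneg_left hle (sq_nonneg _)

/-- On the support of the test function the box contains every active lattice point. The only error
is the clamping of the coefficients, bounded by the perturbation of `u ^ 2`. -/
theorem abs_integral_truncSum_sub_le (hac : ∀ᵐ s ∂μ.fst, μ.condKernel s ≪ volume) (hκ : IsCut κ)
    (hC : PertBound μ r κ C) (hr : 0 < r) (hφ : IsPrimal φ) (hθ : IsPrimal θ) (hA : 0 ≤ A)
    (hh : ∀ a x, |h a x| ≤ A * rescale θ r a x) (hu : BddMeas u) {k : ℕ} (hk : 0 < k)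
    {Y : S × (Fin d → ℝ) → ℝ}
    (hY : ∀ p, Y p = ∑ a ∈ near r p.2, coef r φ (fun x => u (p.1, x)) a * h a p.2)
    {ψ : S × (Fin d → ℝ) → ℝ} {M : ℝ} (hM0 : 0 ≤ M) (hM : ∀ p, |ψ p| ≤ M)
    (hψ : ∀ p, ψ p ≠ 0 → near r p.2 ⊆ box d k) :
    |∫ p, (truncSum r φ h u k p - Y p) * ψ p ∂cutMeasure μ κ|
      ≤ (k : ℝ)⁻¹ * (A * M * (C * ∫ p, u p ^ 2 ∂μ)) := by
  obtain ⟨hi, hle⟩ := integrable_pertSec hac hκ hC hr hθ hφ hu.sq.bddSec (fun p => sq_nonneg _)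
    (hu.sq.integrable μ)
  rw [← Real.norm_eq_abs]
  refine (norm_integral_le_of_norm_le (hi.const_mul ((k : ℝ)⁻¹ * A * M))
    (ae_of_all _ fun p => ?_)).trans ?_
  · have h0 : 0 ≤ pertSec r θ φ (fun p => u p ^ 2) p :=
      perturbation_nonneg hr hθ hφ (fun x => sq_nonneg _) p.2
    by_cases hp : ψ p = 0
    · rw [hp, mul_zero, norm_zero]
      positivity
    · rw [norm_mul, hY]
      calc _ ≤ ((k : ℝ)⁻¹ * A * pertSec r θ φ (fun p => u p ^ 2) p) * M :=
            mul_le_mul (abs_truncSum_sub_le hr hφ hθ hA hh hu hk (hψ p hp)) (hM p) (abs_nonneg _)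
              (by positivity)
        _ = _ := by ring
  · rw [integral_const_mul]
    calc _ ≤ (k : ℝ)⁻¹ * A * M * (C * ∫ p, u p ^ 2 ∂μ) :=
          mul_le_mul_of_nonneg_left hle (by positivity)
      _ = _ := by ring

end Truncation

/-! ### The gradient of the expansion -/

section ExpansionGradient

variable {d : ℕ} {r : ℝ}

theorem contDiff_rescale {n : WithTop ℕ∞} {φ : (Fin d → ℝ) → ℝ} (hφ : ContDiff ℝ n φ)
    (a : Fin d → ℤ) : ContDiff ℝ n (rescale φ r a) :=
  hφ.comp (contDiff_pi.2 fun i => ((contDiff_apply ℝ ℝ i).sub contDiff_const).div_const _)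

theorem hasCompactSupport_rescale {φ : (Fin d → ℝ) → ℝ} (hr : 0 < r) (hφ : IsPrimal φ)
    (a : Fin d → ℤ) : HasCompactSupport (rescale φ r a) := by
  refine HasCompactSupport.intro (isCompact_Icc (a := fun i => r * a i - 2 * r)
    (b := fun i => r * a i + 2 * r)) fun x hx => hφ.eq_zero _ fun hx' => hx ⟨fun i => ?_, fun i => ?_⟩
  · have := hx'.1 i
    simp only at this ⊢
    rw [le_div_iff₀ hr] at this
    linarith
  · have := hx'.2 i
    simp only at this ⊢
    rw [div_le_iff₀ hr] at this
    linarith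

/-- Integration by parts against `primalBaseAvg`, whose derivative is a difference of two
neighbouring `primalBase` functions. -/
theorem coef_primalBaseAvg (hr : 0 < r) (i : Fin d) {f v : (Fin d → ℝ) → ℝ} (hf : BddMeas f)
    (h : IsWeakPartial i f v) (a : Fin d → ℤ) :
    coef r (primalBaseAvg i) v a
      = r⁻¹ * (coef r (primalBase d) f (a + Pi.single i 1) - coef r (primalBase d) f a) := by
  have h1 := h (rescale (primalBaseAvg i) r a) (contDiff_rescale (contDiff_primalBaseAvg i) a)
    (hasCompactSupport_rescale hr (isPrimal_primalBaseAvg i) a)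
  have i1 := fun b => integrable_rescale_mul hr (isPrimal_primalBase (d := d)) b hf
  have h2 : ∫ x, f x * fderiv ℝ (rescale (primalBaseAvg i) r a) x (Pi.single i 1)
      = r⁻¹ * ((∫ x, rescale (primalBase d) r a x * f x)
        - ∫ x, rescale (primalBase d) r (a + Pi.single i 1) x * f x) := by
    rw [← integral_sub (i1 _) (i1 _), ← integral_const_mul]
    refine integral_congr_ae (ae_of_all _ fun x => ?_)
    simp only [fderiv_primalBaseAvg i hr.ne']
    ring
  have h3 : ∫ x, rescale (primalBaseAvg i) r a x * v x
      = ∫ x, v x * rescale (primalBaseAvg i) r a x := by simp only [mul_comm]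
  unfold coef
  rw [h3, ← neg_eq_iff_eq_neg.2 h1, h2]
  ring

/-- Differentiation commutes with the expansion up to a change of primal functions: a summation by
parts over the lattice moves the difference from the basis functions to the coefficients. -/
theorem sum_coef_mul_fderiv (hr : 0 < r) (i : Fin d) {f v : (Fin d → ℝ) → ℝ} (hf : BddMeas f)
    (h : IsWeakPartial i f v) (y : Fin d → ℝ) :
    perturbation r (primalSmoothDiff i) (primalBaseAvg i) v y
      = ∑ a ∈ near r y, coef r (primalBase d) f a
          * fderiv ℝ (rescale (primalSmooth d) r a) y (Pi.single i 1) := by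
  set c := coef r (primalBase d) f
  have hD := isPrimal_primalSmoothDiff i
  have hS := isPrimal_primalSmoothDiffShift i
  -- The index shift is made in the sum over the whole lattice, since the finite set `near r y` is
  -- not invariant.
  have hshift : ∑ a ∈ near r y, c a * rescale (primalSmoothDiffShift i) r a y
      = ∑ a ∈ near r y, c (a + Pi.single i 1) * rescale (primalSmoothDiff i) r a y := by
    rw [← tsum_rescale_mul hr.ne' hS, ← tsum_rescale_mul hr.ne' hD,
      ← (Equiv.addRight (Pi.single i 1 : Fin d → ℤ)).tsum_eq]
    simp only [Equiv.coe_addRight, rescale_primalSmoothDiffShift i hr.ne']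
  rw [perturbation_eq_sum hr.ne' hD]
  simp only [fderiv_primalSmooth, coef_primalBaseAvg hr i hf h]
  have e1 : ∑ a ∈ near r y, c a * (r⁻¹ * (rescale (primalSmoothDiffShift i) r a y
        - rescale (primalSmoothDiff i) r a y))
      = r⁻¹ * (∑ a ∈ near r y, c a * rescale (primalSmoothDiffShift i) r a y
        - ∑ a ∈ near r y, c a * rescale (primalSmoothDiff i) r a y) := by
    rw [← Finset.sum_sub_distrib, Finset.mul_sum]
    exact Finset.sum_congr rfl fun a _ => by ring
  rw [e1, hshift, ← Finset.sum_sub_distrib, Finset.mul_sum]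
  exact Finset.sum_congr rfl fun a _ => by ring

/-- The primal function dominating the partial derivative of `primalSmooth`. -/
def primalGradBound (i : Fin d) (x : Fin d → ℝ) : ℝ :=
  (primalSmoothDiffShift i x + primalSmoothDiff i x) / 2

theorem isPrimal_primalGradBound (i : Fin d) : IsPrimal (primalGradBound i) :=
  (isPrimal_primalSmoothDiffShift i).half_add (isPrimal_primalSmoothDiff i)

theorem abs_fderiv_primalSmooth_le (hr : 0 < r) (i : Fin d) (a : Fin d → ℤ) (x : Fin d → ℝ) :
    |fderiv ℝ (rescale (primalSmooth d) r a) x (Pi.single i 1)|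
      ≤ 2 / r * rescale (primalGradBound i) r a x := by
  have h1 := rescale_nonneg (r := r) (isPrimal_primalSmoothDiffShift i) a x
  have h2 := rescale_nonneg (r := r) (isPrimal_primalSmoothDiff i) a x
  have e : 2 / r * rescale (primalGradBound i) r a x
      = r⁻¹ * (rescale (primalSmoothDiffShift i) r a x + rescale (primalSmoothDiff i) r a x) := by
    unfold rescale primalGradBound
    ring
  rw [e, fderiv_primalSmooth, abs_mul, abs_of_pos (inv_pos.2 hr)]
  refine mul_le_mul_of_nonneg_left ?_ (inv_pos.2 hr).le
  rw [abs_le]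
  constructor <;> linarith

end ExpansionGradient

/-! ### Passage to the limit -/

section FiniteExpansions

variable {d : ℕ} {S : Type*}

/-- A finite expansion with coefficients depending on the first variable. -/
def coefSum (k : ℕ) (b : (Fin d → ℤ) → S → ℝ) (h : (Fin d → ℤ) → (Fin d → ℝ) → ℝ)
    (p : S × (Fin d → ℝ)) : ℝ :=
  ∑ a ∈ box d k, b a p.1 * h a p.2

variable [MeasurableSpace S] {μ₀ : Measure (S × (Fin d → ℝ))}
  {h : (Fin d → ℤ) → (Fin d → ℝ) → ℝ}

theorem memLp_coef_mul {m : Measure (S × (Fin d → ℝ))} (hm : m ≤ μ₀) {b : S → ℝ}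
    (hb : MemLp b 2 μ₀.fst) {g : (Fin d → ℝ) → ℝ} (hg : BddMeas g) :
    MemLp (fun p : S × (Fin d → ℝ) => b p.1 * g p.2) 2 m := by
  obtain ⟨M, hM⟩ := hg.2
  have h1 : MemLp (fun p : S × (Fin d → ℝ) => M * b p.1) 2 m :=
    ((memLp_fst hb).mono_measure hm).const_mul M
  refine h1.mono (((memLp_fst hb).mono_measure hm).1.mul
    (hg.1.comp measurable_snd).aestronglyMeasurable) (ae_of_all _ fun p => ?_)
  rw [norm_mul, norm_mul, mul_comm]
  exact mul_le_mul_of_nonneg_right ((hM _).trans (le_abs_self M)) (norm_nonneg _)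

theorem memLp_coefSum {m : Measure (S × (Fin d → ℝ))} (hm : m ≤ μ₀) {b : (Fin d → ℤ) → S → ℝ}
    (hb : ∀ a, MemLp (b a) 2 μ₀.fst) (hh : ∀ a, BddMeas (h a)) (k : ℕ) :
    MemLp (coefSum k b h) 2 m :=
  memLp_finsetSum _ fun a _ => memLp_coef_mul hm (hb a) (hh a)

end FiniteExpansions

/-! ### Weak limits in the measure, the truncation level and the scale -/

section Limits

variable {d : ℕ} {S : Type*} [TopologicalSpace S]

/-- The test function `f(s) g(x)` as a bounded continuous function. -/
def tensorBcf (f : S →ᵇ ℝ) {g : (Fin d → ℝ) → ℝ} (hg : Continuous g) (hc : HasCompactSupport g) :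
    (S × (Fin d → ℝ)) →ᵇ ℝ :=
  f.compContinuous ⟨Prod.fst, continuous_fst⟩ *
    BoundedContinuousFunction.ofNormedAddCommGroup (fun p : S × (Fin d → ℝ) => g p.2)
      (hg.comp continuous_snd) (hc.exists_bound_of_continuous hg).choose
      fun p => (hc.exists_bound_of_continuous hg).choose_spec p.2

theorem tensorBcf_apply (f : S →ᵇ ℝ) {g : (Fin d → ℝ) → ℝ} (hg : Continuous g)
    (hc : HasCompactSupport g) (p : S × (Fin d → ℝ)) : tensorBcf f hg hc p = f p.1 * g p.2 :=
  rfl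

/-- Continuous cut-off functions as bounded continuous functions. -/
def cutBcf {κ : S × (Fin d → ℝ) → ℝ} (hκc : Continuous κ) (hκ : ∀ p, κ p ∈ Icc (0 : ℝ) 1) :
    (S × (Fin d → ℝ)) →ᵇ ℝ :=
  BoundedContinuousFunction.ofNormedAddCommGroup κ hκc 1 fun p => by
    rw [Real.norm_of_nonneg (hκ p).1]; exact (hκ p).2

variable [MeasurableSpace S] {μ : ℕ → Measure (S × (Fin d → ℝ))} {μ₀ : Measure (S × (Fin d → ℝ))}
  {𝒰 : Ultrafilter ℕ} {κ : S × (Fin d → ℝ) → ℝ}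

/-- A continuous cut-off is absorbed into the test function. -/
theorem tendsto_integral_cutMeasure
    (hκ : IsCut κ) (hκc : Continuous κ) {f : ℕ → S × (Fin d → ℝ) → ℝ} {f₀ : S × (Fin d → ℝ) → ℝ}
    (h : ∀ ψ : (S × (Fin d → ℝ)) →ᵇ ℝ,
      Tendsto (fun N => ∫ p, f N p * ψ p ∂μ N) 𝒰 (𝓝 (∫ p, f₀ p * ψ p ∂μ₀)))
    (ψ : (S × (Fin d → ℝ)) →ᵇ ℝ) :
    Tendsto (fun N => ∫ p, f N p * ψ p ∂cutMeasure (μ N) κ) 𝒰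
      (𝓝 (∫ p, f₀ p * ψ p ∂cutMeasure μ₀ κ)) := by
  simp only [integral_cutMeasure _ hκ, mul_assoc]
  exact h (ψ * cutBcf hκc hκ.2)

variable [BorelSpace S]

theorem tendsto_integral_fst
    (hm : ∀ ψ : (S × (Fin d → ℝ)) →ᵇ ℝ,
      Tendsto (fun N => ∫ p, ψ p ∂μ N) 𝒰 (𝓝 (∫ p, ψ p ∂μ₀))) (ψ : S →ᵇ ℝ) :
    Tendsto (fun N => ∫ s, ψ s ∂(μ N).fst) 𝒰 (𝓝 (∫ s, ψ s ∂μ₀.fst)) := by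
  have e : ∀ ρ : Measure (S × (Fin d → ℝ)), ∫ s, ψ s ∂ρ.fst = ∫ p, ψ p.1 ∂ρ := fun ρ => by
    rw [Measure.fst, integral_map measurable_fst.aemeasurable ψ.continuous.aestronglyMeasurable]
  simp only [e]
  exact hm (ψ.compContinuous ⟨Prod.fst, continuous_fst⟩)

variable [∀ N, IsProbabilityMeasure (μ N)] {r A B C : ℝ} {φ θ : (Fin d → ℝ) → ℝ} {h : (Fin d → ℤ) → (Fin d → ℝ) → ℝ}

/-- The difference between a function and its expansion is small when tested, uniformly in `N`. The
estimate survives the limit in `N` at each fixed scale, after which the scale tends to zero. -/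
theorem tendsto_perturbation_limit
    (hac : ∀ N, ∀ᵐ s ∂(μ N).fst, (μ N).condKernel s ≪ volume)
    (hκ : IsCut κ) (hκc : Continuous κ) {ρ D : ℕ → ℝ} (hρ : ∀ j, 0 < ρ j)
    (hρ0 : Tendsto ρ atTop (𝓝 0)) (hC : ∀ j N, PertBound (μ N) (ρ j) κ C) (hD0 : ∀ j, 0 ≤ D j)
    (hDlim : Tendsto D atTop (𝓝 0))
    (hD : ∀ j N, eLpNorm (fun s => deltaRes (ρ j) (fun x => κ (s, x)) ((μ N).condKernel s)) 2
      (μ N).fst ≤ ENNReal.ofReal (D j)) {η : (Fin d → ℝ) → ℝ} (hφ : IsPrimal φ) (hη : IsPrimal η)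
    {f : ℕ → S × (Fin d → ℝ) → ℝ} (hf : ∀ N, BddSec (f N)) (hf2 : ∀ N, MemLp (f N) 2 (μ N))
    (hB : ∀ N, ∫ p, f N p ^ 2 ∂μ N ≤ B) {f₀ : S × (Fin d → ℝ) → ℝ}
    (hlim : ∀ ψ : (S × (Fin d → ℝ)) →ᵇ ℝ,
      Tendsto (fun N => ∫ p, f N p * ψ p ∂μ N) 𝒰 (𝓝 (∫ p, f₀ p * ψ p ∂μ₀)))
    {Y : ℕ → S × (Fin d → ℝ) → ℝ}
    (hYlim : ∀ j (ψ : (S × (Fin d → ℝ)) →ᵇ ℝ), Tendsto (fun N => ∫ p,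
      pertSec (ρ j) φ η (f N) p * ψ p ∂cutMeasure (μ N) κ) 𝒰
        (𝓝 (∫ p, Y j p * ψ p ∂cutMeasure μ₀ κ)))
    (F : S →ᵇ ℝ) (g : (Fin d → ℝ) → ℝ) (hg : Continuous g) (hc : HasCompactSupport g) :
    Tendsto (fun j => ∫ p, Y j p * (F p.1 * g p.2) ∂cutMeasure μ₀ κ) atTop
      (𝓝 (∫ p, f₀ p * (F p.1 * g p.2) ∂cutMeasure μ₀ κ)) := by
  have hfin := fun N => isFiniteMeasure_cutMeasure (μ N) hκ
  obtain ⟨G, hG⟩ := hc.exists_bound_of_continuous hg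
  have hG0 : 0 ≤ G := (norm_nonneg _).trans (hG 0)
  have hC0 := (hC 0 0).1
  have hunif := hc.uniformContinuous_of_continuous hg
  set ψ := tensorBcf F hg hc with hψ
  have hψm : ∀ (ρ : Measure (S × (Fin d → ℝ))) [IsFiniteMeasure ρ], MemLp (fun p => ψ p) 2 ρ :=
    fun ρ _ => memLp_two_bcf ρ ψ
  have hbound : ∀ ε : ℝ, 0 < ε → ∀ᶠ j in atTop,
      |(∫ p, Y j p * ψ p ∂cutMeasure μ₀ κ) - ∫ p, f₀ p * ψ p ∂cutMeasure μ₀ κ|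
        ≤ ε * (‖F‖ * ((G + C) * √B)) := by
    intro ε hε
    obtain ⟨δ, hδ, hmod⟩ := Metric.uniformContinuous_iff.1 hunif ε hε
    -- The quarter reflects the range `4 * r` of the kernel.
    filter_upwards [hDlim.eventually_lt_const hε,
      hρ0.eventually_lt_const (show (0 : ℝ) < δ / 4 by positivity)] with j hj1 hj2
    refine le_of_tendsto ((hYlim j ψ).sub (tendsto_integral_cutMeasure hκ hκc hlim ψ)).abs
      (.of_forall fun N => ?_)
    have hP := (memLp_pertSec (hac N) hκ (hC j N) (hρ j) hφ hη (hf N) (hf2 N)).1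
    rw [← integral_sub (integrable_mul_of_memLp hP (hψm _))
      (integrable_mul_of_memLp (memLp_cutMeasure hκ (hf2 N)) (hψm _))]
    simp only [← sub_mul]
    have hmain := abs_integral_pertSec_sub_le (hac N) hκ (hC j N) (hD0 j) (hD j N) (hρ j) hφ hη
      (hf N) (hf2 N) F.continuous.measurable F.norm_coe_le_norm (norm_nonneg F) hg.measurable hG
      hG0 (w := ε) fun x y hxy => by
        have := hmod (a := y) (b := x) (hxy.trans_lt (by linarith))
        rw [Real.dist_eq] at this
        exact this.le
    refine hmain.trans ?_
    have h1 : √(∫ p, f N p ^ 2 ∂μ N) ≤ √B := Real.sqrt_le_sqrt (hB N)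
    have h2 : D j * G + ε * C ≤ ε * (G + C) := by
      rw [mul_add]
      gcongr
    calc _ ≤ ‖F‖ * ((ε * (G + C)) * √B) := by gcongr
      _ = _ := by ring
  rw [Metric.tendsto_nhds]
  intro ε hε
  set K := ‖F‖ * ((G + C) * √B) with hK
  have hK0 : 0 ≤ K := by positivity
  filter_upwards [hbound (ε / (K + 1)) (by positivity)] with j hj
  rw [Real.dist_eq]
  refine hj.trans_lt ?_
  rw [div_mul_eq_mul_div, div_lt_iff₀ (by positivity)]
  nlinarith

variable [PolishSpace S] [IsProbabilityMeasure μ₀]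

/-- At fixed `k` only finitely many products occur. Each converges by `tendsto_integral_coef_mul`,
with the basis function, the test function and the cut-off merged into one bounded continuous
function. -/
theorem tendsto_integral_truncSum
    (hm : ∀ ψ : (S × (Fin d → ℝ)) →ᵇ ℝ,
      Tendsto (fun N => ∫ p, ψ p ∂μ N) 𝒰 (𝓝 (∫ p, ψ p ∂μ₀)))
    (hcond : ∀ g : (S × (Fin d → ℝ)) →ᵇ ℝ,
      Tendsto (fun N => ∫ s, |∫ x, g (s, x) ∂((μ N).condKernel s)| ^ 2 ∂(μ N).fst) 𝒰
        (𝓝 (∫ s, |∫ x, g (s, x) ∂(μ₀.condKernel s)| ^ 2 ∂μ₀.fst)))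
    (hκ : IsCut κ) (hκc : Continuous κ) (hφ : IsPrimal φ) (hhc : ∀ a, Continuous (h a))
    (hh : ∀ a, BddMeas (h a)) {u : ℕ → S × (Fin d → ℝ) → ℝ} (hu : ∀ N, BddMeas (u N)) (k : ℕ)
    {b : (Fin d → ℤ) → S → ℝ} (hb : ∀ a, MemLp (b a) 2 μ₀.fst)
    (hblim : ∀ a (ψ : S →ᵇ ℝ),
      Tendsto (fun N => ∫ s, clamp k (coef r φ (fun x => u N (s, x)) a) * ψ s ∂(μ N).fst) 𝒰
        (𝓝 (∫ s, b a s * ψ s ∂μ₀.fst)))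
    (ψ : (S × (Fin d → ℝ)) →ᵇ ℝ) :
    Tendsto (fun N => ∫ p, truncSum r φ h (u N) k p * ψ p ∂cutMeasure (μ N) κ) 𝒰
      (𝓝 (∫ p, coefSum k b h p * ψ p ∂cutMeasure μ₀ κ)) := by
  have hψb : ∀ a, BddMeas fun p : S × (Fin d → ℝ) => h a p.2 * ψ p := fun a =>
    BddMeas.mul ⟨(hh a).1.comp measurable_snd, (hh a).2.imp fun _ hM p => hM p.2⟩
      ⟨ψ.continuous.measurable, ‖ψ‖, ψ.norm_coe_le_norm⟩
  have key : ∀ (ρ : Measure (S × (Fin d → ℝ))) [IsProbabilityMeasure ρ]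
      (c : (Fin d → ℤ) → S → ℝ), (∀ a, MemLp (c a) 2 ρ.fst) →
      ∫ p, (∑ a ∈ box d k, c a p.1 * h a p.2) * ψ p ∂cutMeasure ρ κ
        = ∑ a ∈ box d k, ∫ p, c a p.1 * (h a p.2 * ψ p * κ p) ∂ρ := by
    intro ρ _ c hc
    rw [integral_cutMeasure ρ hκ, ← integral_finsetSum]
    · refine integral_congr_ae (ae_of_all _ fun p => ?_)
      simp only [Finset.sum_mul]
      exact Finset.sum_congr rfl fun a _ => by ring
    · intro a _
      exact integrable_mul_of_memLp (memLp_fst (hc a))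
        (((hψb a).mul ⟨hκ.1, 1, fun p => by
          rw [abs_of_nonneg (hκ.2 p).1]; exact (hκ.2 p).2⟩).memLp ρ 2)
  unfold truncSum coefSum
  rw [key μ₀ b hb]
  simp only [fun N => key (μ N) (fun a s => clamp k (coef r φ (fun x => u N (s, x)) a))
    fun a => (bddMeas_clamp_coef hφ (hu N).1 k a).memLp _ 2]
  refine tendsto_finsetSum _ fun a _ => ?_
  let g : (S × (Fin d → ℝ)) →ᵇ ℝ :=
    BoundedContinuousFunction.ofNormedAddCommGroup (fun p : S × (Fin d → ℝ) => h a p.2 * ψ p)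
      (((hhc a).comp continuous_snd).mul ψ.continuous) (hψb a).2.choose (hψb a).2.choose_spec
      * cutBcf hκc hκ.2
  exact tendsto_integral_coef_mul 𝒰 hm hcond (M := k)
    (fun N => (bddMeas_clamp_coef hφ (hu N).1 k a).1)
    (fun N s => abs_clamp_le (Nat.cast_nonneg k) _) (hb a) (hblim a) g

/-- Interchange of the limits in `N` and `k`: the truncation error is of order `1 / k` uniformly in
`N`. The `L²` bound, uniform in `k`, comes from lower semicontinuity. The lemma is stated for
general `h` because it serves both the basis functions and their derivatives. -/
theorem coefSum_limit
    (hm : ∀ ψ : (S × (Fin d → ℝ)) →ᵇ ℝ,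
      Tendsto (fun N => ∫ p, ψ p ∂μ N) 𝒰 (𝓝 (∫ p, ψ p ∂μ₀)))
    (hcond : ∀ g : (S × (Fin d → ℝ)) →ᵇ ℝ,
      Tendsto (fun N => ∫ s, |∫ x, g (s, x) ∂((μ N).condKernel s)| ^ 2 ∂(μ N).fst) 𝒰
        (𝓝 (∫ s, |∫ x, g (s, x) ∂(μ₀.condKernel s)| ^ 2 ∂μ₀.fst)))
    (hac : ∀ N, ∀ᵐ s ∂(μ N).fst, (μ N).condKernel s ≪ volume)
    (hκ : IsCut κ) (hκc : Continuous κ) (hC : ∀ N, PertBound (μ N) r κ C) (hr : 0 < r)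
    (hφ : IsPrimal φ) (hθ : IsPrimal θ) (hA : 0 ≤ A) (hhc : ∀ a, Continuous (h a))
    (hh : ∀ a x, |h a x| ≤ A * rescale θ r a x) {u : ℕ → S × (Fin d → ℝ) → ℝ}
    (hu : ∀ N, BddMeas (u N)) (hB : ∀ N, ∫ p, u N p ^ 2 ∂μ N ≤ B)
    {b : ℕ → (Fin d → ℤ) → S → ℝ} (hb : ∀ k a, MemLp (b k a) 2 μ₀.fst)
    (hblim : ∀ (k : ℕ) a (ψ : S →ᵇ ℝ),
      Tendsto (fun N => ∫ s, clamp k (coef r φ (fun x => u N (s, x)) a) * ψ s ∂(μ N).fst) 𝒰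
        (𝓝 (∫ s, b k a s * ψ s ∂μ₀.fst)))
    {Y : ℕ → S × (Fin d → ℝ) → ℝ}
    (hY : ∀ N p, Y N p = ∑ a ∈ near r p.2, coef r φ (fun x => u N (p.1, x)) a * h a p.2)
    (hY2 : ∀ N, MemLp (Y N) 2 (cutMeasure (μ N) κ)) {Y₀ : S × (Fin d → ℝ) → ℝ}
    (hYlim : ∀ ψ : (S × (Fin d → ℝ)) →ᵇ ℝ,
      Tendsto (fun N => ∫ p, Y N p * ψ p ∂cutMeasure (μ N) κ) 𝒰
        (𝓝 (∫ p, Y₀ p * ψ p ∂cutMeasure μ₀ κ))) :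
    (∀ k, MemLp (coefSum k (b k) h) 2 (cutMeasure μ₀ κ)) ∧
    (∀ k, ∫ p, coefSum k (b k) h p ^ 2 ∂cutMeasure μ₀ κ ≤ A ^ 2 * (C * B)) ∧
    ∀ (f : S →ᵇ ℝ) (g : (Fin d → ℝ) → ℝ), Continuous g → HasCompactSupport g →
      Tendsto (fun k => ∫ p, coefSum k (b k) h p * (f p.1 * g p.2) ∂cutMeasure μ₀ κ) atTop
        (𝓝 (∫ p, Y₀ p * (f p.1 * g p.2) ∂cutMeasure μ₀ κ)) := by
  have hfin := fun N => isFiniteMeasure_cutMeasure (μ N) hκ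
  have hfin₀ := isFiniteMeasure_cutMeasure μ₀ hκ
  have hhb : ∀ a, BddMeas (h a) := fun a => ⟨(hhc a).measurable, A, fun x =>
    (hh a x).trans (mul_le_of_le_one_right hA (rescale_le_one hθ a x))⟩
  have hmem : ∀ k, MemLp (coefSum k (b k) h) 2 (cutMeasure μ₀ κ) := fun k =>
    memLp_coefSum (cutMeasure_le μ₀ hκ) (hb k) hhb k
  have hlim := fun k => tendsto_integral_truncSum hm hcond hκ hκc hφ hhc hhb hu k (hb k) (hblim k)
  have hmc : ∀ ψ : (S × (Fin d → ℝ)) →ᵇ ℝ, Tendsto (fun N => ∫ p, ψ p ∂cutMeasure (μ N) κ) 𝒰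
      (𝓝 (∫ p, ψ p ∂cutMeasure μ₀ κ)) := fun ψ => by
    have := tendsto_integral_cutMeasure (f := fun _ _ => 1) (f₀ := fun _ => 1) hκ hκc
      (μ := μ) (μ₀ := μ₀) (𝒰 := 𝒰) (by simpa using hm) ψ
    simpa using this
  have hC0 := (hC 0).1
  have hCB : ∀ N, C * ∫ p, u N p ^ 2 ∂μ N ≤ C * B := fun N => mul_le_mul_of_nonneg_left (hB N) hC0
  have htr := fun k N => memLp_truncSum (hac N) hκ (hC N) hr hφ hθ (fun a => (hhb a).1) hh (hu N) k
  refine ⟨hmem, fun k => ?_, fun f g hg hc => ?_⟩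
  · refine integral_sq_le_of_tendsto 𝒰 hmc (fun N => (htr k N).1) (.of_forall fun N => ?_) (hmem k)
      (hlim k)
    exact (htr k N).2.trans (mul_le_mul_of_nonneg_left (hCB N) (sq_nonneg _))
  · set ψ := tensorBcf f hg hc with hψ
    have hψm : ∀ (ρ : Measure (S × (Fin d → ℝ))) [IsFiniteMeasure ρ], MemLp (fun p => ψ p) 2 ρ :=
      fun ρ _ => memLp_two_bcf ρ ψ
    have hbound : ∀ᶠ k : ℕ in atTop, |(∫ p, coefSum k (b k) h p * ψ p ∂cutMeasure μ₀ κ)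
        - ∫ p, Y₀ p * ψ p ∂cutMeasure μ₀ κ| ≤ (k : ℝ)⁻¹ * (A * ‖ψ‖ * (C * B)) := by
      filter_upwards [eventually_near_subset_box hr hc, eventually_gt_atTop 0] with k hk hk0
      refine le_of_tendsto ((hlim k ψ).sub (hYlim ψ)).abs (.of_forall fun N => ?_)
      rw [← integral_sub (integrable_mul_of_memLp (htr k N).1 (hψm _))
        (integrable_mul_of_memLp (hY2 N) (hψm _))]
      simp only [← sub_mul]
      refine (abs_integral_truncSum_sub_le (hac N) hκ (hC N) hr hφ hθ hA hh (hu N) hk0 (hY N)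
        (norm_nonneg ψ) ψ.norm_coe_le_norm fun p hp => hk p.2 fun h0 => hp ?_).trans ?_
      · rw [hψ, tensorBcf_apply, h0, mul_zero]
      · have := hCB N
        have h0 : 0 ≤ A * ‖ψ‖ := by positivity
        exact mul_le_mul_of_nonneg_left (mul_le_mul_of_nonneg_left this h0) (by positivity)
    have hz : Tendsto (fun k : ℕ => (k : ℝ)⁻¹ * (A * ‖ψ‖ * (C * B))) atTop (𝓝 0) := by
      have := (tendsto_inv_atTop_nhds_zero_nat (𝕜 := ℝ)).mul_const (A * ‖ψ‖ * (C * B))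
      rwa [zero_mul] at this
    rw [tendsto_iff_dist_tendsto_zero]
    refine tendsto_of_tendsto_of_tendsto_of_le_of_le' tendsto_const_nhds hz
      (.of_forall fun _ => dist_nonneg) hbound

/-- The weak limits of the expansions at a fixed scale are limits of gradients. -/
theorem isLimGrad_expansion
    (hm : ∀ ψ : (S × (Fin d → ℝ)) →ᵇ ℝ,
      Tendsto (fun N => ∫ p, ψ p ∂μ N) 𝒰 (𝓝 (∫ p, ψ p ∂μ₀)))
    (hcond : ∀ g : (S × (Fin d → ℝ)) →ᵇ ℝ,
      Tendsto (fun N => ∫ s, |∫ x, g (s, x) ∂((μ N).condKernel s)| ^ 2 ∂(μ N).fst) 𝒰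
        (𝓝 (∫ s, |∫ x, g (s, x) ∂(μ₀.condKernel s)| ^ 2 ∂μ₀.fst)))
    (hac : ∀ N, ∀ᵐ s ∂(μ N).fst, (μ N).condKernel s ≪ volume)
    (hκ : IsCut κ) (hκc : Continuous κ) (hC : ∀ N, PertBound (μ N) r κ C) (hr : 0 < r)
    {u : ℕ → S × (Fin d → ℝ) → ℝ} {V : ℕ → Fin d → S × (Fin d → ℝ) → ℝ}
    (hu : ∀ N, IsGrad (u N) (V N)) (hV : ∀ N i, MemLp (V N i) 2 (μ N))
    (hB : ∀ N, ∫ p, u N p ^ 2 ∂μ N ≤ B)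
    {Y : S × (Fin d → ℝ) → ℝ} {Z : Fin d → S × (Fin d → ℝ) → ℝ}
    (hY : MemLp Y 2 (cutMeasure μ₀ κ)) (hZ : ∀ i, MemLp (Z i) 2 (cutMeasure μ₀ κ))
    (hYlim : ∀ ψ : (S × (Fin d → ℝ)) →ᵇ ℝ, Tendsto (fun N => ∫ p,
      pertSec r (primalSmooth d) (primalBase d) (u N) p * ψ p ∂cutMeasure (μ N) κ) 𝒰
        (𝓝 (∫ p, Y p * ψ p ∂cutMeasure μ₀ κ)))
    (hZlim : ∀ i, ∀ ψ : (S × (Fin d → ℝ)) →ᵇ ℝ, Tendsto (fun N => ∫ p,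
      pertSec r (primalSmoothDiff i) (primalBaseAvg i) (V N i) p * ψ p ∂cutMeasure (μ N) κ) 𝒰
        (𝓝 (∫ p, Z i p * ψ p ∂cutMeasure μ₀ κ))) :
    IsLimGrad (cutMeasure μ₀ κ) Y Z := by
  have hfin₀ := isFiniteMeasure_cutMeasure μ₀ hκ
  have hφ := isPrimal_primalBase (d := d)
  have hη := isPrimal_primalSmooth (d := d)
  -- The same limit coefficients serve the expansion and all its partial derivatives, so the limits
  -- form a pair of function and gradient.
  have hex : ∀ (k : ℕ) (a : Fin d → ℤ), ∃ b : S → ℝ, MemLp b 2 μ₀.fst ∧ ∀ ψ : S →ᵇ ℝ,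
      Tendsto (fun N => ∫ s, clamp k (coef r (primalBase d) (fun x => u N (s, x)) a) * ψ s
        ∂(μ N).fst) 𝒰 (𝓝 (∫ s, b s * ψ s ∂μ₀.fst)) := by
    intro k a
    have hb := fun N => bddMeas_clamp_coef (r := r) hφ (hu N).bddMeas.1 k a
    obtain ⟨b, hb1, -, hb2⟩ := exists_weak_limit_of_le 𝒰 (tendsto_integral_fst hm)
      (fun N => (hb N).memLp (μ N).fst 2) (B := (k : ℝ) ^ 2) (.of_forall fun N => by
        have := integral_mono (μ := (μ N).fst) ((hb N).sq.integrable _)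
          (integrable_const ((k : ℝ) ^ 2)) fun s => by
            have h := abs_le.1 (abs_clamp_le (Nat.cast_nonneg k)
              (coef r (primalBase d) (fun x => u N (s, x)) a))
            exact sq_le_sq' h.1 h.2
        simpa using this)
    exact ⟨b, hb1, hb2⟩
  choose b hb hblim using hex
  have hsm : ∀ a : Fin d → ℤ, ContDiff ℝ 1 (rescale (primalSmooth d) r a) := fun a =>
    (contDiff_rescale contDiff_primalSmooth a).of_le (by exact_mod_cast le_top)
  have hdc : ∀ i (a : Fin d → ℤ), Continuous fun x =>
      fderiv ℝ (rescale (primalSmooth d) r a) x (Pi.single i 1) := fun i a =>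
    ((hsm a).continuous_fderiv (by simp)).clm_apply continuous_const
  obtain ⟨hU, hUB, hUlim⟩ := coefSum_limit hm hcond hac hκ hκc hC hr hφ hη (A := 1) zero_le_one
    (h := fun a => rescale (primalSmooth d) r a) (fun a => (hsm a).continuous)
    (fun a x => by rw [one_mul, abs_of_nonneg (rescale_nonneg hη a x)])
    (fun N => (hu N).bddMeas) hB hb hblim
    (fun N p => perturbation_eq_sum hr.ne' hη _ p.2)
    (fun N => (memLp_pertSec (hac N) hκ (hC N) hr hη hφ (hu N).bddMeas.bddSec
      ((hu N).bddMeas.memLp _ 2)).1) hYlim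
  have hgrad := fun i => coefSum_limit hm hcond hac hκ hκc hC hr hφ (isPrimal_primalGradBound i)
    (A := 2 / r) (by positivity)
    (h := fun a x => fderiv ℝ (rescale (primalSmooth d) r a) x (Pi.single i 1)) (hdc i)
    (abs_fderiv_primalSmooth_le hr i) (fun N => (hu N).bddMeas) hB hb hblim
    (Y := fun N => pertSec r (primalSmoothDiff i) (primalBaseAvg i) (V N i))
    (fun N p => sum_coef_mul_fderiv hr i (bddMeas_section (hu N).bddMeas p.1)
      ((hu N).weak i p.1) p.2)
    (fun N => (memLp_pertSec (hac N) hκ (hC N) hr (isPrimal_primalSmoothDiff i)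
      (isPrimal_primalBaseAvg i) ⟨(hu N).measurable i, (hu N).bdd i⟩ (hV N i)).1) (hZlim i)
  refine isLimGrad_of_weak (B := max (1 ^ 2 * (C * B)) ((2 / r) ^ 2 * (C * B))) hU
    (fun k i => (hgrad i).1 k) hY hZ (.of_forall fun k => ?_)
    (.of_forall fun k => (hUB k).trans (le_max_left _ _))
    (fun i => .of_forall fun k => ((hgrad i).2.1 k).trans (le_max_right _ _)) hUlim
    fun i => (hgrad i).2.2
  have hle := cutMeasure_le μ₀ hκ
  have hbd : ∀ a, BddMeas (rescale (primalSmooth d) r a) := fun a =>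
    ⟨measurable_rescale hη a, 1, fun x => by
      rw [abs_of_nonneg (rescale_nonneg hη a x)]; exact rescale_le_one hη a x⟩
  have hbd' : ∀ i a, BddMeas fun x => fderiv ℝ (rescale (primalSmooth d) r a) x (Pi.single i 1) :=
    fun i a => ⟨(hdc i a).measurable, 2 / r, fun x => (abs_fderiv_primalSmooth_le hr i a x).trans
      (mul_le_of_le_one_right (by positivity) (rescale_le_one (isPrimal_primalGradBound i) a x))⟩
  have hsum := IsLimGrad.finset_sum (m := cutMeasure μ₀ κ) (box d k)
    (u := fun a p => b k a p.1 * rescale (primalSmooth d) r a p.2)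
    (V := fun a i p => b k a p.1 * fderiv ℝ (rescale (primalSmooth d) r a) p.2 (Pi.single i 1))
    (fun a => (memLp_coef_mul hle (hb k a) (hbd a)).1)
    (fun a i => (memLp_coef_mul hle (hb k a) (hbd' i a)).1)
    (fun a => isLimGrad_tensor hle (hb k a) (hsm a) (hasCompactSupport_rescale hr hη a))
  convert hsum using 1
  · funext p
    simp [coefSum, Finset.sum_apply]
  · funext i p
    simp [coefSum, Finset.sum_apply]

/-- Weak limits of functions and of their gradients along the sequence are limits of gradients
for the limit measure with cut-off. -/
theorem isLimGrad_of_weak_limits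
    (hm : ∀ ψ : (S × (Fin d → ℝ)) →ᵇ ℝ,
      Tendsto (fun N => ∫ p, ψ p ∂μ N) 𝒰 (𝓝 (∫ p, ψ p ∂μ₀)))
    (hcond : ∀ g : (S × (Fin d → ℝ)) →ᵇ ℝ,
      Tendsto (fun N => ∫ s, |∫ x, g (s, x) ∂((μ N).condKernel s)| ^ 2 ∂(μ N).fst) 𝒰
        (𝓝 (∫ s, |∫ x, g (s, x) ∂(μ₀.condKernel s)| ^ 2 ∂μ₀.fst)))
    (hac : ∀ N, ∀ᵐ s ∂(μ N).fst, (μ N).condKernel s ≪ volume)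
    (hκ : IsCut κ) (hκc : Continuous κ) {ρ D : ℕ → ℝ} (hρ : ∀ j, 0 < ρ j)
    (hρ0 : Tendsto ρ atTop (𝓝 0)) (hC : ∀ j N, PertBound (μ N) (ρ j) κ C) (hD0 : ∀ j, 0 ≤ D j)
    (hDlim : Tendsto D atTop (𝓝 0))
    (hD : ∀ j N, eLpNorm (fun s => deltaRes (ρ j) (fun x => κ (s, x)) ((μ N).condKernel s)) 2
      (μ N).fst ≤ ENNReal.ofReal (D j))
    {u : ℕ → S × (Fin d → ℝ) → ℝ} {V : ℕ → Fin d → S × (Fin d → ℝ) → ℝ}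
    (hu : ∀ N, IsGrad (u N) (V N)) (hV : ∀ N i, MemLp (V N i) 2 (μ N))
    (hB : ∀ N, ∫ p, u N p ^ 2 ∂μ N ≤ B) (hBV : ∀ N i, ∫ p, V N i p ^ 2 ∂μ N ≤ B)
    {u₀ : S × (Fin d → ℝ) → ℝ} {v : Fin d → S × (Fin d → ℝ) → ℝ}
    (hu₀ : MemLp u₀ 2 μ₀) (hv : ∀ i, MemLp (v i) 2 μ₀)
    (hulim : ∀ ψ : (S × (Fin d → ℝ)) →ᵇ ℝ,
      Tendsto (fun N => ∫ p, u N p * ψ p ∂μ N) 𝒰 (𝓝 (∫ p, u₀ p * ψ p ∂μ₀)))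
    (hvlim : ∀ i, ∀ ψ : (S × (Fin d → ℝ)) →ᵇ ℝ,
      Tendsto (fun N => ∫ p, V N i p * ψ p ∂μ N) 𝒰 (𝓝 (∫ p, v i p * ψ p ∂μ₀))) :
    IsLimGrad (cutMeasure μ₀ κ) u₀ v := by
  have hfin := fun N => isFiniteMeasure_cutMeasure (μ N) hκ
  have hfin₀ := isFiniteMeasure_cutMeasure μ₀ hκ
  have hC0 := (hC 0 0).1
  have hmc : ∀ ψ : (S × (Fin d → ℝ)) →ᵇ ℝ, Tendsto (fun N => ∫ p, ψ p ∂cutMeasure (μ N) κ) 𝒰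
      (𝓝 (∫ p, ψ p ∂cutMeasure μ₀ κ)) := fun ψ => by
    have := tendsto_integral_cutMeasure (f := fun _ _ => 1) (f₀ := fun _ => 1) hκ hκc
      (μ := μ) (μ₀ := μ₀) (𝒰 := 𝒰) (by simpa using hm) ψ
    simpa using this
  have hlim : ∀ {φ η : (Fin d → ℝ) → ℝ}, IsPrimal φ → IsPrimal η →
      ∀ {f : ℕ → S × (Fin d → ℝ) → ℝ}, (∀ N, BddSec (f N)) → (∀ N, MemLp (f N) 2 (μ N)) →
      (∀ N, ∫ p, f N p ^ 2 ∂μ N ≤ B) → ∀ j, ∃ Y : S × (Fin d → ℝ) → ℝ,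
        MemLp Y 2 (cutMeasure μ₀ κ) ∧ ∫ p, Y p ^ 2 ∂cutMeasure μ₀ κ ≤ C * B ∧
        ∀ ψ : (S × (Fin d → ℝ)) →ᵇ ℝ, Tendsto (fun N => ∫ p,
          pertSec (ρ j) φ η (f N) p * ψ p ∂cutMeasure (μ N) κ) 𝒰
            (𝓝 (∫ p, Y p * ψ p ∂cutMeasure μ₀ κ)) := by
    intro φ η hφ hη f hf hf2 hfB j
    have hP := fun N => memLp_pertSec (hac N) hκ (hC j N) (hρ j) hφ hη (hf N) (hf2 N)
    exact exists_weak_limit_of_le 𝒰 hmc (fun N => (hP N).1)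
      (.of_forall fun N => (hP N).2.trans (mul_le_mul_of_nonneg_left (hfB N) hC0))
  have hus : ∀ N, BddSec (u N) := fun N => (hu N).bddMeas.bddSec
  have hu2 : ∀ N, MemLp (u N) 2 (μ N) := fun N => (hu N).bddMeas.memLp _ 2
  have hVs : ∀ i N, BddSec (V N i) := fun i N => ⟨(hu N).measurable i, (hu N).bdd i⟩
  have hφ := isPrimal_primalBase (d := d)
  have hη := isPrimal_primalSmooth (d := d)
  -- At each scale both expansions have weak limits, bounded in `L²` uniformly in the scale.
  choose Y hY hYB hYlim using hlim hη hφ hus hu2 hB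
  choose Z hZ hZB hZlim using fun i => hlim (isPrimal_primalSmoothDiff i)
    (isPrimal_primalBaseAvg i) (hVs i) (fun N => hV N i) (fun N => hBV N i)
  refine isLimGrad_of_weak hY (fun j i => hZ i j) (memLp_cutMeasure hκ hu₀)
    (fun i => memLp_cutMeasure hκ (hv i)) (.of_forall fun j => ?_) (.of_forall hYB)
    (fun i => .of_forall (hZB i)) ?_ fun i => ?_
  · exact isLimGrad_expansion hm hcond hac hκ hκc (hC j) (hρ j) hu hV hB (hY j)
      (fun i => hZ i j) (hYlim j) fun i => hZlim i j
  · exact tendsto_perturbation_limit hac hκ hκc hρ hρ0 hC hD0 hDlim hD hη hφ hus hu2 hB hulim hYlim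
  · exact tendsto_perturbation_limit hac hκ hκc hρ hρ0 hC hD0 hDlim hD
      (isPrimal_primalSmoothDiff i) (isPrimal_primalBaseAvg i) (hVs i) (fun N => hV N i)
      (fun N => hBV N i) (hvlim i) (hZlim i)

end Limits

/-! ### Mosco convergence -/

section ClassMap

variable {X : Type*} [TopologicalSpace X] [MeasurableSpace X] [BorelSpace X]
  [SecondCountableTopology X]

theorem inner_classMap (m : Measure X) [IsFiniteMeasure m] (u : Lp ℝ 2 m) (ψ : X →ᵇ ℝ) :
    inner ℝ u (classMap m ψ) = ∫ x, u x * ψ x ∂m := by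
  rw [integral_mul_eq_inner (Lp.memLp u) (memLp_two_bcf m ψ), Lp.toLp_coeFn, ← toLp_bcf_eq]
  rfl

theorem integral_classMap_mul (m : Measure X) [IsFiniteMeasure m] (φ ψ : X →ᵇ ℝ) :
    ∫ x, classMap m φ x * ψ x ∂m = ∫ x, (φ * ψ) x ∂m := by
  refine integral_congr_ae ?_
  have h : classMap m φ =ᵐ[m] φ := BoundedContinuousFunction.coeFn_toLp 2 m ℝ φ
  filter_upwards [h] with x hx
  rw [hx]
  rfl

theorem norm_classMap_le (m : Measure X) [IsProbabilityMeasure m] (φ : X →ᵇ ℝ) :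
    ‖classMap m φ‖ ≤ ‖φ‖ := by
  have h : classMap m φ =ᵐ[m] φ := BoundedContinuousFunction.coeFn_toLp 2 m ℝ φ
  have h1 := Lp.norm_le_of_ae_bound (f := classMap m φ) (norm_nonneg φ) (by
    filter_upwards [h] with x hx
    rw [hx]
    exact φ.norm_coe_le_norm x)
  simpa [measureUnivNNReal] using h1

theorem sqrt_integral_sq_bcf_le {X : Type*} [TopologicalSpace X] [MeasurableSpace X]
    [BorelSpace X] (m : Measure X) [IsProbabilityMeasure m] (φ : X →ᵇ ℝ) :
    √(∫ x, φ x ^ 2 ∂m) ≤ ‖φ‖ := by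
  refine Real.sqrt_le_iff.2 ⟨norm_nonneg _, ?_⟩
  have := integral_mono (μ := m) (memLp_two_bcf m φ).integrable_sq (integrable_const (‖φ‖ ^ 2))
    fun x => by
      have h := abs_le.1 (φ.norm_coe_le_norm x)
      exact sq_le_sq' h.1 h.2
  simpa using this

variable {m : ℕ → Measure X} [∀ N, IsFiniteMeasure (m N)] {m₀ : Measure X} [IsFiniteMeasure m₀]

/-- Products of bounded continuous functions are bounded continuous, so pairings and norms converge
with the measures. -/
theorem strongConv_classMap
    (hm : ∀ ψ : X →ᵇ ℝ, Tendsto (fun N => ∫ x, ψ x ∂m N) atTop (𝓝 (∫ x, ψ x ∂m₀)))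
    (ψ : X →ᵇ ℝ) :
    StrongConv (fun N => classMap (m N)) (classMap m₀) (fun N => classMap (m N) ψ)
      (classMap m₀ ψ) := by
  have h : ∀ φ : X →ᵇ ℝ, Tendsto (fun N => inner ℝ (classMap (m N) ψ) (classMap (m N) φ)) atTop
      (𝓝 (inner ℝ (classMap m₀ ψ) (classMap m₀ φ))) := fun φ => by
    simp only [inner_classMap, integral_classMap_mul]
    exact hm (ψ * φ)
  refine ⟨h, ?_⟩
  have h2 := (h ψ).sqrt
  simp only [real_inner_self_eq_norm_sq, Real.sqrt_sq (norm_nonneg _)] at h2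
  exact h2

theorem WeakConv.tendsto_integral_mul
    (hm : ∀ ψ : X →ᵇ ℝ, Tendsto (fun N => ∫ x, ψ x ∂m N) atTop (𝓝 (∫ x, ψ x ∂m₀)))
    {u : ∀ N, Lp ℝ 2 (m N)} {u₀ : Lp ℝ 2 m₀}
    (hu : WeakConv (fun N => classMap (m N)) (classMap m₀) u u₀) (ψ : X →ᵇ ℝ) :
    Tendsto (fun N => ∫ x, u N x * ψ x ∂m N) atTop (𝓝 (∫ x, u₀ x * ψ x ∂m₀)) := by
  have := hu _ _ (strongConv_classMap hm ψ)
  simpa only [inner_classMap] using this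

end ClassMap

/-! ### Choice of scales with uniform constants -/

section Scales

variable {d : ℕ} {S : Type*} [MeasurableSpace S] {μ : ℕ → Measure (S × (Fin d → ℝ))}
  [∀ N, IsProbabilityMeasure (μ N)] {κ : S × (Fin d → ℝ) → ℝ}

theorem exists_scales
    (hδ : Tendsto (fun n : ℕ => ⨆ N, eLpNorm
      (fun s => deltaRes (1 / (n : ℝ)) (fun x => κ (s, x)) ((μ N).condKernel s)) 2 (μ N).fst)
      atTop (𝓝 0))
    (hC : limsup (fun n : ℕ => ⨆ N, eLpNorm
      (fun s => cPert (1 / (n : ℝ)) (fun x => κ (s, x)) ((μ N).condKernel s)) ⊤ (μ N).fst)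
      atTop < ⊤) :
    ∃ (C : ℝ) (ρ D : ℕ → ℝ), (∀ j, 0 < ρ j) ∧ Tendsto ρ atTop (𝓝 0) ∧
      (∀ j N, PertBound (μ N) (ρ j) κ C) ∧ (∀ j, 0 ≤ D j) ∧ Tendsto D atTop (𝓝 0) ∧
      ∀ j N, eLpNorm (fun s => deltaRes (ρ j) (fun x => κ (s, x)) ((μ N).condKernel s)) 2
        (μ N).fst ≤ ENNReal.ofReal (D j) := by
  obtain ⟨c, hc1, hc2⟩ := exists_between hC
  -- The scales start at `n₀`, beyond which both suprema are finite. This also skips `n = 0`, where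
  -- `1 / n` is zero.
  have ev := (eventually_lt_of_limsup_lt hc1).and
    ((hδ.eventually_lt_const ENNReal.zero_lt_top).and (eventually_gt_atTop 0))
  obtain ⟨n₀, hn₀⟩ := eventually_atTop.1 ev
  have hshift : Tendsto (fun j : ℕ => n₀ + j) atTop atTop := 
    tendsto_atTop_mono (fun j => Nat.le_add_left j n₀) tendsto_id
  refine ⟨c.toReal, fun j => 1 / ((n₀ + j : ℕ) : ℝ), fun j => (⨆ N, eLpNorm
      (fun s => deltaRes (1 / ((n₀ + j : ℕ) : ℝ)) (fun x => κ (s, x)) ((μ N).condKernel s)) 2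
      (μ N).fst).toReal, fun j => ?_, ?_, fun j N => ⟨ENNReal.toReal_nonneg, ?_⟩,
      fun j => ENNReal.toReal_nonneg, ?_, fun j N => ?_⟩
  · have := (hn₀ (n₀ + j) (Nat.le_add_right _ _)).2.2
    exact one_div_pos.2 (Nat.cast_pos.2 this)
  · exact tendsto_one_div_atTop_nhds_zero_nat.comp hshift
  · rw [ENNReal.ofReal_toReal hc2.ne]
    have h1 := (le_iSup (fun N => eLpNorm (fun s => cPert (1 / ((n₀ + j : ℕ) : ℝ))
      (fun x => κ (s, x)) ((μ N).condKernel s)) ⊤ (μ N).fst) N).trans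
      (hn₀ (n₀ + j) (Nat.le_add_right _ _)).1.le
    rw [eLpNorm_exponent_top] at h1
    filter_upwards [ae_le_eLpNormEssSup (μ := (μ N).fst) (f := fun s =>
      cPert (1 / ((n₀ + j : ℕ) : ℝ)) (fun x => κ (s, x)) ((μ N).condKernel s))] with s hs
    exact hs.trans h1
  · exact ((ENNReal.tendsto_toReal ENNReal.zero_ne_top).comp hδ).comp hshift
  · rw [ENNReal.ofReal_toReal (hn₀ (n₀ + j) (Nat.le_add_right _ _)).2.1.ne]
    exact le_iSup (fun N => eLpNorm (fun s => deltaRes (1 / ((n₀ + j : ℕ) : ℝ))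
      (fun x => κ (s, x)) ((μ N).condKernel s)) 2 (μ N).fst) N

end Scales

/-! ### The lower bound -/

section LowerBound

variable {d : ℕ} {S : Type*} [MeasurableSpace S]

/-- Some closure value lies below `c`, and a late term of the sequence realising it is close to `u`
with energy still below `c`. -/
theorem exists_isGrad_near {μ : Measure (S × (Fin d → ℝ))} [IsProbabilityMeasure μ]
    (hac : ∀ᵐ s ∂μ.fst, μ.condKernel s ≪ volume) {u : S × (Fin d → ℝ) → ℝ} {c : ℝ≥0∞}
    (h : gradForm μ u < c) {ε : ℝ≥0∞} (hε : 0 < ε) :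
    ∃ w V, IsGrad w V ∧ gradSq μ V < c ∧ eLpNorm (w - u) 2 μ < ε := by
  rw [gradForm, closedForm, sInf_lt_iff] at h
  obtain ⟨e, ⟨w, hw, hlim, -, hE⟩, hec⟩ := h
  obtain ⟨k, hk1, hk2⟩ := ((hlim.eventually_lt_const hε).and (hE.eventually_lt_const hec)).exists
  have hwk := hw k
  rw [← cutDensity_one μ] at hwk hk2
  obtain ⟨V, hV, hfin⟩ := exists_isGrad_of_mem_directDomain μ isCut_one hac hwk
  rw [hV.ofReal_directEnergy μ isCut_one hac hfin, cutMeasure_one] at hk2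
  exact ⟨w k, V, hV, hk2, hk1⟩

theorem gradSq_eq_ofReal {X : Type*} [MeasurableSpace X] {m : Measure X} {V : Fin d → X → ℝ}
    (hV : ∀ i, MemLp (V i) 2 m) : gradSq m V = ENNReal.ofReal (∑ i, ∫ x, V i x ^ 2 ∂m) := by
  rw [gradSq_eq_sum fun i => (hV i).1, ENNReal.ofReal_sum_of_nonneg fun i _ =>
    integral_nonneg fun x => sq_nonneg _]
  refine Finset.sum_congr rfl fun i _ => ?_
  rw [eLpNorm_two_sq_eq, ofReal_integral_eq_lintegral_ofReal (hV i).integrable_sq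
    (ae_of_all _ fun x => sq_nonneg _)]

theorem integral_sq_le_of_eLpNorm_le {X : Type*} [MeasurableSpace X] {m : Measure X} {f : X → ℝ}
    (hf : MemLp f 2 m) {R : ℝ} (hR : 0 ≤ R) (h : eLpNorm f 2 m ≤ ENNReal.ofReal R) :
    ∫ x, f x ^ 2 ∂m ≤ R ^ 2 := by
  rw [eLpNorm_two_eq_ofReal hf, ENNReal.ofReal_le_ofReal_iff hR, Real.sqrt_le_left hR] at h
  exact h

/-- Weak limits of vector fields do not increase the energy. -/
theorem exists_weak_limit_grad {X : Type*} [TopologicalSpace X] [PolishSpace X]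
    [MeasurableSpace X] [BorelSpace X] {m : ℕ → Measure X} [∀ N, IsFiniteMeasure (m N)]
    {m₀ : Measure X} [IsFiniteMeasure m₀] (𝒰 : Ultrafilter ℕ)
    (hm : ∀ ψ : X →ᵇ ℝ, Tendsto (fun N => ∫ x, ψ x ∂m N) 𝒰 (𝓝 (∫ x, ψ x ∂m₀)))
    {V : ℕ → Fin d → X → ℝ} (hV : ∀ N i, MemLp (V N i) 2 (m N)) {c : ℝ}
    (hc : ∀ N, ∑ i, ∫ x, V N i x ^ 2 ∂m N ≤ c) :
    ∃ v : Fin d → X → ℝ, (∀ i, MemLp (v i) 2 m₀) ∧ ∑ i, ∫ x, v i x ^ 2 ∂m₀ ≤ c ∧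
      ∀ i (ψ : X →ᵇ ℝ), Tendsto (fun N => ∫ x, V N i x * ψ x ∂m N) 𝒰
        (𝓝 (∫ x, v i x * ψ x ∂m₀)) := by
  have hnn : ∀ N i, 0 ≤ ∫ x, V N i x ^ 2 ∂m N := fun N i => integral_nonneg fun x => sq_nonneg _
  -- The squared norm of each component gets its own limit. Summing these limits keeps the bound
  -- `c`, whereas bounding every component by `c` would lose a factor `d`.
  have hB : ∀ i, ∃ B, Tendsto (fun N => ∫ x, V N i x ^ 2 ∂m N) 𝒰 (𝓝 B) := by
    intro i
    have hmem : ∀ N, ∫ x, V N i x ^ 2 ∂m N ∈ Icc 0 c := fun N => ⟨hnn N i,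
      (Finset.single_le_sum (f := fun i => ∫ x, V N i x ^ 2 ∂m N) (fun i _ => hnn N i)
        (Finset.mem_univ i)).trans (hc N)⟩
    obtain ⟨B, -, hB⟩ := isCompact_Icc.ultrafilter_le_nhds
      (𝒰.map fun N => ∫ x, V N i x ^ 2 ∂m N)
      (le_principal_iff.2 (mem_map.2 (univ_mem' hmem)))
    exact ⟨B, hB⟩
  choose B hB using hB
  choose v hv hvB hvlim using fun i => exists_weak_limit 𝒰 hm (fun N => hV N i) (hB i)
  refine ⟨v, hv, (Finset.sum_le_sum fun i _ => hvB i).trans ?_, hvlim⟩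
  exact le_of_tendsto (tendsto_finsetSum _ fun i _ => hB i) (.of_forall hc)

variable [TopologicalSpace S]

theorem IsLimGrad.mono_measure {m m' : Measure (S × (Fin d → ℝ))} (hle : m ≤ m')
    {u : S × (Fin d → ℝ) → ℝ} {V : Fin d → S × (Fin d → ℝ) → ℝ} (h : IsLimGrad m' u V) :
    IsLimGrad m u V := by
  obtain ⟨w, hw, h1, h2⟩ := h
  exact ⟨w, hw,
    tendsto_of_tendsto_of_tendsto_of_le_of_le tendsto_const_nhds h1 (fun _ => zero_le)
      fun k => eLpNorm_mono_measure _ hle,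
    fun i => tendsto_of_tendsto_of_tendsto_of_le_of_le tendsto_const_nhds (h2 i) (fun _ => zero_le)
      fun k => eLpNorm_mono_measure _ hle⟩

variable [BorelSpace S]

/-- The form of the limit is determined by limits of gradients for all cut-off functions. -/
theorem gradFormMin_le_of_forall_isLimGrad {μ₀ : Measure (S × (Fin d → ℝ))}
    [IsProbabilityMeasure μ₀] (hH : Hamza μ₀) {U : Set (S × (Fin d → ℝ) → ℝ)} (hU : U.Countable)
    (hUc : ∀ κ ∈ U, Continuous κ ∧ ∀ p, κ p ∈ Icc (0 : ℝ) 1)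
    (hsup : ∀ᵐ p ∂μ₀, IsLUB ((fun κ : S × (Fin d → ℝ) → ℝ => κ p) '' U) 1)
    {u : S × (Fin d → ℝ) → ℝ} (hu : AEStronglyMeasurable u μ₀)
    (hdom : (∀ κ ∈ U, MemCutMin μ₀ κ u) ∧ (⨆ κ ∈ U, cutForm μ₀ κ u) < ⊤ → MemGradMin μ₀ u)
    {v : Fin d → S × (Fin d → ℝ) → ℝ} (hv : ∀ i, MemLp (v i) 2 μ₀)
    (h : ∀ κ ∈ U, IsLimGrad (cutMeasure μ₀ κ) u v) : gradFormMin μ₀ u ≤ gradSq μ₀ v := by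
  have hac := hH.1
  have hcut : ∀ κ ∈ U, IsCut κ := fun κ hκ => ⟨(hUc κ hκ).1.measurable, (hUc κ hκ).2⟩
  have hvκ : ∀ κ ∈ U, ∀ i, MemLp (v i) 2 (cutMeasure μ₀ κ) := fun κ hκ i =>
    memLp_cutMeasure (hcut κ hκ) (hv i)
  have hmin : MemGradMin μ₀ u := by
    refine hdom ⟨fun κ hκ => (h κ hκ).memCutMin μ₀ hac (hcut κ hκ) (hvκ κ hκ), ?_⟩
    -- All cut forms are bounded by the squared norm of the single field `v`, because `κ μ₀ ≤ μ₀`.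
    refine lt_of_le_of_lt (iSup₂_le fun κ hκ => ?_) (gradSq_lt_top hv)
    refine ((h κ hκ).cutForm_le μ₀ hac (hcut κ hκ) (hvκ κ hκ)).trans ?_
    exact lintegral_mono' (cutMeasure_le μ₀ (hcut κ hκ)) le_rfl
  have hcm := (memGradMin_iff_memCutMin μ₀ u).1 hmin
  have hu1 : AEStronglyMeasurable u (cutMeasure μ₀ fun _ => 1) := by rwa [cutMeasure_one]
  obtain ⟨V, hV, hVlim, hVeq⟩ := hcm.exists_isLimGrad μ₀ hH isCut_one
    (fun _ => continuous_const) hu1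
  rw [gradFormMin, if_pos hmin, gradForm_eq_cutForm, hVeq]
  rw [cutMeasure_one] at hV hVlim ⊢
  have hae : ∀ i, V i =ᵐ[μ₀] v i := by
    intro i
    have h1 : ∀ κ ∈ U, ∀ᵐ p ∂μ₀, κ p ≠ 0 → V i p = v i p := by
      intro κ hκ
      have hle := cutMeasure_le μ₀ (hcut κ hκ)
      have h2 := IsWeakLimGrad.ae_unique μ₀ hH (hcut κ hκ)
        (fun s => (hUc κ hκ).1.comp (Continuous.prodMk_right s)) (hu.mono_measure hle)
        (fun i => (hV i).1.mono_measure hle) (fun i => (hvκ κ hκ i).1)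
        (hVlim.mono_measure hle).isWeakLimGrad (h κ hκ).isWeakLimGrad i
      have h3 := (ae_withDensity_iff (hcut κ hκ).1.ennreal_ofReal).1 h2
      filter_upwards [h3] with p hp hne
      refine hp ?_
      rw [ne_eq, ENNReal.ofReal_eq_zero, not_le]
      exact lt_of_le_of_ne ((hcut κ hκ).2 p).1 (Ne.symm hne)
    filter_upwards [(ae_ball_iff hU).2 h1, hsup] with p hp hlub
    by_contra hne
    -- At a point where the gradients differ every cut-off vanishes, contradicting the supremum one.
    have hub : (0 : ℝ) ∈ upperBounds ((fun κ : S × (Fin d → ℝ) → ℝ => κ p) '' U) := by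
      rintro _ ⟨κ, hκ, rfl⟩
      by_contra hpos
      exact hne (hp κ hκ fun h0 => hpos (le_of_eq h0))
    exact absurd (hlub.2 hub) (by norm_num)
  rw [gradSq_congr hae]

variable [PolishSpace S] {μ : ℕ → Measure (S × (Fin d → ℝ))} [∀ N, IsProbabilityMeasure (μ N)]
  {μ₀ : Measure (S × (Fin d → ℝ))} [IsProbabilityMeasure μ₀]

/-- Core of the lower bound. An ultrafilter concentrated on the indices with small energy yields
weak limits of approximants and gradients, and the limit field dominates the form at `u₀`. -/
theorem gradFormMin_le_of_frequently_lt
    (hm : ∀ ψ : (S × (Fin d → ℝ)) →ᵇ ℝ,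
      Tendsto (fun N => ∫ p, ψ p ∂μ N) atTop (𝓝 (∫ p, ψ p ∂μ₀)))
    (hH : ∀ N, Hamza (μ N)) (hH₀ : Hamza μ₀) (hcond : CondIntegralsConv μ μ₀)
    (hcut : CutoffCondition μ μ₀) {u : ∀ N, Lp ℝ 2 (μ N)} {u₀ : Lp ℝ 2 μ₀} {R : ℝ}
    (hR : ∀ N, ‖u N‖ ≤ R)
    (hu : ∀ ψ : (S × (Fin d → ℝ)) →ᵇ ℝ,
      Tendsto (fun N => ∫ p, u N p * ψ p ∂μ N) atTop (𝓝 (∫ p, u₀ p * ψ p ∂μ₀)))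
    {c : ℝ≥0∞} (hc : c ≠ ⊤) (hfreq : ∃ᶠ N in atTop, gradForm (μ N) (u N) < c) :
    gradFormMin μ₀ u₀ ≤ c := by
  obtain ⟨U, hUcount, hUc, hUδ, hsup, hdom⟩ := hcut
  set T : Set ℕ := {N | gradForm (μ N) (u N) < c}
  have hne : (atTop ⊓ 𝓟 T : Filter ℕ).NeBot := frequently_mem_iff_neBot.1 hfreq
  set 𝒰 : Ultrafilter ℕ := Ultrafilter.of (atTop ⊓ 𝓟 T)
  have h𝒰 : (𝒰 : Filter ℕ) ≤ atTop := (Ultrafilter.of_le _).trans inf_le_left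
  have hT : ∀ᶠ N in (𝒰 : Filter ℕ), N ∈ T :=
    (Ultrafilter.of_le (atTop ⊓ 𝓟 T)) (mem_inf_of_right (mem_principal_self T))
  have hR0 : 0 ≤ R := (norm_nonneg _).trans (hR 0)
  -- Off `T` the zero function is taken. The uniform bounds then hold for every `N`, and only the
  -- indices in `T` matter along the ultrafilter.
  have hex : ∀ N, ∃ w V, IsGrad w V ∧ gradSq (μ N) V ≤ c ∧
      (N ∈ T → eLpNorm (w - ⇑(u N)) 2 (μ N) ≤ ENNReal.ofReal (1 / ((N : ℝ) + 1))) ∧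
      eLpNorm w 2 (μ N) ≤ ENNReal.ofReal (R + 1) := by
    intro N
    by_cases hN : N ∈ T
    · obtain ⟨w, V, hw, h1, h2⟩ := exists_isGrad_near (hH N).1 hN
        (ε := ENNReal.ofReal (1 / ((N : ℝ) + 1))) (ENNReal.ofReal_pos.2 (by positivity))
      refine ⟨w, V, hw, h1.le, fun _ => h2.le, ?_⟩
      have e : w = (w - ⇑(u N)) + ⇑(u N) := by simp
      have h3 : eLpNorm (u N) 2 (μ N) ≤ ENNReal.ofReal R := by
        rw [← Lp.enorm_def, ← ofReal_norm]
        exact ENNReal.ofReal_le_ofReal (hR N)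
      have h4 : ENNReal.ofReal (1 / ((N : ℝ) + 1)) ≤ ENNReal.ofReal 1 :=
        ENNReal.ofReal_le_ofReal (by
          rw [div_le_one (by positivity)]
          have : (0 : ℝ) ≤ N := Nat.cast_nonneg N
          linarith)
      rw [e, ENNReal.ofReal_add hR0 zero_le_one, add_comm (ENNReal.ofReal R)]
      refine (eLpNorm_add_le (hw.bddMeas.1.aestronglyMeasurable.sub (Lp.aestronglyMeasurable _))
        (Lp.aestronglyMeasurable _) (by norm_num)).trans (add_le_add (h2.le.trans h4) h3)
    · have h0 := (isSmoothBdd_of_mem_core (Submodule.zero_mem (core S d))).isGrad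
      have hp : ∀ i, pgrad i (0 : S × (Fin d → ℝ) → ℝ) = 0 := fun i => by
        funext p; simp [pgrad]
      refine ⟨0, _, h0, ?_, fun h => absurd h hN, by simp⟩
      simp [gradSq, hp]
  choose w V hw hVc hwu hwR using hex
  have hwm : ∀ N, MemLp (w N) 2 (μ N) := fun N => (hw N).bddMeas.memLp _ 2
  have hVm : ∀ N i, MemLp (V N i) 2 (μ N) := fun N i =>
    memLp_of_gradSq_lt_top (hw N).measurable ((hVc N).trans_lt hc.lt_top) i
  have hVsum : ∀ N, ∑ i, ∫ p, V N i p ^ 2 ∂μ N ≤ c.toReal := fun N => by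
    have := hVc N
    rw [gradSq_eq_ofReal (hVm N)] at this
    exact (ENNReal.ofReal_le_iff_le_toReal hc).1 this
  have hm' := fun ψ => (hm ψ).mono_left h𝒰
  obtain ⟨v, hv, hvc, hvlim⟩ := exists_weak_limit_grad 𝒰 hm' hVm hVsum
  have hwlim : ∀ ψ : (S × (Fin d → ℝ)) →ᵇ ℝ,
      Tendsto (fun N => ∫ p, w N p * ψ p ∂μ N) 𝒰 (𝓝 (∫ p, u₀ p * ψ p ∂μ₀)) := by
    intro ψ
    have hz : Tendsto (fun N => (∫ p, w N p * ψ p ∂μ N) - ∫ p, u N p * ψ p ∂μ N) 𝒰 (𝓝 0) := by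
      have hb : Tendsto (fun N : ℕ => 1 / ((N : ℝ) + 1) * ‖ψ‖) 𝒰 (𝓝 0) := by
        have := (tendsto_one_div_add_atTop_nhds_zero_nat (𝕜 := ℝ)).mul_const ‖ψ‖
        rw [zero_mul] at this
        exact this.mono_left h𝒰
      refine squeeze_zero_norm' ?_ hb
      filter_upwards [hT] with N hN
      have hψ := memLp_two_bcf (μ N) ψ
      rw [← integral_sub (integrable_mul_of_memLp (hwm N) hψ)
        (integrable_mul_of_memLp (Lp.memLp (u N)) hψ)]
      simp only [← sub_mul]
      have hd : MemLp (fun p => w N p - u N p) 2 (μ N) := (hwm N).sub (Lp.memLp (u N))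
      refine (abs_integral_mul_le hd hψ).trans (mul_le_mul ?_ ?_ (Real.sqrt_nonneg _)
        (by positivity))
      · have h1 : eLpNorm (fun p => w N p - u N p) 2 (μ N) ≤ ENNReal.ofReal (1 / ((N : ℝ) + 1)) :=
          hwu N hN
        exact Real.sqrt_le_iff.2 ⟨by positivity,
          integral_sq_le_of_eLpNorm_le hd (by positivity) h1⟩
      · exact sqrt_integral_sq_bcf_le (μ N) ψ
    have := hz.add ((hu ψ).mono_left h𝒰)
    simpa using this
  set B : ℝ := max ((R + 1) ^ 2) c.toReal
  have key := gradFormMin_le_of_forall_isLimGrad hH₀ hUcount hUc hsup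
    (Lp.aestronglyMeasurable u₀) (hdom u₀).2 hv fun κ hκ => by
      obtain ⟨C, ρ, D, hρ, hρ0, hC, hD0, hDlim, hD⟩ := exists_scales (hUδ κ hκ).1 (hUδ κ hκ).2
      exact isLimGrad_of_weak_limits (B := B) hm' (fun g => (hcond g).mono_left h𝒰)
        (fun N => (hH N).1) ⟨(hUc κ hκ).1.measurable, (hUc κ hκ).2⟩ (hUc κ hκ).1 hρ hρ0 hC hD0
        hDlim hD hw hVm
        (fun N => (integral_sq_le_of_eLpNorm_le (hwm N) (by positivity) (hwR N)).trans
          (le_max_left _ _))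
        (fun N i => ((Finset.single_le_sum (f := fun i => ∫ p, V N i p ^ 2 ∂μ N)
          (fun i _ => integral_nonneg fun p => sq_nonneg _) (Finset.mem_univ i)).trans
            (hVsum N)).trans (le_max_right _ _))
        (Lp.memLp u₀) hv hwlim hvlim
  refine key.trans ?_
  rw [gradSq_eq_ofReal hv]
  exact (ENNReal.ofReal_le_iff_le_toReal hc).2 hvc

theorem gradFormMin_le_liminf
    (hm : ∀ ψ : (S × (Fin d → ℝ)) →ᵇ ℝ,
      Tendsto (fun N => ∫ p, ψ p ∂μ N) atTop (𝓝 (∫ p, ψ p ∂μ₀)))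
    (hH : ∀ N, Hamza (μ N)) (hH₀ : Hamza μ₀) (hcond : CondIntegralsConv μ μ₀)
    (hcut : CutoffCondition μ μ₀) {u : ∀ N, Lp ℝ 2 (μ N)} {u₀ : Lp ℝ 2 μ₀}
    (hu : WeakConv (fun N => classMap (μ N)) (classMap μ₀) u u₀) :
    gradFormMin μ₀ u₀ ≤ liminf (fun N => gradForm (μ N) (u N)) atTop := by
  have hlim := hu.tendsto_integral_mul hm
  obtain ⟨R, hR⟩ := hu.bddAbove_norm fun φ => ⟨‖φ‖, fun N => norm_classMap_le (μ N) φ⟩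
  refine le_of_forall_gt_imp_ge_of_dense fun c hc => ?_
  rcases eq_or_ne c ⊤ with rfl | hct
  · exact le_top
  · exact gradFormMin_le_of_frequently_lt hm hH hH₀ hcond hcut hR hlim hct
      (frequently_lt_of_liminf_lt (by isBoundedDefault) hc)

end LowerBound

/-! ### Recovery sequences -/

section Recovery

theorem tendsto_diagonal {x : ℕ → ℕ → ℝ} {x₀ : ℕ → ℝ} {l : ℝ} (hx₀ : Tendsto x₀ atTop (𝓝 l))
    {σ : ℕ → ℕ} (hσ : Tendsto σ atTop atTop)
    (h : ∀ᶠ N in atTop, |x (σ N) N - x₀ (σ N)| < 1 / ((σ N : ℝ) + 1)) :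
    Tendsto (fun N => x (σ N) N) atTop (𝓝 l) := by
  have h1 : Tendsto (fun N => x (σ N) N - x₀ (σ N)) atTop (𝓝 0) :=
    squeeze_zero_norm' (h.mono fun N hN => hN.le)
      ((tendsto_one_div_add_atTop_nhds_zero_nat (𝕜 := ℝ)).comp hσ)
  simpa using h1.add (hx₀.comp hσ)

/-- Diagonal sequences of bounded continuous functions converge strongly. -/
theorem strongConv_diagonal {X : Type*} [TopologicalSpace X] [MeasurableSpace X] [BorelSpace X]
    [SecondCountableTopology X] {m : ℕ → Measure X} [∀ N, IsProbabilityMeasure (m N)]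
    {m₀ : Measure X} [IsProbabilityMeasure m₀]
    (hm : ∀ ψ : X →ᵇ ℝ, Tendsto (fun N => ∫ x, ψ x ∂m N) atTop (𝓝 (∫ x, ψ x ∂m₀)))
    {w : ℕ → X →ᵇ ℝ} {u₀ : Lp ℝ 2 m₀} (hw : Tendsto (fun k => classMap m₀ (w k)) atTop (𝓝 u₀))
    {σ : ℕ → ℕ} (hσ : Tendsto σ atTop atTop)
    (h : ∀ᶠ N in atTop, |‖classMap (m N) (w (σ N))‖ - ‖classMap m₀ (w (σ N))‖|
        < 1 / ((σ N : ℝ) + 1) ∧ ∀ j ∈ Finset.range (σ N),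
        |‖classMap (m N) (w (σ N) - w j)‖ - ‖classMap m₀ (w (σ N) - w j)‖|
          < 1 / ((σ N : ℝ) + 1)) :
    StrongConv (fun N => classMap (m N)) (classMap m₀) (fun N => classMap (m N) (w (σ N))) u₀ := by
  refine ⟨fun φ => ?_, tendsto_diagonal (x := fun k N => ‖classMap (m N) (w k)‖) hw.norm hσ
    (h.mono fun N hN => hN.1)⟩
  rw [Metric.tendsto_nhds]
  intro ε hε
  set δ := ε / (3 * ‖φ‖ + 2) with hδ
  have hδ0 : 0 < δ := by positivity
  -- The diagonal term is compared with a fixed `w J`: their distance in `L²(μ₀)` is below `δ`, and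
  -- the norm condition carries this over to `L²(m N)` up to another `δ`. The total error is below
  -- `(3 * ‖φ‖ + 1) * δ`.
  obtain ⟨J₁, hJ₁⟩ := Metric.cauchySeq_iff.1 hw.cauchySeq δ hδ0
  obtain ⟨J₂, hJ₂⟩ := eventually_atTop.1 (Metric.tendsto_nhds.1 hw δ hδ0)
  set J := max J₁ J₂
  have hJa := (strongConv_classMap hm (w J)).1 φ
  filter_upwards [h, hσ.eventually_gt_atTop J, Metric.tendsto_nhds.1 hJa δ hδ0,
    ((tendsto_one_div_add_atTop_nhds_zero_nat (𝕜 := ℝ)).comp hσ).eventually_lt_const hδ0]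
    with N hN hσN hN2 hN3
  simp only [Function.comp] at hN3
  have h1 := hN.2 J (Finset.mem_range.2 hσN)
  have h2 := hJ₁ (σ N) ((le_max_left _ _).trans hσN.le) J (le_max_left _ _)
  have h3 := hJ₂ J (le_max_right _ _)
  rw [dist_eq_norm, ← map_sub] at h2
  rw [dist_eq_norm] at h3
  rw [Real.dist_eq] at hN2 ⊢
  have h4 : ‖classMap (m N) (w (σ N) - w J)‖ ≤ 2 * δ := by
    have := (abs_lt.1 h1).2
    linarith
  have c1 : |inner ℝ (classMap (m N) (w (σ N) - w J)) (classMap (m N) φ)| ≤ 2 * δ * ‖φ‖ :=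
    (abs_real_inner_le_norm _ _).trans
      (mul_le_mul h4 (norm_classMap_le (m N) φ) (norm_nonneg _) (by positivity))
  have c2 : |inner ℝ (classMap m₀ (w J) - u₀) (classMap m₀ φ)| ≤ δ * ‖φ‖ :=
    (abs_real_inner_le_norm _ _).trans
      (mul_le_mul h3.le (norm_classMap_le m₀ φ) (norm_nonneg _) hδ0.le)
  rw [map_sub, inner_sub_left] at c1
  rw [inner_sub_left] at c2
  have e : (3 * ‖φ‖ + 2) * δ = ε := by
    rw [hδ]
    field_simp
  have d1 := abs_le.1 c1
  have d2 := abs_le.1 c2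
  have d3 := abs_lt.1 hN2
  rw [abs_lt]
  constructor <;> nlinarith

variable {d : ℕ} {S : Type*} [MeasurableSpace S] [TopologicalSpace S]
  {μ : ℕ → Measure (S × (Fin d → ℝ))} {μ₀ : Measure (S × (Fin d → ℝ))}

/-- Functions of the core as bounded continuous functions. -/
def coreBcf {w : S × (Fin d → ℝ) → ℝ} (hw : w ∈ core S d) : (S × (Fin d → ℝ)) →ᵇ ℝ :=
  BoundedContinuousFunction.ofNormedAddCommGroup w (isSmoothBdd_of_mem_core hw).continuous
    (isSmoothBdd_of_mem_core hw).bdd.choose (isSmoothBdd_of_mem_core hw).bdd.choose_spec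

/-- The squared partial derivatives are themselves bounded continuous functions. -/
theorem tendsto_energy_of_mem_core
    (hm : ∀ ψ : (S × (Fin d → ℝ)) →ᵇ ℝ,
      Tendsto (fun N => ∫ p, ψ p ∂μ N) atTop (𝓝 (∫ p, ψ p ∂μ₀)))
    {w : S × (Fin d → ℝ) → ℝ} (hw : w ∈ core S d) :
    Tendsto (fun N => ∑ i, ∫ p, pgrad i w p ^ 2 ∂μ N) atTop
      (𝓝 (∑ i, ∫ p, pgrad i w p ^ 2 ∂μ₀)) := by
  have hs := isSmoothBdd_of_mem_core hw
  refine tendsto_finsetSum _ fun i _ => ?_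
  obtain ⟨M, hM⟩ := hs.bdd_grad i
  exact hm (BoundedContinuousFunction.ofNormedAddCommGroup (fun p => pgrad i w p ^ 2)
    ((hs.continuous_grad i).pow 2) (M ^ 2) fun p => by
      rw [Real.norm_of_nonneg (sq_nonneg _)]
      exact sq_le_sq' (abs_le.1 (hM p)).1 (abs_le.1 (hM p)).2)

variable [BorelSpace S]

theorem gradForm_of_mem_core {μ : Measure (S × (Fin d → ℝ))} [IsProbabilityMeasure μ]
    (hH : Hamza μ) {w : S × (Fin d → ℝ) → ℝ} (hw : w ∈ core S d) :
    gradForm μ w = ENNReal.ofReal (∑ i, ∫ p, pgrad i w p ^ 2 ∂μ) := by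
  rw [gradForm_eq_cutForm, cutForm_of_mem_core μ hH isCut_one (fun _ => continuous_const) hw,
    cutMeasure_one, gradSq_eq_ofReal fun i => (isSmoothBdd_of_mem_core hw).memLp_pgrad μ i]

variable [PolishSpace S] [∀ N, IsProbabilityMeasure (μ N)] [IsProbabilityMeasure μ₀]

theorem exists_recovery
    (hm : ∀ ψ : (S × (Fin d → ℝ)) →ᵇ ℝ,
      Tendsto (fun N => ∫ p, ψ p ∂μ N) atTop (𝓝 (∫ p, ψ p ∂μ₀)))
    (hH : ∀ N, Hamza (μ N)) (hH₀ : Hamza μ₀) {u₀ : Lp ℝ 2 μ₀} (h : gradFormMin μ₀ u₀ < ⊤) :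
    ∃ u : ∀ N, Lp ℝ 2 (μ N), (∀ N, gradForm (μ N) (u N) < ⊤) ∧
      StrongConv (fun N => classMap (μ N)) (classMap μ₀) u u₀ ∧
      Tendsto (fun N => gradForm (μ N) (u N)) atTop (𝓝 (gradFormMin μ₀ u₀)) := by
  have hmin : MemGradMin μ₀ u₀ := by
    by_contra hn
    rw [gradFormMin, if_neg hn] at h
    exact lt_irrefl _ h
  have hcm := (memGradMin_iff_memCutMin μ₀ u₀).1 hmin
  have hu1 : AEStronglyMeasurable u₀ (cutMeasure μ₀ fun _ => 1) := by
    rw [cutMeasure_one]; exact Lp.aestronglyMeasurable u₀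
  obtain ⟨V, hV, hVlim, hVeq⟩ := hcm.exists_isLimGrad μ₀ hH₀ isCut_one
    (fun _ => continuous_const) hu1
  rw [cutMeasure_one] at hV hVlim hVeq
  rw [gradFormMin, if_pos hmin, gradForm_eq_cutForm, hVeq]
  obtain ⟨w, hw, hwu, hwV⟩ := hVlim
  set W : ℕ → (S × (Fin d → ℝ)) →ᵇ ℝ := fun k => coreBcf (hw k)
  have hWae : ∀ (ρ : Measure (S × (Fin d → ℝ))) [IsFiniteMeasure ρ] (k : ℕ),
      classMap ρ (W k) =ᵐ[ρ] w k := fun ρ _ k =>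
    BoundedContinuousFunction.coeFn_toLp 2 ρ ℝ (W k)
  have hWlim : Tendsto (fun k => classMap μ₀ (W k)) atTop (𝓝 u₀) := by
    rw [Lp.tendsto_Lp_iff_tendsto_eLpNorm']
    exact hwu.congr fun k => eLpNorm_congr_ae ((hWae μ₀ k).symm.sub .rfl)
  set E : ℕ → ℕ → ℝ := fun k N => ∑ i, ∫ p, pgrad i (w k) p ^ 2 ∂μ N
  set E₀ : ℕ → ℝ := fun k => ∑ i, ∫ p, pgrad i (w k) p ^ 2 ∂μ₀
  have hpm : ∀ k i, MemLp (pgrad i (w k)) 2 μ₀ := fun k i =>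
    (isSmoothBdd_of_mem_core (hw k)).memLp_pgrad μ₀ i
  have hEnn : ∀ k, 0 ≤ E₀ k := fun k =>
    Finset.sum_nonneg fun i _ => integral_nonneg fun p => sq_nonneg _
  have hE₀ : Tendsto E₀ atTop (𝓝 (∑ i, ∫ p, V i p ^ 2 ∂μ₀)) := by
    have h1 := tendsto_gradSq_of_tendsto_sub (fun k i => (hpm k i).1) hV hwV
    have h2 := (ENNReal.tendsto_toReal (gradSq_lt_top hV).ne).comp h1
    rw [gradSq_eq_ofReal hV, ENNReal.toReal_ofReal
      (Finset.sum_nonneg fun i _ => integral_nonneg fun p => sq_nonneg _)] at h2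
    refine h2.congr fun k => ?_
    simp only [Function.comp]
    rw [gradSq_eq_ofReal (hpm k), ENNReal.toReal_ofReal (hEnn k)]
  -- At level `k` the index must control the energy of `w k`, its norm, and its distances to all
  -- earlier terms. The distances give weak convergence along the diagonal.
  obtain ⟨σ, hσ, hev⟩ := exists_diagonal (p := fun k N => |E k N - E₀ k| < 1 / ((k : ℝ) + 1) ∧
      |‖classMap (μ N) (W k)‖ - ‖classMap μ₀ (W k)‖| < 1 / ((k : ℝ) + 1) ∧
      ∀ j ∈ Finset.range k, |‖classMap (μ N) (W k - W j)‖ - ‖classMap μ₀ (W k - W j)‖|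
        < 1 / ((k : ℝ) + 1)) fun k => by
    have hk : (0 : ℝ) < 1 / ((k : ℝ) + 1) := by positivity
    refine (Metric.tendsto_nhds.1 (tendsto_energy_of_mem_core hm (hw k)) _ hk).and
      ((Metric.tendsto_nhds.1 (strongConv_classMap hm (W k)).2 _ hk).and
        ((eventually_all_finset _).2 fun j _ =>
          Metric.tendsto_nhds.1 (strongConv_classMap hm (W k - W j)).2 _ hk))
  have hform : ∀ N, gradForm (μ N) (classMap (μ N) (W (σ N))) = ENNReal.ofReal (E (σ N) N) :=
    fun N => (closedForm_congr (hWae (μ N) (σ N))).trans (gradForm_of_mem_core (hH N) (hw (σ N)))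
  refine ⟨fun N => classMap (μ N) (W (σ N)), fun N => ?_,
    strongConv_diagonal hm hWlim hσ (hev.mono fun N hN => hN.2), ?_⟩
  · rw [hform]
    exact ENNReal.ofReal_lt_top
  · simp only [hform]
    rw [gradSq_eq_ofReal hV]
    exact ENNReal.tendsto_ofReal (tendsto_diagonal hE₀ hσ (hev.mono fun N hN => hN.1))

end Recovery

end MoscoSuperposition

end

theorem theorem3p9 {S : Type*} [TopologicalSpace S] [PolishSpace S] [MeasurableSpace S]
    [BorelSpace S] {d : ℕ} (hd : 0 < d)
    (μ : ℕ → ProbabilityMeasure (S × (Fin d → ℝ))) (μ₀ : ProbabilityMeasure (S × (Fin d → ℝ)))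
    (hμ : Tendsto μ atTop (𝓝 μ₀))
    (hsupp : ∀ N, (μ N : Measure (S × (Fin d → ℝ))).support ⊆
      (μ₀ : Measure (S × (Fin d → ℝ))).support)
    (hHamza : ∀ N, Hamza (μ N : Measure (S × (Fin d → ℝ))))
    (hHamza₀ : Hamza (μ₀ : Measure (S × (Fin d → ℝ))))
    (hcond : CondIntegralsConv (fun N => (μ N : Measure (S × (Fin d → ℝ)))) μ₀)
    (hcut : CutoffCondition (fun N => (μ N : Measure (S × (Fin d → ℝ)))) μ₀) :
    MoscoConv (fun N => classMap (μ N : Measure (S × (Fin d → ℝ))))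
      (classMap (μ₀ : Measure (S × (Fin d → ℝ))))
      (fun N (u : Lp ℝ 2 (μ N : Measure (S × (Fin d → ℝ)))) => gradForm (μ N) u)
      (fun u : Lp ℝ 2 (μ₀ : Measure (S × (Fin d → ℝ))) => gradFormMin μ₀ u) := by
  have hm : ∀ ψ : (S × (Fin d → ℝ)) →ᵇ ℝ,
      Tendsto (fun N => ∫ p, ψ p ∂(μ N : Measure (S × (Fin d → ℝ)))) atTop
        (𝓝 (∫ p, ψ p ∂(μ₀ : Measure (S × (Fin d → ℝ))))) :=
    ProbabilityMeasure.tendsto_iff_forall_integral_tendsto.1 hμ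
  exact ⟨fun u u₀ hu => gradFormMin_le_liminf hm hHamza hHamza₀ hcond hcut hu,
    fun u₀ hu₀ => exists_recovery hm hHamza hHamza₀ hu₀⟩
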